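/- Let $k$ be a field and let $S=\bigoplus_{\mathbf n\in\mathbb N^r}S_{\mathbf n}$ be a Noetherian $\mathbb N^r$-graded $k$-algebra with $S_0=k$ that is Cohen--Macaulay of Krull dimension $d$; let $\mathcal M=\bigoplus_{\mathbf n\neq 0}S_{\mathbf n}$ be its homogeneous maximal ideal. Let $M$ be a finitely generated $\mathbb Z^r$-graded $S$-module of dimension $m$ and depth $\rho$ (the supremum of the lengths of $M$-regular sequences in $\mathcal M$) that has a finite minimal $\mathbb Z^r$-graded free resolution $$0\to D_l\to\cdots\to D_1\to D_0\to M\to 0,\qquad D_p=\bigoplus_q S(\mathbf a_{pq}),\quad \mathbf a_{pq}=(a^1_{pq},\dots,a^r_{pq})\in\mathbb Z^r,$$ with finite direct sums, where $S(\mathbf a)_{\mathbf n}=S_{\mathbf a+\mathbf n}$, the maps preserve degrees, and minimality means that the image of $D_{p+1}$ lies in $\mathcal M D_p$ for all $p\ge 0$; put $D_p=0$ for $p>l$. Let $H^i_{\mathcal M}$ be the $i$-th right derived functor of $\Gamma_{\mathcal M}(N)=\{x\in N:\mathcal M^t x=0\text{ for some }t\ge 0\}$ on the category of $\mathbb Z^r$-graded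 $S$-modules. For a finitely generated graded module $N$ and $1\le j\le r$ let $$a_i^j(N)=\max\{n^j:\ \mathbf n\in\mathbb Z^r,\ [H^i_{\mathcal M}(N)]_{\mathbf n}\neq 0\}$$ (and $-\infty$ if $H^i_{\mathcal M}(N)=0$), $a^j(S)=a^j_d(S)$ and $a_*^j(M)=\max_{0\le i\le m}a_i^j(M)$. Let $t_p^j(M)=\max_q\{-a^j_{pq}\}$ and $t_*^j(M)=\max_{0\le p\le l}t_p^j(M)$. For a permutation $\sigma$ of $\{1,\dots,r\}$ write $\mathbf u\le_\sigma\mathbf v$ if $(u_{\sigma(1)},\dots,u_{\sigma(r)})\le_{\mathrm{lex}}(v_{\sigma(1)},\dots,v_{\sigma(r)})$, and let $\mathbf M_p^\sigma=\max_{\le_\sigma}\{-\mathbf a_{pq}\}_q$. The maximum of the empty set is $-\infty$. Then for every $j=1,\dots,r$ the maxima defining $a^j_i(M)$ and $a^j(S)$ exist, $a^j(S)$ is an integer, and: 1. $a_{d-p}^j(M)\le t_p^j(M)+a^j(S)$ for $d-m\le p\le d-\rho$. 2. If for some $p\ge 0$ there is a permutation $\sigma$ with $\sigma(1)=j$ and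 $\mathbf M_p^\sigma>_\sigma\mathbf M_{p+1}^\sigma$, then $p\le d$ and $a_{d-p}^j(M)=t_p^j(M)+a^j(S)$. 3. $a_*^j(M)=t_*^j(M)+a^j(S)$; that is, $\mathbf a_*(M)=\mathbf t_*(M)+\mathbf a(S)$, where $\mathbf a_*(M)=(a_*^j(M))_j$, $\mathbf t_*(M)=(t_*^j(M))_j$ and $\mathbf a(S)=(a^j(S))_j$. -/

import Mathlib

universe u v

open scoped DirectSum

/-- A `ℤ^r`-graded module over a `ℤ^r`-graded ring `S = ⨁ 𝒜 n`: an `S`-module with a direct sum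
decomposition into additive subgroups `gr n` such that `𝒜 m • gr n ⊆ gr (m + n)`. -/
structure GrMod {r : ℕ} {S : Type u} [CommRing S] (𝒜 : (Fin r → ℤ) → AddSubgroup S) where
  carrier : Type u
  [addCommGroup : AddCommGroup carrier]
  [module : Module S carrier]
  gr : (Fin r → ℤ) → AddSubgroup carrier
  isInternal : DirectSum.IsInternal gr
  smul_mem : ∀ (m n : Fin r → ℤ) (a : S) (x : carrier),
    a ∈ 𝒜 m → x ∈ gr n → a • x ∈ gr (m + n)

attribute [instance] GrMod.addCommGroup GrMod.module

/-- The submodule `Γ_I(X)` of the elements killed by a power of the ideal `I`. -/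
def gammaTorsion {S : Type u} [CommRing S] (I : Ideal S) (X : Type u) [AddCommGroup X]
    [Module S X] : Submodule S X where
  carrier := {x | ∃ t : ℕ, ∀ a ∈ I ^ t, a • x = 0}
  zero_mem' := ⟨0, fun a _ => smul_zero a⟩
  add_mem' := by
    rintro x y ⟨s, hs⟩ ⟨t, ht⟩
    refine ⟨s + t, fun a ha => ?_⟩
    rw [smul_add, hs a (Ideal.pow_le_pow_right (Nat.le_add_right s t) ha),
      ht a (Ideal.pow_le_pow_right (Nat.le_add_left t s) ha), add_zero]
  smul_mem' := by
    rintro c x ⟨t, ht⟩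
    exact ⟨t, fun a ha => by rw [smul_comm, ht a ha, smul_zero]⟩

/-- A Noetherian local ring is Cohen–Macaulay if its maximal ideal contains a regular sequence
whose length is the Krull dimension of the ring. -/
def IsCohenMacaulayLocal (R : Type u) [CommRing R] [IsLocalRing R] : Prop :=
  ∃ rs : List R, (∀ x ∈ rs, x ∈ IsLocalRing.maximalIdeal R) ∧
    RingTheory.Sequence.IsRegular R rs ∧ (rs.length : WithBot ℕ∞) = ringKrullDim R

/-- A Noetherian ring is Cohen–Macaulay if all its localizations at primes are. -/
def IsCohenMacaulay (S : Type u) [CommRing S] : Prop :=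
  IsNoetherianRing S ∧
    ∀ (P : Ideal S) [P.IsPrime], IsCohenMacaulayLocal (Localization.AtPrime P)

/-- The integers with `-∞` and `+∞` added. -/
abbrev ExtInt : Type := WithBot (WithTop ℤ)

/-- The inclusion of the integers in the extended integers. -/
def ExtInt.ofInt (z : ℤ) : ExtInt := ((z : WithTop ℤ) : WithBot (WithTop ℤ))

namespace GrMod

section

variable {r : ℕ} {S : Type u} [CommRing S] {𝒜 : (Fin r → ℤ) → AddSubgroup S}

/-- An `S`-linear map is a morphism of graded modules if it preserves degrees. -/
def IsHom {M N : GrMod 𝒜} (f : M.carrier →ₗ[S] N.carrier) : Prop :=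
  ∀ (n : Fin r → ℤ) (x : M.carrier), x ∈ M.gr n → f x ∈ N.gr n

/-- Injective objects of the category of graded `S`-modules. -/
def IsInjective (E : GrMod 𝒜) : Prop :=
  ∀ (A B : GrMod 𝒜) (i : A.carrier →ₗ[S] B.carrier) (f : A.carrier →ₗ[S] E.carrier),
    IsHom i → Function.Injective i → IsHom f →
      ∃ g : B.carrier →ₗ[S] E.carrier, IsHom g ∧ g ∘ₗ i = f

/-- The ideal generated by the homogeneous elements of nonzero degree. When `S` is `ℕ^r`-graded
and `S_0` is a field, it is the homogeneous maximal ideal of `S`. -/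
def maxIdeal (𝒜 : (Fin r → ℤ) → AddSubgroup S) : Ideal S :=
  Ideal.span {x | ∃ n : Fin r → ℤ, n ≠ 0 ∧ x ∈ 𝒜 n}

/-- An injective resolution `0 → M → I 0 → I 1 → ⋯` in the category of graded `S`-modules. -/
structure InjRes (M : GrMod 𝒜) where
  I : ℕ → GrMod 𝒜
  inj : ∀ p, (I p).IsInjective
  ε : M.carrier →ₗ[S] (I 0).carrier
  δ : ∀ p, (I p).carrier →ₗ[S] (I (p + 1)).carrier
  ε_hom : IsHom ε
  δ_hom : ∀ p, IsHom (δ p)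
  ε_injective : Function.Injective ε
  exact_zero : Function.Exact ε (δ 0)
  exact_succ : ∀ p, Function.Exact (δ p) (δ (p + 1))

namespace InjRes

variable {M : GrMod 𝒜} (R : InjRes M)

/-- The degree `n` component of the module of `i`-cochains of the complex `Γ_𝓜(I)`. -/
def cochains (i : ℕ) (n : Fin r → ℤ) : AddSubgroup (R.I i).carrier :=
  (R.I i).gr n ⊓ (gammaTorsion (maxIdeal 𝒜) (R.I i).carrier).toAddSubgroup

/-- The degree `n` component of the module of `i`-cocycles of the complex `Γ_𝓜(I)`. -/
def cocycles (i : ℕ) (n : Fin r → ℤ) : AddSubgroup (R.I i).carrier :=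
  R.cochains i n ⊓ (LinearMap.ker (R.δ i)).toAddSubgroup

/-- The degree `n` component of the module of `i`-coboundaries of the complex `Γ_𝓜(I)`. -/
def coboundaries : (i : ℕ) → (n : Fin r → ℤ) → AddSubgroup (R.I i).carrier
  | 0, _ => ⊥
  | i + 1, n => (R.cochains i n).map (R.δ i).toAddMonoidHom

/-- The degree `n` component of the `i`-th cohomology of the complex `Γ_𝓜(I)`. -/
abbrev cohomology (i : ℕ) (n : Fin r → ℤ) : Type u :=
  R.cocycles i n ⧸ (R.coboundaries i n).addSubgroupOf (R.cocycles i n)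

end InjRes

/-- The support of the local cohomology module `H^i_𝓜(M)`, the `i`-th right derived functor of
`Γ_𝓜` on graded `S`-modules: the degrees `n` with `[H^i_𝓜(M)]_n ≠ 0`. Up to isomorphism the
cohomology of `Γ_𝓜(I)` does not depend on the injective resolution `I`. -/
def localCohomologySupport (M : GrMod 𝒜) (i : ℕ) : Set (Fin r → ℤ) :=
  {n | ∃ R : InjRes M, Nontrivial (R.cohomology i n)}

/-- The invariant `a_i^j(M)`: the largest `j`-th component of a degree in which `H^i_𝓜(M)` is
nonzero; it is `-∞` if `H^i_𝓜(M) = 0`, and `+∞` if these components are unbounded above. -/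
noncomputable def aInv (M : GrMod 𝒜) (i : ℕ) (j : Fin r) : ExtInt :=
  ⨆ n ∈ M.localCohomologySupport i, ExtInt.ofInt (n j)

/-- The invariant `a_*^j(M)`: the maximum of `a_i^j(M)` for `0 ≤ i ≤ dim M`. -/
noncomputable def aStar (M : GrMod 𝒜) (j : Fin r) : ExtInt :=
  ⨆ i ∈ {i : ℕ | (i : WithBot ℕ∞) ≤ Module.supportDim S M.carrier}, M.aInv i j

/-- The depth of `M`: the supremum of the lengths of the `M`-regular sequences in the
homogeneous maximal ideal. -/
noncomputable def depth (M : GrMod 𝒜) : ℕ∞ :=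
  ⨆ rs ∈ {rs : List S | (∀ x ∈ rs, x ∈ maxIdeal 𝒜) ∧
    RingTheory.Sequence.IsRegular M.carrier rs}, (rs.length : ℕ∞)

end

section

variable {r : ℕ} {S : Type u} [CommRing S] (𝒜 : (Fin r → ℤ) → AddSubgroup S) [GradedRing 𝒜]

/-- The graded ring as a graded module over itself. -/
def self : GrMod 𝒜 where
  carrier := S
  gr := 𝒜
  isInternal := DirectSum.Decomposition.isInternal 𝒜
  smul_mem _ _ _ _ ha hx := SetLike.GradedMul.mul_mem ha hx

/-- The degree `n` component of `⨁_q S(a_q)`, where `S(a)_n = S_{a + n}`. -/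
def freeGr {b : ℕ} (a : Fin b → Fin r → ℤ) (n : Fin r → ℤ) : AddSubgroup (Fin b → S) where
  carrier := {x | ∀ q, x q ∈ 𝒜 (a q + n)}
  zero_mem' q := (𝒜 (a q + n)).zero_mem
  add_mem' hx hy q := (𝒜 (a q + n)).add_mem (hx q) (hy q)
  neg_mem' hx q := (𝒜 (a q + n)).neg_mem (hx q)

theorem freeGr_decompose {b : ℕ} (a : Fin b → Fin r → ℤ) (x : ⨁ n, freeGr 𝒜 a n)
    (q : Fin b) (n : Fin r → ℤ) :
    (DirectSum.decompose 𝒜 (DirectSum.coeAddMonoidHom (freeGr 𝒜 a) x q) (a q + n) : S) =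
      (x n : Fin b → S) q := by
  induction x using DirectSum.induction_on with
  | zero => simp
  | of i y =>
    rw [DirectSum.coeAddMonoidHom_of]
    by_cases h : i = n
    · subst h
      rw [DirectSum.decompose_of_mem_same 𝒜 (y.2 q), DirectSum.of_eq_same]
    · rw [DirectSum.decompose_of_mem_ne 𝒜 (y.2 q) (fun h' => h (add_left_cancel h')),
        DirectSum.of_eq_of_ne _ _ _ (Ne.symm h)]
      rfl
  | add x y hx hy =>
    rw [map_add, Pi.add_apply, DirectSum.decompose_add, DirectSum.add_apply, DirectSum.add_apply]
    simp [hx, hy]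

theorem freeGr_isInternal {b : ℕ} (a : Fin b → Fin r → ℤ) :
    DirectSum.IsInternal (freeGr 𝒜 a) := by
  classical
  refine ⟨(injective_iff_map_eq_zero _).2 fun x hx => ?_, fun v => ?_⟩
  · refine DFinsupp.ext fun n => Subtype.ext (funext fun q => ?_)
    have h := freeGr_decompose 𝒜 a x q n
    rw [hx, Pi.zero_apply, DirectSum.decompose_zero] at h
    exact h.symm
  · change v ∈ (DirectSum.coeAddMonoidHom (freeGr 𝒜 a)).range
    rw [← Finset.univ_sum_single v]
    refine AddSubgroup.sum_mem _ fun q _ => ?_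
    rw [← DirectSum.sum_support_decompose 𝒜 (v q)]
    change AddMonoidHom.single (fun _ : Fin b => S) q _ ∈ _
    rw [map_sum]
    refine AddSubgroup.sum_mem _ fun n _ => ?_
    refine ⟨DirectSum.of (fun i => freeGr 𝒜 a i) (n - a q)
      ⟨Pi.single q (DirectSum.decompose 𝒜 (v q) n : S), fun q' => ?_⟩, ?_⟩
    · by_cases h : q' = q
      · subst h
        rw [Pi.single_eq_same, add_sub_cancel]
        exact (DirectSum.decompose 𝒜 (v q') n).2
      · rw [Pi.single_eq_of_ne h]
        exact AddSubgroup.zero_mem _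
    · rw [DirectSum.coeAddMonoidHom_of]
      rfl

/-- The graded free module `⨁_q S(a_q)`. -/
def free {b : ℕ} (a : Fin b → Fin r → ℤ) : GrMod 𝒜 where
  carrier := Fin b → S
  gr := freeGr 𝒜 a
  isInternal := freeGr_isInternal 𝒜 a
  smul_mem m n c x hc hx q := by
    have h : c * x q ∈ 𝒜 (m + (a q + n)) := SetLike.GradedMul.mul_mem hc (hx q)
    rw [add_left_comm] at h
    exact h

end

/-- A finite minimal graded free resolution `0 → D_l → ⋯ → D_0 → M → 0` with
`D_p = ⨁_q S(a_{pq})`, where `a_{pq} = shift p q` and `1 ≤ q ≤ rank p`. -/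
structure MinFreeRes {r : ℕ} {S : Type u} [CommRing S] {𝒜 : (Fin r → ℤ) → AddSubgroup S}
    [GradedRing 𝒜] (M : GrMod 𝒜) where
  rank : ℕ → ℕ
  shift : ∀ p, Fin (rank p) → Fin r → ℤ
  ε : (free 𝒜 (shift 0)).carrier →ₗ[S] M.carrier
  δ : ∀ p, (free 𝒜 (shift (p + 1))).carrier →ₗ[S] (free 𝒜 (shift p)).carrier
  ε_hom : IsHom ε
  δ_hom : ∀ p, IsHom (δ p)
  ε_surjective : Function.Surjective ε
  exact_zero : Function.Exact (δ 0) ε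
  exact_succ : ∀ p, Function.Exact (δ (p + 1)) (δ p)
  minimal : ∀ p, LinearMap.range (δ p) ≤
    maxIdeal 𝒜 • (⊤ : Submodule S (free 𝒜 (shift p)).carrier)
  l : ℕ
  finite : ∀ p, l < p → rank p = 0

namespace MinFreeRes

variable {r : ℕ} {S : Type u} [CommRing S] {𝒜 : (Fin r → ℤ) → AddSubgroup S} [GradedRing 𝒜]
  {M : GrMod 𝒜} (D : MinFreeRes M)

/-- `t_p^j(M) = max_q (-a_{pq}^j)`, which is `-∞` if `D_p = 0`. -/
noncomputable def t (p : ℕ) (j : Fin r) : ExtInt :=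
  Finset.univ.sup fun q : Fin (D.rank p) => ExtInt.ofInt (-D.shift p q j)

/-- `t_*^j(M) = max_p t_p^j(M)` for `0 ≤ p ≤ l`. -/
noncomputable def tStar (j : Fin r) : ExtInt :=
  (Finset.range (D.l + 1)).sup fun p => D.t p j

/-- The maximum, for the order `≤_σ`, of the vectors `-a_{pq}` (it is `-∞` if `D_p = 0`). Here
`u ≤_σ v` if and only if `(u_{σ(1)}, …, u_{σ(r)})` is lexicographically at most
`(v_{σ(1)}, …, v_{σ(r)})`, so a vector `u` is recorded as `(u_{σ(1)}, …, u_{σ(r)})`. -/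
noncomputable def lexMax (σ : Equiv.Perm (Fin r)) (p : ℕ) : WithBot (Lex (Fin r → ℤ)) :=
  Finset.univ.sup fun q : Fin (D.rank p) =>
    ((toLex fun i => -D.shift p q (σ i) : Lex (Fin r → ℤ)) : WithBot (Lex (Fin r → ℤ)))

end MinFreeRes

end GrMod

/-!
For a ring `S` as in the theorem, graded local cohomology vanishes above degree `d`, and that of `S`
itself is concentrated in degree `d`. Two facts reduce this to the Cohen–Macaulay property of the
local ring `S_𝓜`. First, `𝓜` has height `d`. Extend the coaction `S → S[T, T⁻¹]`,
`∑ s_n ↦ ∑ s_n T^{-|n|}`, to `S[T]` by `T ↦ T`. For a prime `P` not containing `𝓜`, the preimage of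
`P[T, T⁻¹]` is a prime of `S[T]` of height at least that of `P`, and it contracts to a prime of `S`
properly contained in `𝓜`, which lowers the height by at most one. Second, the regular sequence of
length `d` in `S_𝓜` forces `Ext^i(L, S) = 0` for `i < d` and every finitely generated `L` killed by
a power of `𝓜`.

Splitting a free resolution `D` of `M` into short exact sequences of syzygies, a nonzero class in
`[H^{d-p}_𝓜(M)]_n` propagates to `[H^d_𝓜(D_p)]_n = ⨁_q [H^d_𝓜(S)]_{n + a_{pq}}`, which gives the
upper bound. Conversely let `m` be the `≤_σ`-largest degree with `[H^d_𝓜(S)]_m ≠ 0` and let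
`-a_{pq}` be the `≤_σ`-largest shift of `D_p`. In the degree `m - a_{pq}` the group `H^d_𝓜(D_p)` is
nonzero, `H^d_𝓜(D_{p+1})` vanishes because its shifts are smaller, and `H^d_𝓜` of the differential
`D_p → D_{p-1}` is zero: by minimality the nonzero entries of its matrix have positive degree, so
they map to summands whose local cohomology vanishes there. Hence the class survives and descends
to `[H^{d-p}_𝓜(M)]_{m - a_{pq}}`, and the bound is attained.
-/

theorem ExtInt.ofInt_le_ofInt {a b : ℤ} : ExtInt.ofInt a ≤ ExtInt.ofInt b ↔ a ≤ b :=
  WithBot.coe_le_coe.trans WithTop.coe_le_coe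

theorem ExtInt.ofInt_add (a b : ℤ) : ExtInt.ofInt (a + b) = ExtInt.ofInt a + ExtInt.ofInt b := rfl

theorem ExtInt.ofInt_ne_top (a : ℤ) : ExtInt.ofInt a ≠ ⊤ :=
  fun h => WithTop.coe_ne_top (WithBot.coe_injective h)

namespace GrMod

variable {r : ℕ} {S : Type u} [CommRing S] {𝒜 : (Fin r → ℤ) → AddSubgroup S}

/-! ### Graded modules and their morphisms -/

theorem isInternal_of_separating {ι X Y : Type*} [DecidableEq ι] [AddCommGroup X] [AddCommGroup Y]
    (gr : ι → AddSubgroup X)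
    (hsep : ∀ n x, x ∈ gr n → x ≠ 0 →
      ∃ q : X →+ Y, q x ≠ 0 ∧ ∀ m, m ≠ n → ∀ y ∈ gr m, q y = 0)
    (htop : ∀ x, x ∈ ⨆ n, gr n) : DirectSum.IsInternal gr := by
  refine ⟨(injective_iff_map_eq_zero _).2 fun x hx => DFinsupp.ext fun n => Subtype.ext ?_,
    fun x => ?_⟩
  · by_contra hne
    obtain ⟨q, hq, hq_ne⟩ := hsep n (x n) (x n).2 hne
    have q_sum (y : ⨁ n, gr n) : q (DirectSum.coeAddMonoidHom gr y) = q (y n) := by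
      induction y using DirectSum.induction_on with
      | zero => simp
      | of i y =>
        rw [DirectSum.coeAddMonoidHom_of]
        by_cases h : i = n
        · subst h; rw [DirectSum.of_eq_same]
        · rw [DirectSum.of_eq_of_ne _ _ _ (Ne.symm h), hq_ne i h _ y.2]; simp
      | add x y hx hy => simp only [map_add, hx, hy, DirectSum.add_apply, AddSubgroup.coe_add]
    exact hq (by rw [← q_sum x, hx, map_zero])
  · have hle : ⨆ n, gr n ≤ (DirectSum.coeAddMonoidHom gr).range := iSup_le fun n y hy =>
      ⟨DirectSum.of (fun i => gr i) n ⟨y, hy⟩, DirectSum.coeAddMonoidHom_of gr n ⟨y, hy⟩⟩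
    exact hle (htop x)

section Basic

variable (M : GrMod 𝒜)

noncomputable instance : DirectSum.Decomposition M.gr := M.isInternal.chooseDecomposition _

/-- The projection of a graded module onto its component of degree `n`, as an endomorphism of the
underlying group. -/
noncomputable def proj (n : Fin r → ℤ) : M.carrier →+ M.carrier :=
  (M.gr n).subtype.comp ((DFinsupp.evalAddMonoidHom n).comp
    (DirectSum.decomposeAddEquiv M.gr).toAddMonoidHom)

theorem proj_mem (n : Fin r → ℤ) (x : M.carrier) : M.proj n x ∈ M.gr n :=
  (DirectSum.decompose M.gr x n).2

theorem proj_of_mem {n : Fin r → ℤ} {x : M.carrier} (hx : x ∈ M.gr n) : M.proj n x = x :=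
  DirectSum.decompose_of_mem_same M.gr hx

theorem proj_of_mem_ne {m n : Fin r → ℤ} {x : M.carrier} (hx : x ∈ M.gr m) (h : m ≠ n) :
    M.proj n x = 0 :=
  DirectSum.decompose_of_mem_ne M.gr hx h

theorem exists_eq_sum_proj (x : M.carrier) :
    ∃ s : Finset (Fin r → ℤ), x = ∑ n ∈ s, M.proj n x ∧ ∀ n ∉ s, M.proj n x = 0 := by
  classical
  refine ⟨(DirectSum.decompose M.gr x).support, (DirectSum.sum_support_decompose M.gr x).symm,
    fun n hn => ?_⟩
  change (DirectSum.decompose M.gr x n : M.carrier) = 0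
  rw [DFinsupp.notMem_support_iff.1 hn, ZeroMemClass.coe_zero]

theorem ext_proj {x y : M.carrier} (h : ∀ n, M.proj n x = M.proj n y) : x = y :=
  (DirectSum.decompose M.gr).injective (DFinsupp.ext fun n => Subtype.ext (h n))

theorem homogeneous_induction {p : M.carrier → Prop} (zero : p 0)
    (homogeneous : ∀ n x, x ∈ M.gr n → p x) (add : ∀ x y, p x → p y → p (x + y))
    (x : M.carrier) : p x :=
  DirectSum.Decomposition.inductionOn M.gr zero (fun {n} x => homogeneous n x x.2) add x

theorem eq_zero_of_mem_gr_of_ne {m n : Fin r → ℤ} (h : m ≠ n) {x : M.carrier} (hm : x ∈ M.gr m)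
    (hn : x ∈ M.gr n) : x = 0 :=
  (M.proj_of_mem hm).symm.trans (M.proj_of_mem_ne hn h.symm)

theorem proj_smul {m : Fin r → ℤ} {a : S} (ha : a ∈ 𝒜 m) (n : Fin r → ℤ) (x : M.carrier) :
    M.proj (m + n) (a • x) = a • M.proj n x := by
  induction x using M.homogeneous_induction with
  | zero => simp
  | homogeneous l x hx =>
    obtain rfl | h := eq_or_ne l n
    · rw [M.proj_of_mem hx, M.proj_of_mem (M.smul_mem _ _ _ _ ha hx)]
    · rw [M.proj_of_mem_ne hx h, smul_zero, M.proj_of_mem_ne (M.smul_mem _ _ _ _ ha hx)]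
      exact fun h' => h (add_left_cancel h')
  | add x y hx hy => rw [smul_add, map_add, map_add, hx, hy, smul_add]

/-- The group of morphisms of graded modules, as a subgroup of the linear maps. -/
def homs (M N : GrMod 𝒜) : AddSubgroup (M.carrier →ₗ[S] N.carrier) where
  carrier := {f | IsHom f}
  zero_mem' n _ _ := (N.gr n).zero_mem
  add_mem' hf hg n x hx := (N.gr n).add_mem (hf n x hx) (hg n x hx)
  neg_mem' hf n x hx := (N.gr n).neg_mem (hf n x hx)

/-- The type of morphisms of graded modules: the linear maps satisfying `GrMod.IsHom`. -/
abbrev Hom (M N : GrMod 𝒜) : Type u := homs M N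

namespace Hom

variable {M} {N P : GrMod 𝒜}

theorem mem (f : Hom M N) {n : Fin r → ℤ} {x : M.carrier} (hx : x ∈ M.gr n) : f.1 x ∈ N.gr n :=
  f.2 n x hx

theorem map_proj (f : Hom M N) (n : Fin r → ℤ) (x : M.carrier) :
    f.1 (M.proj n x) = N.proj n (f.1 x) := by
  induction x using M.homogeneous_induction with
  | zero => simp
  | homogeneous l x hx =>
    obtain rfl | h := eq_or_ne l n
    · rw [M.proj_of_mem hx, N.proj_of_mem (f.mem hx)]
    · rw [M.proj_of_mem_ne hx h, map_zero, N.proj_of_mem_ne (f.mem hx) h]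
  | add x y hx hy => simp only [map_add, hx, hy]

/-- The composition `g ∘ f` of morphisms of graded modules. -/
def comp (g : Hom N P) (f : Hom M N) : Hom M P :=
  ⟨g.1 ∘ₗ f.1, fun n x hx => g.2 n _ (f.2 n x hx)⟩

@[simp] theorem comp_apply (g : Hom N P) (f : Hom M N) (x : M.carrier) :
    (g.comp f).1 x = g.1 (f.1 x) := rfl

/-- The identity morphism of a graded module. -/
def id (M : GrMod 𝒜) : Hom M M := ⟨LinearMap.id, fun _ _ hx => hx⟩

theorem ext {f g : Hom M N} (h : ∀ x, f.1 x = g.1 x) : f = g :=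
  Subtype.ext (LinearMap.ext h)

@[simp] theorem neg_apply (f : Hom M N) (x : M.carrier) : (-f).1 x = -f.1 x := rfl
@[simp] theorem sub_apply (f g : Hom M N) (x : M.carrier) : (f - g).1 x = f.1 x - g.1 x := rfl
@[simp] theorem zero_apply (x : M.carrier) : (0 : Hom M N).1 x = 0 := rfl

end Hom

/-- Graded (homogeneous) submodules: those that contain the homogeneous components of their
elements. -/
def IsHomogeneous (N : Submodule S M.carrier) : Prop := ∀ n x, x ∈ N → M.proj n x ∈ N

variable {M}

/-- A graded submodule, regarded as a graded module. -/
noncomputable def sub (N : Submodule S M.carrier) (hN : M.IsHomogeneous N) : GrMod 𝒜 where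
  carrier := N
  gr n := (M.gr n).comap N.subtype.toAddMonoidHom
  isInternal := by
    refine isInternal_of_separating (Y := M.carrier) _ (fun n x hx hx0 => ?_) fun x => ?_
    · refine ⟨(M.proj n).comp N.subtype.toAddMonoidHom, ?_, fun m hm y hy => ?_⟩
      · change M.proj n x.1 ≠ 0
        rw [M.proj_of_mem (x := x.1) hx]
        exact fun h => hx0 (Subtype.ext h)
      · exact M.proj_of_mem_ne hy hm
    · obtain ⟨s, hs, -⟩ := M.exists_eq_sum_proj x.1
      have hx : x = ∑ n ∈ s, (⟨M.proj n x.1, hN n _ x.2⟩ : N) :=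
        Subtype.ext (by rw [Submodule.coe_sum]; exact hs)
      rw [hx]
      exact sum_mem fun n _ => AddSubgroup.mem_iSup_of_mem n (M.proj_mem n x.1)
  smul_mem m n a x ha hx := M.smul_mem m n a x.1 ha hx

/-- The inclusion of a graded submodule, as a morphism of graded modules. -/
noncomputable def subIncl (N : Submodule S M.carrier) (hN : M.IsHomogeneous N) :
    Hom (sub N hN) M :=
  ⟨N.subtype, fun _ _ hx => hx⟩

/-- The quotient of a graded module by a graded submodule, regarded as a graded module. -/
noncomputable def quot (N : Submodule S M.carrier) (hN : M.IsHomogeneous N) : GrMod 𝒜 where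
  carrier := M.carrier ⧸ N
  gr n := (M.gr n).map N.mkQ.toAddMonoidHom
  isInternal := by
    refine isInternal_of_separating (Y := M.carrier ⧸ N) _ (fun n x hx hx0 => ?_) fun x => ?_
    · obtain ⟨x, hx, rfl⟩ := hx
      refine ⟨QuotientAddGroup.lift N.toAddSubgroup (N.mkQ.toAddMonoidHom.comp (M.proj n))
        fun y hy => (Submodule.Quotient.mk_eq_zero N).2 (hN n y hy), ?_, fun m hm y hy => ?_⟩
      · change N.mkQ (M.proj n x) ≠ 0
        rw [M.proj_of_mem hx]; exact hx0
      · obtain ⟨y, hy, rfl⟩ := hy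
        change N.mkQ (M.proj n y) = 0
        rw [M.proj_of_mem_ne hy hm, map_zero]
    · obtain ⟨x, rfl⟩ := N.mkQ_surjective x
      obtain ⟨s, hs, -⟩ := M.exists_eq_sum_proj x
      rw [hs, map_sum]
      exact sum_mem fun n _ => AddSubgroup.mem_iSup_of_mem n ⟨_, M.proj_mem n x, rfl⟩
  smul_mem := by
    rintro m n a _ ha ⟨x, hx, rfl⟩
    exact ⟨a • x, M.smul_mem m n a x ha hx, map_smul N.mkQ a x⟩

/-- The projection to a graded quotient, as a morphism of graded modules. -/
noncomputable def quotProj (N : Submodule S M.carrier) (hN : M.IsHomogeneous N) :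
    Hom M (quot N hN) :=
  ⟨N.mkQ, fun _ x hx => ⟨x, hx, rfl⟩⟩

theorem quotProj_surjective (N : Submodule S M.carrier) (hN : M.IsHomogeneous N) :
    Function.Surjective (quotProj N hN).1 := N.mkQ_surjective

theorem quotProj_eq_zero_iff (N : Submodule S M.carrier) (hN : M.IsHomogeneous N)
    (x : M.carrier) : (quotProj N hN).1 x = 0 ↔ x ∈ N := Submodule.Quotient.mk_eq_zero N

theorem subIncl_injective (N : Submodule S M.carrier) (hN : M.IsHomogeneous N) :
    Function.Injective (subIncl N hN).1 := N.subtype_injective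

variable {N : GrMod 𝒜}

/-- The morphism out of a quotient induced by a morphism that kills the submodule. -/
noncomputable def quotLift (K : Submodule S M.carrier) (hK : M.IsHomogeneous K) (f : Hom M N)
    (h : ∀ x ∈ K, f.1 x = 0) : Hom (quot K hK) N :=
  ⟨K.liftQ f.1 h, by rintro n _ ⟨x, hx, rfl⟩; exact f.mem hx⟩

/-- The morphism into a graded submodule induced by a morphism whose range it contains. -/
noncomputable def subLift (K : Submodule S N.carrier) (hK : N.IsHomogeneous K) (f : Hom M N)
    (h : ∀ x, f.1 x ∈ K) : Hom M (sub K hK) :=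
  ⟨f.1.codRestrict K h, fun _ _ hx => f.mem hx⟩

theorem isHomogeneous_ker (f : Hom M N) : M.IsHomogeneous (LinearMap.ker f.1) := fun n x hx => by
  rw [LinearMap.mem_ker] at hx ⊢
  rw [f.map_proj, hx, map_zero]

theorem isHomogeneous_range (f : Hom M N) : N.IsHomogeneous (LinearMap.range f.1) := by
  rintro n _ ⟨x, rfl⟩
  exact ⟨M.proj n x, f.map_proj n x⟩

/-- The product of two graded modules, graded componentwise. -/
def prod (M N : GrMod 𝒜) : GrMod 𝒜 where
  carrier := M.carrier × N.carrier
  gr n := (M.gr n).prod (N.gr n)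
  isInternal := by
    refine isInternal_of_separating (Y := M.carrier × N.carrier) _ (fun n x hx hx0 => ?_)
      fun x => ?_
    · refine ⟨(M.proj n).prodMap (N.proj n), ?_, fun m hm y hy => ?_⟩
      · rwa [show (M.proj n).prodMap (N.proj n) x = x from
          Prod.ext (M.proj_of_mem hx.1) (N.proj_of_mem hx.2)]
      · exact Prod.ext (M.proj_of_mem_ne hy.1 hm) (N.proj_of_mem_ne hy.2 hm)
    · have inl_mem (y : M.carrier) : (y, (0 : N.carrier)) ∈ ⨆ n, (M.gr n).prod (N.gr n) := by
        induction y using M.homogeneous_induction with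
        | zero => exact zero_mem _
        | homogeneous n y hy => exact AddSubgroup.mem_iSup_of_mem n ⟨hy, zero_mem _⟩
        | add y z hy hz => simpa using add_mem hy hz
      have inr_mem (y : N.carrier) : ((0 : M.carrier), y) ∈ ⨆ n, (M.gr n).prod (N.gr n) := by
        induction y using N.homogeneous_induction with
        | zero => exact zero_mem _
        | homogeneous n y hy => exact AddSubgroup.mem_iSup_of_mem n ⟨zero_mem _, hy⟩
        | add y z hy hz => simpa using add_mem hy hz
      simpa using add_mem (inl_mem x.1) (inr_mem x.2)
  smul_mem m n a x ha hx := ⟨M.smul_mem m n a _ ha hx.1, N.smul_mem m n a _ ha hx.2⟩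

/-- The shifted module `M(a)`, with `M(a)_n = M_{a + n}`. -/
def shift (M : GrMod 𝒜) (a : Fin r → ℤ) : GrMod 𝒜 where
  carrier := M.carrier
  gr n := M.gr (a + n)
  isInternal := by
    refine isInternal_of_separating (Y := M.carrier) _ (fun n x hx hx0 => ?_) fun x => ?_
    · refine ⟨M.proj (a + n), by rwa [M.proj_of_mem hx], fun m hm y hy => ?_⟩
      exact M.proj_of_mem_ne hy fun h => hm (add_left_cancel h)
    · refine M.homogeneous_induction (zero_mem _) (fun n y hy => ?_)
        (fun y z hy hz => add_mem hy hz) x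
      refine AddSubgroup.mem_iSup_of_mem (n - a) ?_
      rwa [add_sub_cancel]
  smul_mem m n c x hc hx := by
    have h := M.smul_mem m (a + n) c x hc hx
    rwa [add_left_comm] at h

/-- A morphism, regarded as a morphism of the shifted modules. -/
def Hom.shift (f : Hom M N) (a : Fin r → ℤ) : Hom (M.shift a) (N.shift a) :=
  ⟨f.1, fun _ _ hx => f.mem hx⟩

theorem IsInjective.exists_extension {E X Y : GrMod 𝒜} (hE : E.IsInjective) (u : Hom X Y)
    (v : Hom X E) (h : ∀ x, u.1 x = 0 → v.1 x = 0) :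
    ∃ w : Hom Y E, ∀ x, w.1 (u.1 x) = v.1 x := by
  let u' := quotLift _ (isHomogeneous_ker u) u fun _ hx => hx
  let v' := quotLift _ (isHomogeneous_ker u) v h
  have hu' : Function.Injective u'.1 :=
    LinearMap.ker_eq_bot.1 (Submodule.ker_liftQ_eq_bot _ _ _ le_rfl)
  obtain ⟨g, hg, hgu⟩ := hE _ Y u'.1 v'.1 u'.2 hu' v'.2
  exact ⟨⟨g, hg⟩, fun x => LinearMap.congr_fun hgu (Submodule.Quotient.mk x)⟩

end Basic

/-! ### Coinduced modules and existence of injective resolutions -/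

section OfFamily

variable [GradedRing 𝒜]

/-- The submodule spanned by the members of a family of subgroups on which `S` acts compatibly
with the degrees; it carries the graded module `GrMod.ofFamily`. -/
def familySpan {X : Type u} [AddCommGroup X] [Module S X] (gr : (Fin r → ℤ) → AddSubgroup X)
    (smul_mem : ∀ (m n : Fin r → ℤ) (a : S) (x : X), a ∈ 𝒜 m → x ∈ gr n → a • x ∈ gr (m + n)) :
    Submodule S X :=
  { (⨆ n, gr n : AddSubgroup X) with
    smul_mem' := by
      intro a x hx
      change a • x ∈ (⨆ n, gr n : AddSubgroup X)
      induction a using DirectSum.Decomposition.inductionOn 𝒜 with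
      | zero => rw [zero_smul]; exact zero_mem _
      | @homogeneous m a =>
        refine AddSubgroup.iSup_induction gr (C := fun x => (a : S) • x ∈ ⨆ n, gr n) hx
          (fun n y hy => AddSubgroup.mem_iSup_of_mem (m + n) (smul_mem m n _ y a.2 hy)) ?_
          fun y z hy hz => ?_
        · rw [smul_zero]; exact zero_mem _
        · rw [smul_add]; exact add_mem hy hz
      | add a b ha hb => rw [add_smul]; exact add_mem ha hb }

theorem mem_familySpan {X : Type u} [AddCommGroup X] [Module S X]
    (gr : (Fin r → ℤ) → AddSubgroup X)
    (smul_mem : ∀ (m n : Fin r → ℤ) (a : S) (x : X), a ∈ 𝒜 m → x ∈ gr n → a • x ∈ gr (m + n))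
    {n : Fin r → ℤ} {x : X} (hx : x ∈ gr n) : x ∈ familySpan gr smul_mem :=
  AddSubgroup.mem_iSup_of_mem n hx

/-- The graded module spanned by a family of subgroups of a module. The independence of the family
is expressed by additive maps that separate each nonzero element from the other components. -/
def ofFamily {X Y : Type u} [AddCommGroup X] [Module S X] [AddCommGroup Y]
    (gr : (Fin r → ℤ) → AddSubgroup X)
    (smul_mem : ∀ (m n : Fin r → ℤ) (a : S) (x : X), a ∈ 𝒜 m → x ∈ gr n → a • x ∈ gr (m + n))
    (hsep : ∀ n x, x ∈ gr n → x ≠ 0 →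
      ∃ q : X →+ Y, q x ≠ 0 ∧ ∀ m, m ≠ n → ∀ y ∈ gr m, q y = 0) : GrMod 𝒜 where
  carrier := familySpan gr smul_mem
  gr n := (gr n).comap (familySpan gr smul_mem).subtype.toAddMonoidHom
  isInternal := by
    refine isInternal_of_separating (Y := Y) _ (fun n x hx hx0 => ?_) fun ⟨x, hx⟩ => ?_
    · obtain ⟨q, hq, hq_ne⟩ := hsep n x.1 hx fun h => hx0 (Subtype.ext h)
      exact ⟨q.comp (familySpan gr smul_mem).subtype.toAddMonoidHom, hq,
        fun m hm y hy => hq_ne m hm _ hy⟩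
    · exact AddSubgroup.iSup_induction' gr
        (C := fun x hx => (⟨x, hx⟩ : familySpan gr smul_mem) ∈
          ⨆ n, (gr n).comap (familySpan gr smul_mem).subtype.toAddMonoidHom)
        (fun n y hy => AddSubgroup.mem_iSup_of_mem n hy) (zero_mem _)
        (fun y z _ _ hy hz => add_mem hy hz) hx
  smul_mem m n a x ha hx := smul_mem m n a x.1 ha hx

end OfFamily

/-- The ring is `ℕ^r`-graded: its components of degree outside `ℕ^r` vanish. -/
def IsNatGraded (𝒜 : (Fin r → ℤ) → AddSubgroup S) : Prop := ∀ n, ¬ 0 ≤ n → 𝒜 n = ⊥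

/-- The total degree of a multidegree. -/
def weight (n : Fin r → ℤ) : ℤ := ∑ i, n i

@[simp]
theorem weight_zero : weight (0 : Fin r → ℤ) = 0 := Finset.sum_const_zero

theorem weight_add (m n : Fin r → ℤ) : weight (m + n) = weight m + weight n :=
  Finset.sum_add_distrib

theorem weight_nonneg {n : Fin r → ℤ} (h : 0 ≤ n) : 0 ≤ weight n :=
  Finset.sum_nonneg fun i _ => h i

theorem weight_pos {n : Fin r → ℤ} (h : 0 ≤ n) (h0 : n ≠ 0) : 0 < weight n :=
  Finset.sum_pos' (fun i _ => h i) (by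
    obtain ⟨i, hi⟩ := Function.ne_iff.1 h0
    exact ⟨i, Finset.mem_univ i, (h i).lt_of_ne hi.symm⟩)

/-- The total degrees of the nonzero homogeneous elements of `N` are at most `b`. -/
def WeightLE (N : GrMod 𝒜) (b : ℤ) : Prop := ∀ n, ∀ x ∈ N.gr n, x ≠ 0 → weight n ≤ b

theorem WeightLE.quot {N : GrMod 𝒜} {b : ℤ} (h : N.WeightLE b) (K : Submodule S N.carrier)
    (hK : N.IsHomogeneous K) : (quot K hK).WeightLE b := by
  rintro n _ ⟨x, hx, rfl⟩ hx0
  exact h n x hx fun h0 => hx0 ((congrArg K.mkQ h0).trans (map_zero K.mkQ))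

section Coinduced

variable (k : Type v) [Field k] [Algebra k S]

/-- The `k`-linear maps from `S` to a graded module, as a subgroup of the additive maps (the
carrier of a graded module is only an `S`-module). -/
def linFuns (N : GrMod 𝒜) : AddSubgroup (S →+ N.carrier) where
  carrier := {f | ∀ (c : k) (s : S), f (algebraMap k S c * s) = algebraMap k S c • f s}
  zero_mem' c s := by simp
  add_mem' hf hg c s := by simp [hf c s, hg c s]
  neg_mem' hf c s := by simp [hf c s]

/-- The group of `k`-linear maps from `S` to a graded module, on which `S` acts through the
source. -/
def CoindFun (N : GrMod 𝒜) : Type u := linFuns k N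

instance (N : GrMod 𝒜) : AddCommGroup (CoindFun k N) :=
  inferInstanceAs (AddCommGroup (linFuns k N))

instance (N : GrMod 𝒜) : Module S (CoindFun k N) where
  smul a f := ⟨f.1.comp (AddMonoidHom.mulLeft a), fun c s => by
    change f.1 (a * (algebraMap k S c * s)) = _ • f.1 (a * s)
    rw [mul_left_comm, f.2]⟩
  one_smul f := Subtype.ext <| AddMonoidHom.ext fun s => congrArg f.1 (one_mul s)
  mul_smul a b f := Subtype.ext <| AddMonoidHom.ext fun s =>
    congrArg f.1 (by change a * b * s = b * (a * s); ring)
  smul_zero a := Subtype.ext <| AddMonoidHom.ext fun s => rfl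
  smul_add a f g := Subtype.ext <| AddMonoidHom.ext fun s => rfl
  add_smul a b f := Subtype.ext <| AddMonoidHom.ext fun s =>
    (congrArg f.1 (add_mul a b s)).trans (map_add f.1 _ _)
  zero_smul f := Subtype.ext <| AddMonoidHom.ext fun s =>
    (congrArg f.1 (zero_mul s)).trans (map_zero f.1)

/-- The `k`-linear maps from `S` to `N` that raise degrees by `n`: the component of degree `n` of
the coinduced module. -/
def coindGr (N : GrMod 𝒜) (n : Fin r → ℤ) : AddSubgroup (CoindFun k N) where
  carrier := {f | ∀ m, ∀ s ∈ 𝒜 m, f.1 s ∈ N.gr (m + n)}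
  zero_mem' m _ _ := zero_mem (N.gr (m + n))
  add_mem' hf hg m s hs := add_mem (hf m s hs) (hg m s hs)
  neg_mem' hf m s hs := neg_mem (hf m s hs)

variable {k}

/-- A `k`-linear retraction becomes degree preserving after projecting its value on each
homogeneous element to the component of the same degree. -/
theorem exists_degree_preserving_retraction (hk : ∀ c : k, algebraMap k S c ∈ 𝒜 0)
    {A B : GrMod 𝒜} (i : Hom A B) (hi : Function.Injective i.1) :
    ∃ ρ : B.carrier →+ A.carrier, (∀ a, ρ (i.1 a) = a) ∧
      (∀ (c : k) b, ρ (algebraMap k S c • b) = algebraMap k S c • ρ b) ∧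
      ∀ n, ∀ b ∈ B.gr n, ρ b ∈ A.gr n := by
  let _ : Module k A.carrier := Module.compHom _ (algebraMap k S)
  let _ : Module k B.carrier := Module.compHom _ (algebraMap k S)
  let iₖ : A.carrier →ₗ[k] B.carrier :=
    { toFun := i.1, map_add' := map_add i.1, map_smul' := fun c x => map_smul i.1 _ x }
  obtain ⟨σ, hσ⟩ := iₖ.exists_leftInverse_of_injective (LinearMap.ker_eq_bot.2 hi)
  let ρ : B.carrier →+ A.carrier :=
    (DirectSum.toAddMonoid fun n => (A.proj n).comp
      (σ.toAddMonoidHom.comp (B.gr n).subtype)).comp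
        (DirectSum.decomposeAddEquiv B.gr).toAddMonoidHom
  have ρ_of_mem : ∀ n, ∀ b ∈ B.gr n, ρ b = A.proj n (σ b) := by
    intro n b hb
    change DirectSum.toAddMonoid _ (DirectSum.decompose B.gr b) = _
    rw [DirectSum.decompose_of_mem B.gr hb, DirectSum.toAddMonoid_of]
    rfl
  refine ⟨ρ, fun a => ?_, fun c b => ?_, fun n b hb => ?_⟩
  · induction a using A.homogeneous_induction with
    | zero => simp
    | homogeneous n a ha =>
      rw [ρ_of_mem n _ (i.mem ha), show σ (i.1 a) = a from LinearMap.congr_fun hσ a,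
        A.proj_of_mem ha]
    | add x y hx hy => rw [map_add, map_add, hx, hy]
  · induction b using B.homogeneous_induction with
    | zero => simp
    | homogeneous n b hb =>
      have hcb := B.smul_mem 0 n _ b (hk c) hb
      have hproj := A.proj_smul (hk c) n (σ b)
      rw [zero_add] at hcb hproj
      rw [ρ_of_mem n _ hcb, ρ_of_mem n _ hb, ← hproj]
      exact congrArg _ (map_smul σ c b)
    | add x y hx hy => rw [smul_add, map_add, map_add, hx, hy, smul_add]
  · rw [ρ_of_mem n b hb]; exact A.proj_mem _ _

variable [GradedRing 𝒜]

theorem coindGr_smul_mem (N : GrMod 𝒜) (m n : Fin r → ℤ) (a : S) (f : CoindFun k N)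
    (ha : a ∈ 𝒜 m) (hf : f ∈ coindGr k N n) : a • f ∈ coindGr k N (m + n) := by
  intro l s hs
  have := hf (m + l) (a * s) (SetLike.GradedMul.mul_mem ha hs)
  rwa [add_assoc, add_left_comm] at this

theorem exists_homogeneous_apply_ne_zero {N : GrMod 𝒜} {f : CoindFun k N} (hf : f ≠ 0) :
    ∃ m, ∃ s ∈ 𝒜 m, f.1 s ≠ 0 := by
  by_contra! h
  refine hf (Subtype.ext (AddMonoidHom.ext fun s => ?_))
  change f.1 s = 0
  induction s using DirectSum.Decomposition.inductionOn 𝒜 with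
  | zero => exact map_zero _
  | homogeneous s => exact h _ _ s.2
  | add a b ha hb => rw [map_add, ha, hb, add_zero]

variable (k) in
/-- The graded module coinduced from the graded vector space underlying `N`: the graded version
of `Hom_k(S, N)`. It is injective and contains `N`. -/
def coind (N : GrMod 𝒜) : GrMod 𝒜 :=
  ofFamily (Y := N.carrier) (coindGr k N) (coindGr_smul_mem N) fun n f hf hf0 => by
    obtain ⟨m, s, hs, hfs⟩ := exists_homogeneous_apply_ne_zero hf0
    refine ⟨(N.proj (m + n)).comp ((AddMonoidHom.eval s).comp (linFuns k N).subtype), ?_, ?_⟩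
    · change N.proj (m + n) (f.1 s) ≠ 0
      rwa [N.proj_of_mem (hf m s hs)]
    · intro l hl g hg
      exact N.proj_of_mem_ne (hg m s hs) fun h => hl (add_left_cancel h)

/-- The morphism `b ↦ (s ↦ φ (s • b))` to a coinduced module defined by a `k`-linear degree
preserving map `φ`. -/
def coindLift {B N : GrMod 𝒜} (φ : B.carrier →+ N.carrier)
    (hk : ∀ (c : k) b, φ (algebraMap k S c • b) = algebraMap k S c • φ b)
    (hφ : ∀ n, ∀ b ∈ B.gr n, φ b ∈ N.gr n) : Hom B (coind k N) :=
  let F (b : B.carrier) : CoindFun k N :=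
    ⟨φ.comp (AddMonoidHom.flip (AddMonoidHom.smul : S →+ B.carrier →+ B.carrier) b),
      fun c s => by
        change φ ((algebraMap k S c * s) • b) = _ • φ (s • b)
        rw [mul_smul, hk]⟩
  have hF (n) (b) (hb : b ∈ B.gr n) : F b ∈ coindGr k N n := fun m s hs =>
    hφ _ _ (B.smul_mem m n s b hs hb)
  let F' : B.carrier →ₗ[S] CoindFun k N :=
    { toFun := F
      map_add' := fun b b' => Subtype.ext <| AddMonoidHom.ext fun s =>
        (congrArg φ (smul_add s b b')).trans (map_add φ _ _)
      map_smul' := fun a b => Subtype.ext <| AddMonoidHom.ext fun s =>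
        congrArg φ (by change s • a • b = (a * s) • b; rw [mul_comm, mul_smul]) }
  ⟨F'.codRestrict (familySpan (coindGr k N) (coindGr_smul_mem N)) fun b => by
      induction b using B.homogeneous_induction with
      | zero => rw [map_zero]; exact zero_mem _
      | homogeneous n b hb => exact mem_familySpan _ _ (hF n b hb)
      | add x y hx hy => rw [map_add]; exact add_mem hx hy,
    fun n b hb => hF n b hb⟩

theorem coindLift_apply {B N : GrMod 𝒜} (φ : B.carrier →+ N.carrier)
    (hk : ∀ (c : k) b, φ (algebraMap k S c • b) = algebraMap k S c • φ b)
    (hφ : ∀ n, ∀ b ∈ B.gr n, φ b ∈ N.gr n) (b : B.carrier) (s : S) :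
    ((coindLift φ hk hφ).1 b).1.1 s = φ (s • b) := rfl

variable (k) in
/-- Evaluation at `1`, the counit of coinduction. -/
def coindEval (N : GrMod 𝒜) : (coind k N).carrier →+ N.carrier where
  toFun f := f.1.1 1
  map_zero' := rfl
  map_add' _ _ := rfl

theorem coindEval_smul {N : GrMod 𝒜} (a : S) (f : (coind k N).carrier) :
    coindEval k N (a • f) = f.1.1 a :=
  congrArg f.1.1 (mul_one a)

theorem coind_isInjective (hk : ∀ c : k, algebraMap k S c ∈ 𝒜 0) (N : GrMod 𝒜) :
    (coind k N).IsInjective := by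
  intro A B i f hi hi_inj hf
  obtain ⟨ρ, ρ_left_inv, ρ_smul, ρ_mem⟩ := exists_degree_preserving_retraction hk ⟨i, hi⟩ hi_inj
  let φ : B.carrier →+ N.carrier := (coindEval k N).comp (f.toAddMonoidHom.comp ρ)
  have φ_smul (c : k) (b) : φ (algebraMap k S c • b) = algebraMap k S c • φ b := by
    change coindEval k N (f (ρ _)) = _ • coindEval k N (f (ρ b))
    rw [ρ_smul, map_smul, coindEval_smul]
    have := (f (ρ b)).1.2 c 1
    rwa [mul_one] at this
  have φ_mem (n) (b) (hb : b ∈ B.gr n) : φ b ∈ N.gr n := by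
    have := hf n _ (ρ_mem n b hb) 0 1 SetLike.GradedOne.one_mem
    rwa [zero_add] at this
  refine ⟨(coindLift φ φ_smul φ_mem).1, (coindLift φ φ_smul φ_mem).2, LinearMap.ext fun a => ?_⟩
  refine Subtype.ext (Subtype.ext (AddMonoidHom.ext fun s => ?_))
  change coindEval k N (f (ρ (s • i a))) = (f a).1.1 s
  rw [← map_smul, show ρ (i (s • a)) = s • a from ρ_left_inv _, map_smul, coindEval_smul]

theorem WeightLE.coind (hN : IsNatGraded 𝒜) {N : GrMod 𝒜} {b : ℤ} (hb : N.WeightLE b) :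
    (coind k N).WeightLE b := by
  intro n f hf hf0
  obtain ⟨m, s, hs, hfs⟩ := exists_homogeneous_apply_ne_zero
    (f := f.1) fun h => hf0 (Subtype.ext h)
  have hmn : weight (m + n) ≤ b := hb _ _ (hf m s hs) hfs
  have hm : 0 ≤ m := by
    by_contra hm
    rw [hN m hm, AddSubgroup.mem_bot] at hs
    exact hfs (hs ▸ map_zero _)
  have hm_weight := weight_nonneg hm
  rw [weight_add] at hmn
  omega

theorem exists_injective_embedding (hN : IsNatGraded 𝒜)
    (hk : ∀ c : k, algebraMap k S c ∈ 𝒜 0) (N : GrMod 𝒜) :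
    ∃ (E : GrMod 𝒜) (ι : Hom N E), E.IsInjective ∧ Function.Injective ι.1 ∧
      ∀ b, N.WeightLE b → E.WeightLE b := by
  let ι : Hom N (coind k N) :=
    coindLift (AddMonoidHom.id _) (fun _ _ => rfl) (fun _ _ h => h)
  have eval_ι (z : N.carrier) : coindEval k N (ι.1 z) = z := by
    change (ι.1 z).1.1 1 = z
    rw [coindLift_apply, one_smul, AddMonoidHom.id_apply]
  exact ⟨coind k N, ι, coind_isInjective hk N, Function.LeftInverse.injective eval_ι,
    fun b hb => hb.coind hN⟩

theorem exists_injRes (hN : IsNatGraded 𝒜) (hk : ∀ c : k, algebraMap k S c ∈ 𝒜 0)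
    (N : GrMod 𝒜) : ∃ R : InjRes N, ∀ b, N.WeightLE b → ∀ p, (R.I p).WeightLE b := by
  choose E ι hE hι hb using exists_injective_embedding (k := k) hN hk
  let C : ℕ → GrMod 𝒜 := fun p => Nat.rec N
    (fun _ X => GrMod.quot (LinearMap.range (ι X).1) (isHomogeneous_range (ι X))) p
  let π (p : ℕ) : Hom (E (C p)) (C (p + 1)) := quotProj _ (isHomogeneous_range (ι (C p)))
  have hπ (p : ℕ) : Function.Surjective (π p).1 :=
    quotProj_surjective _ (isHomogeneous_range (ι (C p)))
  let δ (p : ℕ) : Hom (E (C p)) (E (C (p + 1))) := (ι (C (p + 1))).comp (π p)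
  have hδ (p : ℕ) (x : (E (C p)).carrier) : (δ p).1 x = 0 ↔ ∃ y, (ι (C p)).1 y = x :=
    (map_eq_zero_iff (ι (C (p + 1))).1 (hι _)).trans
      (quotProj_eq_zero_iff _ (isHomogeneous_range (ι (C p))) x)
  have hC (b : ℤ) (hNb : N.WeightLE b) (p : ℕ) : (C p).WeightLE b := by
    induction p with
    | zero => exact hNb
    | succ p ih => exact (hb _ _ ih).quot _ _
  refine ⟨⟨fun p => E (C p), fun p => hE _, (ι N).1, fun p => (δ p).1, (ι N).2,
    fun p => (δ p).2, hι N, fun x => hδ 0 x, fun p x => (hδ (p + 1) x).trans ⟨?_, ?_⟩⟩,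
    fun b hNb p => hb _ _ (hC b hNb p)⟩
  · rintro ⟨y, rfl⟩
    obtain ⟨z, rfl⟩ := hπ p y
    exact ⟨z, rfl⟩
  · rintro ⟨z, rfl⟩
    exact ⟨(π p).1 z, rfl⟩

end Coinduced

/-! ### Morphisms of injective resolutions -/

theorem exists_lift_of_exact (X Y : ℕ → GrMod 𝒜) (dX : ∀ p, Hom (X p) (X (p + 1)))
    (dY : ∀ p, Hom (Y p) (Y (p + 1))) (hX : ∀ p, Function.Exact (dX p).1 (dX (p + 1)).1)
    (hY : ∀ p x, (dY (p + 1)).1 ((dY p).1 x) = 0) (hI : ∀ p, (Y (p + 1)).IsInjective)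
    (f₀ : Hom (X 0) (Y 0)) (h₀ : ∀ x, (dX 0).1 x = 0 → (dY 0).1 (f₀.1 x) = 0) :
    ∃ f : ∀ p, Hom (X p) (Y p), f 0 = f₀ ∧
      ∀ p x, (f (p + 1)).1 ((dX p).1 x) = (dY p).1 ((f p).1 x) := by
  have extend : ∀ (p : ℕ) (f : {f : Hom (X p) (Y p) // ∀ x, (dX p).1 x = 0 →
      (dY p).1 (f.1 x) = 0}), ∃ g : {g : Hom (X (p + 1)) (Y (p + 1)) // ∀ x,
      (dX (p + 1)).1 x = 0 → (dY (p + 1)).1 (g.1 x) = 0},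
      ∀ x, g.1.1 ((dX p).1 x) = (dY p).1 (f.1.1 x) := by
    intro p f
    obtain ⟨g, hg⟩ := (hI p).exists_extension (dX p) ((dY p).comp f.1) f.2
    refine ⟨⟨g, fun x hx => ?_⟩, hg⟩
    obtain ⟨y, rfl⟩ := (hX p x).1 hx
    rw [hg, Hom.comp_apply, hY]
  choose next hnext using extend
  let F : ∀ p, {f : Hom (X p) (Y p) // ∀ x, (dX p).1 x = 0 → (dY p).1 (f.1 x) = 0} :=
    fun p => Nat.rec ⟨f₀, h₀⟩ (fun p f => next p f) p
  exact ⟨fun p => (F p).1, rfl, fun p x => hnext p (F p) x⟩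

theorem Hom.map_gammaTorsion {M N : GrMod 𝒜} (f : Hom M N) (I : Ideal S) {x : M.carrier}
    (hx : x ∈ gammaTorsion I M.carrier) : f.1 x ∈ gammaTorsion I N.carrier := by
  obtain ⟨t, ht⟩ := hx
  exact ⟨t, fun a ha => by rw [← map_smul, ht a ha, map_zero]⟩

namespace InjRes

variable {M N P : GrMod 𝒜}

/-- The augmentation of a resolution, as a morphism of graded modules. -/
def augmentation (R : InjRes M) : Hom M (R.I 0) := ⟨R.ε, R.ε_hom⟩

/-- The differential of a resolution, as a morphism of graded modules. -/
def differential (R : InjRes M) (p : ℕ) : Hom (R.I p) (R.I (p + 1)) := ⟨R.δ p, R.δ_hom p⟩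

theorem δ_ε (R : InjRes M) (x : M.carrier) : R.δ 0 (R.ε x) = 0 :=
  (R.exact_zero _).2 ⟨x, rfl⟩

theorem δ_δ (R : InjRes M) (p : ℕ) (x : (R.I p).carrier) : R.δ (p + 1) (R.δ p x) = 0 :=
  (R.exact_succ p _).2 ⟨x, rfl⟩

section Classes

variable (R : InjRes M) {i : ℕ} {n : Fin r → ℤ}

theorem mem_coboundaries_zero {x : (R.I 0).carrier} : x ∈ R.coboundaries 0 n ↔ x = 0 := Iff.rfl

theorem mem_coboundaries_succ {x : (R.I (i + 1)).carrier} :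
    x ∈ R.coboundaries (i + 1) n ↔ ∃ y ∈ R.cochains i n, R.δ i y = x := Iff.rfl

theorem map_mem_cochains {R' : InjRes N} {i' : ℕ} (g : Hom (R.I i) (R'.I i'))
    {x : (R.I i).carrier} (hx : x ∈ R.cochains i n) : g.1 x ∈ R'.cochains i' n :=
  ⟨g.mem hx.1, g.map_gammaTorsion _ hx.2⟩

/-- The class of a cocycle in the cohomology of `Γ_𝓜(I)`. -/
def classOf (x : (R.I i).carrier) (hx : x ∈ R.cocycles i n) : R.cohomology i n :=
  QuotientAddGroup.mk (⟨x, hx⟩ : R.cocycles i n)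

theorem classOf_surjective (c : R.cohomology i n) : ∃ x hx, R.classOf x hx = c := by
  obtain ⟨⟨x, hx⟩, rfl⟩ := QuotientAddGroup.mk_surjective c
  exact ⟨x, hx, rfl⟩

theorem classOf_eq_zero_iff {x : (R.I i).carrier} (hx : x ∈ R.cocycles i n) :
    R.classOf x hx = 0 ↔ x ∈ R.coboundaries i n := by
  rw [classOf, QuotientAddGroup.eq_zero_iff, AddSubgroup.mem_addSubgroupOf]

theorem classOf_eq_iff {x y : (R.I i).carrier} (hx : x ∈ R.cocycles i n) (hy : y ∈ R.cocycles i n) :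
    R.classOf x hx = R.classOf y hy ↔ x - y ∈ R.coboundaries i n := by
  rw [← R.classOf_eq_zero_iff (sub_mem hx hy), ← sub_eq_zero]
  rfl

theorem nontrivial_iff_exists :
    Nontrivial (R.cohomology i n) ↔ ∃ x ∈ R.cocycles i n, x ∉ R.coboundaries i n := by
  constructor
  · intro h
    obtain ⟨c, hc⟩ := exists_ne (0 : R.cohomology i n)
    obtain ⟨x, hx, rfl⟩ := R.classOf_surjective c
    exact ⟨x, hx, fun h => hc ((R.classOf_eq_zero_iff hx).2 h)⟩
  · rintro ⟨x, hx, hx'⟩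
    exact ⟨R.classOf x hx, 0, fun h => hx' ((R.classOf_eq_zero_iff hx).1 h)⟩

/-- The map on cohomology induced by a morphism that respects cocycles and coboundaries. -/
def inducedMap {R' : InjRes N} {i' : ℕ} (g : Hom (R.I i) (R'.I i'))
    (hz : ∀ x ∈ R.cocycles i n, g.1 x ∈ R'.cocycles i' n)
    (hb : ∀ x ∈ R.coboundaries i n, g.1 x ∈ R'.coboundaries i' n) :
    R.cohomology i n →+ R'.cohomology i' n :=
  QuotientAddGroup.map _ _
    ((g.1.toAddMonoidHom.comp (R.cocycles i n).subtype).codRestrict (R'.cocycles i' n)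
      fun x => hz x.1 x.2)
    fun x hx => hb x.1 hx

theorem inducedMap_classOf {R' : InjRes N} {i' : ℕ} (g : Hom (R.I i) (R'.I i'))
    (hz : ∀ x ∈ R.cocycles i n, g.1 x ∈ R'.cocycles i' n)
    (hb : ∀ x ∈ R.coboundaries i n, g.1 x ∈ R'.coboundaries i' n)
    (x : (R.I i).carrier) (hx : x ∈ R.cocycles i n) :
    R.inducedMap g hz hb (R.classOf x hx) = R'.classOf (g.1 x) (hz x hx) := rfl

end Classes

/-- A morphism of injective resolutions that covers a morphism of modules. -/
structure ResMap (R : InjRes M) (R' : InjRes N) (f : Hom M N) where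
  φ : ∀ p, Hom (R.I p) (R'.I p)
  ε_comm : ∀ x, (φ 0).1 (R.ε x) = R'.ε (f.1 x)
  δ_comm : ∀ p x, (φ (p + 1)).1 (R.δ p x) = R'.δ p ((φ p).1 x)

theorem exists_resMap (R : InjRes M) (R' : InjRes N) (f : Hom M N) :
    Nonempty (ResMap R R' f) := by
  obtain ⟨φ₀, h₀⟩ := (R'.inj 0).exists_extension R.augmentation (R'.augmentation.comp f)
    fun x hx => by
      rw [R.ε_injective (a₁ := x) (a₂ := 0) (hx.trans (map_zero _).symm), map_zero]
  obtain ⟨φ, rfl, hφ⟩ := exists_lift_of_exact R.I R'.I R.differential R'.differential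
    R.exact_succ R'.δ_δ (fun p => R'.inj (p + 1)) φ₀ fun x hx => by
      obtain ⟨y, rfl⟩ := (R.exact_zero x).1 hx
      exact (congrArg (R'.δ 0) (h₀ y)).trans (R'.δ_ε _)
  exact ⟨⟨φ, h₀, hφ⟩⟩

namespace ResMap

variable {R : InjRes M} {R' : InjRes N} {R'' : InjRes P} {f : Hom M N} {g : Hom N P}

theorem exists_homotopy (F : ResMap R R' 0) :
    ∃ h : ∀ p, Hom (R.I (p + 1)) (R'.I p), (∀ x, (F.φ 0).1 x = (h 0).1 (R.δ 0 x)) ∧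
      ∀ p x, (F.φ (p + 1)).1 x = R'.δ p ((h p).1 x) + (h (p + 1)).1 (R.δ (p + 1) x) := by
  obtain ⟨h₀, hh₀⟩ := (R'.inj 0).exists_extension (R.differential 0) (F.φ 0) fun x hx => by
    obtain ⟨y, rfl⟩ := (R.exact_zero x).1 hx
    rw [F.ε_comm, Hom.zero_apply, map_zero]
  have extend : ∀ (p : ℕ) (h : {h : Hom (R.I (p + 1)) (R'.I p) // ∀ x,
      (F.φ (p + 1)).1 (R.δ p x) = R'.δ p (h.1 (R.δ p x))}),
      ∃ h' : {h' : Hom (R.I (p + 1 + 1)) (R'.I (p + 1)) // ∀ x,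
        (F.φ (p + 1 + 1)).1 (R.δ (p + 1) x) = R'.δ (p + 1) (h'.1 (R.δ (p + 1) x))},
        ∀ x, (F.φ (p + 1)).1 x = R'.δ p (h.1.1 x) + h'.1.1 (R.δ (p + 1) x) := by
    intro p h
    obtain ⟨h', hh'⟩ := (R'.inj (p + 1)).exists_extension (R.differential (p + 1))
      (F.φ (p + 1) - (R'.differential p).comp h.1) fun x hx => by
        obtain ⟨y, rfl⟩ := (R.exact_succ p x).1 hx
        rw [Hom.sub_apply, Hom.comp_apply, h.2]
        exact sub_self _
    have hφ : ∀ x, (F.φ (p + 1)).1 x = R'.δ p (h.1.1 x) + h'.1 (R.δ (p + 1) x) := fun x => by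
      rw [show h'.1 (R.δ (p + 1) x) = (F.φ (p + 1)).1 x - R'.δ p (h.1.1 x) from hh' x]
      abel
    refine ⟨⟨h', fun x => ?_⟩, hφ⟩
    rw [F.δ_comm, hφ, map_add, R'.δ_δ, zero_add]
  choose next hnext using extend
  let H : ∀ p, {h : Hom (R.I (p + 1)) (R'.I p) // ∀ x,
      (F.φ (p + 1)).1 (R.δ p x) = R'.δ p (h.1 (R.δ p x))} :=
    fun p => Nat.rec ⟨h₀, fun x => by
      rw [show h₀.1 (R.δ 0 x) = (F.φ 0).1 x from hh₀ x]; exact F.δ_comm 0 x⟩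
      (fun p h => next p h) p
  exact ⟨fun p => (H p).1, fun x => (hh₀ x).symm, fun p x => hnext p (H p) x⟩

theorem map_cocycles (F : ResMap R R' f) (i : ℕ) (n : Fin r → ℤ) :
    ∀ x ∈ R.cocycles i n, (F.φ i).1 x ∈ R'.cocycles i n := fun x hx =>
  ⟨R.map_mem_cochains _ hx.1, by
    change R'.δ i ((F.φ i).1 x) = 0
    rw [← F.δ_comm, show R.δ i x = 0 from hx.2, map_zero]⟩

theorem map_coboundaries (F : ResMap R R' f) (i : ℕ) (n : Fin r → ℤ) :
    ∀ x ∈ R.coboundaries i n, (F.φ i).1 x ∈ R'.coboundaries i n := fun x hx => by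
  cases i with
  | zero => rw [R.mem_coboundaries_zero.1 hx, map_zero]; exact zero_mem _
  | succ i =>
    obtain ⟨y, hy, rfl⟩ := R.mem_coboundaries_succ.1 hx
    exact R'.mem_coboundaries_succ.2 ⟨_, R.map_mem_cochains _ hy, (F.δ_comm i y).symm⟩

/-- The map on cohomology induced by a morphism of resolutions. -/
def cohomologyMap (F : ResMap R R' f) (i : ℕ) (n : Fin r → ℤ) :
    R.cohomology i n →+ R'.cohomology i n :=
  R.inducedMap (F.φ i) (F.map_cocycles i n) (F.map_coboundaries i n)

theorem cohomologyMap_classOf (F : ResMap R R' f) {i : ℕ} {n : Fin r → ℤ} (x : (R.I i).carrier)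
    (hx : x ∈ R.cocycles i n) :
    F.cohomologyMap i n (R.classOf x hx) = R'.classOf ((F.φ i).1 x) (F.map_cocycles i n x hx) := rfl

/-- The difference of two morphisms of resolutions that cover the same morphism. -/
def sub (F G : ResMap R R' f) : ResMap R R' 0 where
  φ p := F.φ p - G.φ p
  ε_comm x := by simp [F.ε_comm, G.ε_comm]
  δ_comm p x := by simp [F.δ_comm, G.δ_comm]

theorem cohomologyMap_eq {f' : Hom M N} (h : f = f') (F : ResMap R R' f) (G : ResMap R R' f')
    (i : ℕ) (n : Fin r → ℤ) : F.cohomologyMap i n = G.cohomologyMap i n := by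
  subst h
  obtain ⟨h, φ_zero, φ_succ⟩ := (F.sub G).exists_homotopy
  refine AddMonoidHom.ext fun c => ?_
  obtain ⟨x, hx, rfl⟩ := R.classOf_surjective c
  rw [cohomologyMap_classOf, cohomologyMap_classOf, classOf_eq_iff]
  change ((F.sub G).φ i).1 x ∈ _
  cases i with
  | zero =>
    rw [φ_zero, show R.δ 0 x = 0 from hx.2, map_zero]; exact zero_mem _
  | succ i =>
    rw [φ_succ, show R.δ (i + 1) x = 0 from hx.2, map_zero, add_zero]
    exact ⟨_, R.map_mem_cochains _ hx.1, rfl⟩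

/-- The composition of morphisms of resolutions. -/
def comp (G : ResMap R' R'' g) (F : ResMap R R' f) : ResMap R R'' (g.comp f) where
  φ p := (G.φ p).comp (F.φ p)
  ε_comm x := by simp [F.ε_comm, G.ε_comm]
  δ_comm p x := by simp [F.δ_comm, G.δ_comm]

/-- The identity morphism of a resolution. -/
def id (R : InjRes M) : ResMap R R (Hom.id M) where
  φ _ := Hom.id _
  ε_comm _ := rfl
  δ_comm _ _ := rfl

/-- The sum of morphisms of resolutions. -/
def add {f' : Hom M N} (F : ResMap R R' f) (G : ResMap R R' f') : ResMap R R' (f + f') where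
  φ p := F.φ p + G.φ p
  ε_comm x := by simp [F.ε_comm, G.ε_comm]
  δ_comm p x := by simp [F.δ_comm, G.δ_comm]

theorem cohomologyMap_comp (G : ResMap R' R'' g) (F : ResMap R R' f) (i : ℕ) (n : Fin r → ℤ) :
    (G.comp F).cohomologyMap i n = (G.cohomologyMap i n).comp (F.cohomologyMap i n) := by
  refine AddMonoidHom.ext fun c => ?_
  obtain ⟨x, hx, rfl⟩ := R.classOf_surjective c
  rfl

theorem cohomologyMap_id (R : InjRes M) (i : ℕ) (n : Fin r → ℤ) :
    (ResMap.id R).cohomologyMap i n = AddMonoidHom.id _ := by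
  refine AddMonoidHom.ext fun c => ?_
  obtain ⟨x, hx, rfl⟩ := R.classOf_surjective c
  rfl

theorem cohomologyMap_add {f' : Hom M N} (F : ResMap R R' f) (G : ResMap R R' f') (i : ℕ)
    (n : Fin r → ℤ) : (F.add G).cohomologyMap i n = F.cohomologyMap i n + G.cohomologyMap i n := by
  refine AddMonoidHom.ext fun c => ?_
  obtain ⟨x, hx, rfl⟩ := R.classOf_surjective c
  rfl

theorem cohomologyMap_comp_eq_id {R R' : InjRes M} (G : ResMap R' R (Hom.id M))
    (F : ResMap R R' (Hom.id M)) (i : ℕ) (n : Fin r → ℤ) :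
    (G.cohomologyMap i n).comp (F.cohomologyMap i n) = AddMonoidHom.id _ := by
  rw [← cohomologyMap_comp, ← cohomologyMap_id]
  exact cohomologyMap_eq rfl (G.comp F) (ResMap.id R) i n

end ResMap

/-- Two injective resolutions of the same module have the same local cohomology. -/
noncomputable def cohomologyEquiv (R R' : InjRes M) (i : ℕ) (n : Fin r → ℤ) :
    R.cohomology i n ≃+ R'.cohomology i n :=
  AddMonoidHom.toAddEquiv ((exists_resMap R R' (Hom.id M)).some.cohomologyMap i n)
    ((exists_resMap R' R (Hom.id M)).some.cohomologyMap i n)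
    (ResMap.cohomologyMap_comp_eq_id _ _ i n) (ResMap.cohomologyMap_comp_eq_id _ _ i n)

end InjRes

open InjRes

/-! ### Local cohomology and its functoriality -/

section Functor

variable (ρ : ∀ N : GrMod 𝒜, InjRes N) {M N P : GrMod 𝒜}

/-- The degree `n` component of `H^i_𝓜(M)`, computed with a choice `ρ` of injective resolutions of
all graded modules. -/
abbrev H (M : GrMod 𝒜) (i : ℕ) (n : Fin r → ℤ) : Type u := (ρ M).cohomology i n

/-- The map `H^i_𝓜(M)_n → H^i_𝓜(N)_n` induced by a morphism `M → N`. -/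
noncomputable def Hmap (f : Hom M N) (i : ℕ) (n : Fin r → ℤ) : H ρ M i n →+ H ρ N i n :=
  (exists_resMap (ρ M) (ρ N) f).some.cohomologyMap i n

theorem Hmap_eq {f : Hom M N} (F : ResMap (ρ M) (ρ N) f) (i : ℕ) (n : Fin r → ℤ) :
    Hmap ρ f i n = F.cohomologyMap i n := ResMap.cohomologyMap_eq rfl _ _ _ _

theorem cohomologyEquiv_comp_cohomologyMap {Q : InjRes N} {f : Hom M N} (F : ResMap (ρ M) Q f)
    (i : ℕ) (n : Fin r → ℤ) :
    AddMonoidHom.comp (Q.cohomologyEquiv (ρ N) i n) (F.cohomologyMap i n) = Hmap ρ f i n :=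
  let U := (exists_resMap Q (ρ N) (Hom.id N)).some
  (U.cohomologyMap_comp F i n).symm.trans
    (ResMap.cohomologyMap_eq (Hom.ext fun _ => rfl) (U.comp F) _ i n)

theorem Hmap_comp_cohomologyEquiv {Q : InjRes M} {f : Hom M N} (F : ResMap Q (ρ N) f)
    (i : ℕ) (n : Fin r → ℤ) :
    (Hmap ρ f i n).comp (Q.cohomologyEquiv (ρ M) i n) = F.cohomologyMap i n :=
  let U := (exists_resMap Q (ρ M) (Hom.id M)).some
  let V := (exists_resMap (ρ M) (ρ N) f).some
  (V.cohomologyMap_comp U i n).symm.trans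
    (ResMap.cohomologyMap_eq (Hom.ext fun _ => rfl) (V.comp U) F i n)

theorem Hmap_id (i : ℕ) (n : Fin r → ℤ) : Hmap ρ (Hom.id M) i n = AddMonoidHom.id _ := by
  rw [Hmap_eq ρ (ResMap.id (ρ M)), ResMap.cohomologyMap_id]

theorem Hmap_comp (g : Hom N P) (f : Hom M N) (i : ℕ) (n : Fin r → ℤ) :
    Hmap ρ (g.comp f) i n = (Hmap ρ g i n).comp (Hmap ρ f i n) := by
  rw [Hmap_eq ρ ((exists_resMap (ρ N) (ρ P) g).some.comp (exists_resMap (ρ M) (ρ N) f).some),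
    ResMap.cohomologyMap_comp]
  rfl

theorem Hmap_add (f g : Hom M N) (i : ℕ) (n : Fin r → ℤ) :
    Hmap ρ (f + g) i n = Hmap ρ f i n + Hmap ρ g i n := by
  rw [Hmap_eq ρ ((exists_resMap (ρ M) (ρ N) f).some.add (exists_resMap (ρ M) (ρ N) g).some),
    ResMap.cohomologyMap_add]
  rfl

/-- `GrMod.Hmap` as a homomorphism in the morphism. -/
noncomputable def HmapHom (M N : GrMod 𝒜) (i : ℕ) (n : Fin r → ℤ) :
    Hom M N →+ (H ρ M i n →+ H ρ N i n) :=
  AddMonoidHom.mk' (fun f => Hmap ρ f i n) fun f g => Hmap_add ρ f g i n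

theorem Hmap_zero (i : ℕ) (n : Fin r → ℤ) : Hmap ρ (0 : Hom M N) i n = 0 :=
  map_zero (HmapHom ρ M N i n)

theorem Hmap_sum {ι : Type*} (s : Finset ι) (f : ι → Hom M N) (i : ℕ) (n : Fin r → ℤ) :
    Hmap ρ (∑ j ∈ s, f j) i n = ∑ j ∈ s, Hmap ρ (f j) i n :=
  map_sum (HmapHom ρ M N i n) f s

theorem mem_localCohomologySupport_iff {i : ℕ} {n : Fin r → ℤ} :
    n ∈ M.localCohomologySupport i ↔ Nontrivial (H ρ M i n) :=
  ⟨fun ⟨R, hR⟩ => (R.cohomologyEquiv (ρ M) i n).toEquiv.nontrivial_congr.1 hR, fun h => ⟨ρ M, h⟩⟩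

end Functor

/-! ### The long exact sequence -/

theorem prod_isInjective {E E' : GrMod 𝒜} (hE : E.IsInjective) (hE' : E'.IsInjective) :
    (prod E E').IsInjective := by
  intro A B i f hi hi' hf
  obtain ⟨g, hg, hgi⟩ := hE A B i ((LinearMap.fst S E.carrier E'.carrier).comp f) hi hi'
    fun n x hx => (hf n x hx).1
  obtain ⟨g', hg', hgi'⟩ := hE' A B i ((LinearMap.snd S E.carrier E'.carrier).comp f) hi hi'
    fun n x hx => (hf n x hx).2
  exact ⟨g.prod g', fun n x hx => ⟨hg n x hx, hg' n x hx⟩, LinearMap.ext fun x =>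
    Prod.ext (LinearMap.congr_fun hgi x) (LinearMap.congr_fun hgi' x)⟩

theorem mem_gammaTorsion_prod {I : Ideal S} {X Y : Type u} [AddCommGroup X] [AddCommGroup Y]
    [Module S X] [Module S Y] {z : X × Y} :
    z ∈ gammaTorsion I (X × Y) ↔ z.1 ∈ gammaTorsion I X ∧ z.2 ∈ gammaTorsion I Y := by
  constructor
  · rintro ⟨t, ht⟩
    exact ⟨⟨t, fun a ha => congrArg Prod.fst (ht a ha)⟩,
      ⟨t, fun a ha => congrArg Prod.snd (ht a ha)⟩⟩
  · rintro ⟨⟨s, hs⟩, ⟨t, ht⟩⟩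
    refine ⟨s + t, fun a ha => Prod.ext ?_ ?_⟩
    · exact hs a (Ideal.pow_le_pow_right (Nat.le_add_right s t) ha)
    · exact ht a (Ideal.pow_le_pow_right (Nat.le_add_left t s) ha)

section LongExact

variable {A B C : GrMod 𝒜}

/-- Short exact sequences of graded modules. -/
structure IsShortExact (f : Hom A B) (g : Hom B C) : Prop where
  injective : Function.Injective f.1
  surjective : Function.Surjective g.1
  exact : Function.Exact f.1 g.1

/-- The off-diagonal part of an injective resolution of `B` with terms `R.I p × R'.I p`: the
augmentation of that resolution is `x ↦ (α x, R'.ε (g x))` and its differential is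
`(a, c) ↦ (R.δ a + θ c, R'.δ c)`. -/
structure Twist (f : Hom A B) (g : Hom B C) (R : InjRes A) (R' : InjRes C) where
  α : Hom B (R.I 0)
  θ : ∀ p, Hom (R'.I p) (R.I (p + 1))
  α_apply : ∀ x, α.1 (f.1 x) = R.ε x
  δ_α : ∀ x, R.δ 0 (α.1 x) + (θ 0).1 (R'.ε (g.1 x)) = 0
  θ_δ : ∀ p x, (θ (p + 1)).1 (R'.δ p x) = -R.δ (p + 1) ((θ p).1 x)

theorem IsShortExact.nonempty_twist {f : Hom A B} {g : Hom B C} (h : IsShortExact f g)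
    (R : InjRes A) (R' : InjRes C) : Nonempty (Twist f g R R') := by
  obtain ⟨α, hα⟩ := (R.inj 0).exists_extension f R.augmentation fun x hx => by
    rw [h.injective (a₁ := x) (a₂ := 0) (hx.trans (map_zero _).symm), map_zero]
  obtain ⟨θ₀, hθ₀⟩ := (R.inj 1).exists_extension (R'.augmentation.comp g)
    (-((R.differential 0).comp α)) fun x hx => by
      obtain ⟨y, rfl⟩ := (h.exact x).1 (R'.ε_injective (hx.trans (map_zero _).symm))
      rw [Hom.neg_apply, Hom.comp_apply, hα, neg_eq_zero]
      exact R.δ_ε y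
  obtain ⟨θ, rfl, hθ⟩ := exists_lift_of_exact R'.I (fun p => R.I (p + 1)) R'.differential
    (fun p => -R.differential (p + 1)) R'.exact_succ
    (fun p x => by
      rw [Hom.neg_apply, Hom.neg_apply, map_neg, neg_neg]; exact R.δ_δ _ x)
    (fun p => R.inj _) θ₀ fun x hx => by
      obtain ⟨y, rfl⟩ := (R'.exact_zero x).1 hx
      obtain ⟨z, rfl⟩ := h.surjective y
      rw [show θ₀.1 (R'.ε (g.1 z)) = _ from hθ₀ z]
      simp only [Hom.neg_apply, Hom.comp_apply, map_neg, neg_neg]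
      exact R.δ_δ 0 _
  refine ⟨⟨α, θ, hα, fun x => ?_, hθ⟩⟩
  rw [show (θ 0).1 (R'.ε (g.1 x)) = -(R.δ 0 (α.1 x)) from hθ₀ x, add_neg_cancel]

namespace Twist

variable {f : Hom A B} {g : Hom B C} {R : InjRes A} {R' : InjRes C} (T : Twist f g R R')

/-- The augmentation `x ↦ (α x, R'.ε (g x))`. -/
def augmentation : B.carrier →ₗ[S] (prod (R.I 0) (R'.I 0)).carrier :=
  T.α.1.prod (R'.ε ∘ₗ g.1)

/-- The differential `(a, c) ↦ (R.δ a + θ c, R'.δ c)`. -/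
def differential (p : ℕ) :
    (prod (R.I p) (R'.I p)).carrier →ₗ[S] (prod (R.I (p + 1)) (R'.I (p + 1))).carrier :=
  (R.δ p ∘ₗ LinearMap.fst S _ _ + (T.θ p).1 ∘ₗ LinearMap.snd S _ _).prod
    (R'.δ p ∘ₗ LinearMap.snd S _ _)

theorem differential_eq_iff {p : ℕ} {a : (R.I p).carrier} {c : (R'.I p).carrier}
    {a' : (R.I (p + 1)).carrier} {c' : (R'.I (p + 1)).carrier} :
    T.differential p (a, c) = (a', c') ↔ R.δ p a + (T.θ p).1 c = a' ∧ R'.δ p c = c' :=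
  Prod.ext_iff

theorem augmentation_injective (h : IsShortExact f g) : Function.Injective T.augmentation := by
  refine (injective_iff_map_eq_zero _).2 fun x hx => ?_
  obtain ⟨hα, hε⟩ := Prod.ext_iff.1 hx
  obtain ⟨y, rfl⟩ := (h.exact x).1 (R'.ε_injective (hε.trans (map_zero _).symm))
  rw [R.ε_injective (((T.α_apply y).symm.trans hα).trans (map_zero _).symm), map_zero]

theorem exact_augmentation (h : IsShortExact f g) :
    Function.Exact T.augmentation (T.differential 0) := by
  rintro ⟨a, c⟩
  constructor
  · intro hx
    obtain ⟨ha, hc⟩ := T.differential_eq_iff.1 hx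
    obtain ⟨y, rfl⟩ := (R'.exact_zero c).1 hc
    obtain ⟨z, rfl⟩ := h.surjective y
    have hδ : R.δ 0 (a - T.α.1 z) = 0 := by
      rw [map_sub, eq_neg_of_add_eq_zero_left ha, eq_neg_of_add_eq_zero_left (T.δ_α z), sub_self]
    obtain ⟨w, hw⟩ := (R.exact_zero _).1 hδ
    refine ⟨f.1 w + z, Prod.ext ?_ ?_⟩
    · change T.α.1 (f.1 w + z) = a
      rw [map_add, T.α_apply, hw, sub_add_cancel]
    · change R'.ε (g.1 (f.1 w + z)) = R'.ε (g.1 z)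
      rw [map_add, (h.exact _).2 ⟨w, rfl⟩, zero_add]
  · rintro ⟨y, hy⟩
    rw [← hy]
    exact T.differential_eq_iff.2 ⟨T.δ_α y, R'.δ_ε _⟩

theorem exact_differential (p : ℕ) :
    Function.Exact (T.differential p) (T.differential (p + 1)) := by
  rintro ⟨a, c⟩
  constructor
  · intro hx
    obtain ⟨ha, hc⟩ := T.differential_eq_iff.1 hx
    obtain ⟨y, rfl⟩ := (R'.exact_succ p c).1 hc
    rw [T.θ_δ, ← sub_eq_add_neg, ← map_sub] at ha
    obtain ⟨w, hw⟩ := (R.exact_succ p _).1 ha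
    exact ⟨(w, y), T.differential_eq_iff.2 ⟨by rw [hw, sub_add_cancel], rfl⟩⟩
  · rintro ⟨⟨y, z⟩, hy⟩
    obtain ⟨rfl, rfl⟩ := T.differential_eq_iff.1 hy
    refine T.differential_eq_iff.2 ⟨?_, R'.δ_δ p z⟩
    rw [map_add, R.δ_δ, zero_add, T.θ_δ, add_neg_cancel]

/-- The resolution of the middle term of a short exact sequence built from resolutions of the
outer terms. -/
def horseshoe (h : IsShortExact f g) : InjRes B where
  I p := prod (R.I p) (R'.I p)
  inj p := prod_isInjective (R.inj p) (R'.inj p)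
  ε := T.augmentation
  δ := T.differential
  ε_hom _ _ hx := ⟨T.α.mem hx, R'.ε_hom _ _ (g.mem hx)⟩
  δ_hom p _ _ hx := ⟨add_mem (R.δ_hom _ _ _ hx.1) ((T.θ p).mem hx.2), R'.δ_hom _ _ _ hx.2⟩
  ε_injective := T.augmentation_injective h
  exact_zero := T.exact_augmentation h
  exact_succ := T.exact_differential

variable (h : IsShortExact f g)

/-- The inclusion of the first factor of the horseshoe resolution. -/
def inl : ResMap R (T.horseshoe h) f where
  φ p := ⟨LinearMap.inl S _ _, fun _ _ hx => ⟨hx, zero_mem _⟩⟩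
  ε_comm x := Prod.ext (T.α_apply x).symm (by
    change 0 = R'.ε (g.1 (f.1 x))
    rw [(h.exact _).2 ⟨x, rfl⟩, map_zero])
  δ_comm p x := Eq.symm (T.differential_eq_iff.2
    ⟨(congrArg (R.δ p x + ·) (map_zero (T.θ p).1)).trans (add_zero _), map_zero _⟩)

/-- The projection of the horseshoe resolution to its second factor. -/
def snd : ResMap (T.horseshoe h) R' g where
  φ _ := ⟨LinearMap.snd S _ _, fun _ _ hx => hx.2⟩
  ε_comm _ := rfl
  δ_comm _ _ := rfl

variable {h} {i : ℕ} {n : Fin r → ℤ}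

theorem mem_cochains_horseshoe {a : (R.I i).carrier} {c : (R'.I i).carrier} :
    ((a, c) : ((T.horseshoe h).I i).carrier) ∈ (T.horseshoe h).cochains i n ↔
      a ∈ R.cochains i n ∧ c ∈ R'.cochains i n :=
  (and_congr_right fun _ => mem_gammaTorsion_prod).trans and_and_and_comm

theorem mem_cocycles_horseshoe {a : (R.I i).carrier} {c : (R'.I i).carrier} :
    ((a, c) : ((T.horseshoe h).I i).carrier) ∈ (T.horseshoe h).cocycles i n ↔
      (a ∈ R.cochains i n ∧ R.δ i a + (T.θ i).1 c = 0) ∧ c ∈ R'.cocycles i n :=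
  (and_congr T.mem_cochains_horseshoe T.differential_eq_iff).trans and_and_and_comm

theorem mem_coboundaries_horseshoe {a : (R.I (i + 1)).carrier} {c : (R'.I (i + 1)).carrier} :
    ((a, c) : ((T.horseshoe h).I (i + 1)).carrier) ∈ (T.horseshoe h).coboundaries (i + 1) n ↔
      ∃ a' ∈ R.cochains i n, ∃ c' ∈ R'.cochains i n,
        R.δ i a' + (T.θ i).1 c' = a ∧ R'.δ i c' = c := by
  refine (mem_coboundaries_succ _).trans ⟨?_, ?_⟩
  · rintro ⟨⟨a', c'⟩, hy, hyd⟩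
    obtain ⟨ha', hc'⟩ := T.mem_cochains_horseshoe.1 hy
    exact ⟨a', ha', c', hc', T.differential_eq_iff.1 hyd⟩
  · rintro ⟨a', ha', c', hc', hd⟩
    exact ⟨(a', c'), T.mem_cochains_horseshoe.2 ⟨ha', hc'⟩, T.differential_eq_iff.2 hd⟩

theorem θ_mem_cocycles (x : (R'.I i).carrier) (hx : x ∈ R'.cocycles i n) :
    (T.θ i).1 x ∈ R.cocycles (i + 1) n :=
  ⟨R'.map_mem_cochains _ hx.1, by
    change R.δ (i + 1) ((T.θ i).1 x) = 0
    rw [← neg_eq_zero, ← T.θ_δ, show R'.δ i x = 0 from hx.2, map_zero]⟩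

theorem θ_mem_coboundaries (x : (R'.I i).carrier) (hx : x ∈ R'.coboundaries i n) :
    (T.θ i).1 x ∈ R.coboundaries (i + 1) n := by
  cases i with
  | zero => rw [R'.mem_coboundaries_zero.1 hx, map_zero]; exact zero_mem _
  | succ i =>
    obtain ⟨y, hy, rfl⟩ := R'.mem_coboundaries_succ.1 hx
    rw [T.θ_δ]
    exact neg_mem ⟨_, R'.map_mem_cochains (T.θ i) hy, rfl⟩

/-- The connecting homomorphism of the long exact sequence. -/
def connecting (i : ℕ) (n : Fin r → ℤ) : R'.cohomology i n →+ R.cohomology (i + 1) n :=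
  R'.inducedMap (T.θ i) T.θ_mem_cocycles T.θ_mem_coboundaries

variable (h i n)

theorem cohomologyMap_inl_injective :
    Function.Injective ((T.inl h).cohomologyMap 0 n) := by
  refine (injective_iff_map_eq_zero _).2 fun c hc => ?_
  obtain ⟨a, hx, rfl⟩ := R.classOf_surjective c
  rw [ResMap.cohomologyMap_classOf, classOf_eq_zero_iff] at hc
  rw [classOf_eq_zero_iff]
  exact (Prod.ext_iff.1 ((T.horseshoe h).mem_coboundaries_zero.1 hc)).1

theorem exact_inl_snd :
    Function.Exact ((T.inl h).cohomologyMap i n) ((T.snd h).cohomologyMap i n) := by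
  intro z
  constructor
  · intro hz
    obtain ⟨⟨a, c⟩, hx, rfl⟩ := (T.horseshoe h).classOf_surjective z
    replace hz : c ∈ R'.coboundaries i n :=
      (R'.classOf_eq_zero_iff ((T.snd h).map_cocycles i n _ hx)).1 hz
    obtain ⟨⟨ha, hd⟩, -⟩ := T.mem_cocycles_horseshoe.1 hx
    cases i with
    | zero =>
      obtain rfl : c = 0 := hz
      rw [map_zero, add_zero] at hd
      exact ⟨R.classOf a ⟨ha, hd⟩, rfl⟩
    | succ i =>
      obtain ⟨y, hy, rfl⟩ := R'.mem_coboundaries_succ.1 hz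
      rw [T.θ_δ, ← sub_eq_add_neg, ← map_sub] at hd
      have hcycle : a - (T.θ i).1 y ∈ R.cocycles (i + 1) n :=
        ⟨(R.cochains (i + 1) n).sub_mem ha (R'.map_mem_cochains _ hy), hd⟩
      refine ⟨R.classOf _ hcycle,
        ((T.horseshoe h).classOf_eq_iff ((T.inl h).map_cocycles _ _ _ hcycle) hx).2
          (T.mem_coboundaries_horseshoe.2 ⟨0, zero_mem _, -y, neg_mem hy, ?_, ?_⟩)⟩
      · rw [map_zero, map_neg]
        change _ = a - (T.θ i).1 y - a
        abel
      · rw [map_neg]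
        exact (zero_sub _).symm
  · rintro ⟨c, rfl⟩
    obtain ⟨a, ha, rfl⟩ := R.classOf_surjective c
    rw [ResMap.cohomologyMap_classOf, ResMap.cohomologyMap_classOf, classOf_eq_zero_iff]
    exact zero_mem _

theorem exact_snd_connecting :
    Function.Exact ((T.snd h).cohomologyMap i n) (T.connecting i n) := by
  intro z
  constructor
  · intro hz
    obtain ⟨c, hx, rfl⟩ := R'.classOf_surjective z
    rw [connecting, inducedMap_classOf, classOf_eq_zero_iff] at hz
    obtain ⟨a, ha, hac⟩ := R.mem_coboundaries_succ.1 hz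
    refine ⟨(T.horseshoe h).classOf ((-a, c) : ((T.horseshoe h).I i).carrier)
      (T.mem_cocycles_horseshoe.2 ⟨⟨neg_mem ha, ?_⟩, hx⟩), rfl⟩
    rw [map_neg, hac, neg_add_cancel]
  · rintro ⟨c, rfl⟩
    obtain ⟨⟨a, c⟩, hx, rfl⟩ := (T.horseshoe h).classOf_surjective c
    obtain ⟨⟨ha, hd⟩, hc⟩ := T.mem_cocycles_horseshoe.1 hx
    refine (R.classOf_eq_zero_iff (T.θ_mem_cocycles _ hc)).2 ⟨-a, neg_mem ha, ?_⟩
    change R.δ i (-a) = (T.θ i).1 c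
    rw [map_neg, neg_eq_of_add_eq_zero_right hd]

theorem exact_connecting_inl :
    Function.Exact (T.connecting i n) ((T.inl h).cohomologyMap (i + 1) n) := by
  intro z
  constructor
  · intro hz
    obtain ⟨a, hx, rfl⟩ := R.classOf_surjective z
    rw [ResMap.cohomologyMap_classOf, classOf_eq_zero_iff] at hz
    obtain ⟨a', ha', c', hc', had, hcd⟩ := T.mem_coboundaries_horseshoe.1 hz
    refine ⟨R'.classOf c' ⟨hc', hcd⟩,
      (R.classOf_eq_iff (T.θ_mem_cocycles _ ⟨hc', hcd⟩) hx).2 ⟨-a', neg_mem ha', ?_⟩⟩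
    change R.δ i (-a') = _
    rw [← show R.δ i a' + (T.θ i).1 c' = a from had, map_neg]
    abel
  · rintro ⟨c, rfl⟩
    obtain ⟨c, hx, rfl⟩ := R'.classOf_surjective c
    rw [connecting, inducedMap_classOf, ResMap.cohomologyMap_classOf, classOf_eq_zero_iff]
    refine T.mem_coboundaries_horseshoe.2 ⟨0, zero_mem _, c, hx.1, ?_, hx.2⟩
    exact (congrArg (· + (T.θ i).1 c) (map_zero (R.δ i))).trans (zero_add _)

end Twist

namespace IsShortExact

variable (ρ : ∀ N : GrMod 𝒜, InjRes N) {f : Hom A B} {g : Hom B C}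

theorem exact_Hmap (h : IsShortExact f g) (i : ℕ) (n : Fin r → ℤ) :
    Function.Exact (Hmap ρ f i n) (Hmap ρ g i n) := by
  obtain ⟨T⟩ := h.nonempty_twist (ρ A) (ρ C)
  exact Function.Exact.of_ladder_addEquiv_of_exact (e₁ := .refl _)
    (e₂ := (T.horseshoe h).cohomologyEquiv (ρ B) i n) (e₃ := .refl _)
    (cohomologyEquiv_comp_cohomologyMap ρ (T.inl h) i n).symm
    (Hmap_comp_cohomologyEquiv ρ (T.snd h) i n) (T.exact_inl_snd h i n)

theorem exists_connecting (h : IsShortExact f g) (i : ℕ) (n : Fin r → ℤ) :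
    ∃ d : H ρ C i n →+ H ρ A (i + 1) n,
      Function.Exact (Hmap ρ g i n) d ∧ Function.Exact d (Hmap ρ f (i + 1) n) := by
  obtain ⟨T⟩ := h.nonempty_twist (ρ A) (ρ C)
  exact ⟨T.connecting i n,
    Function.Exact.of_ladder_addEquiv_of_exact
      (e₁ := (T.horseshoe h).cohomologyEquiv (ρ B) i n) (e₂ := .refl _) (e₃ := .refl _)
      (Hmap_comp_cohomologyEquiv ρ (T.snd h) i n) rfl (T.exact_snd_connecting h i n),
    Function.Exact.of_ladder_addEquiv_of_exact (e₁ := .refl _) (e₂ := .refl _)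
      (e₃ := (T.horseshoe h).cohomologyEquiv (ρ B) (i + 1) n) rfl
      (cohomologyEquiv_comp_cohomologyMap ρ (T.inl h) (i + 1) n).symm
      (T.exact_connecting_inl h i n)⟩

theorem Hmap_zero_injective (h : IsShortExact f g) (n : Fin r → ℤ) :
    Function.Injective (Hmap ρ f 0 n) := by
  obtain ⟨T⟩ := h.nonempty_twist (ρ A) (ρ C)
  rw [← cohomologyEquiv_comp_cohomologyMap ρ (T.inl h) 0 n]
  exact ((T.horseshoe h).cohomologyEquiv (ρ B) 0 n).injective.comp
    (T.cohomologyMap_inl_injective h n)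

end IsShortExact

end LongExact

/-! ### Vanishing of local cohomology -/

section Vanishing

variable {ρ : ∀ N : GrMod 𝒜, InjRes N} {i : ℕ} {n : Fin r → ℤ}

namespace IsShortExact

variable {A B C : GrMod 𝒜} {f : Hom A B} {g : Hom B C}

theorem subsingleton_middle (h : IsShortExact f g) (hA : Subsingleton (H ρ A i n))
    (hC : Subsingleton (H ρ C i n)) : Subsingleton (H ρ B i n) := by
  refine subsingleton_of_forall_eq 0 fun b => ?_
  obtain ⟨a, rfl⟩ := (h.exact_Hmap ρ i n b).1 (hC.elim _ _)
  rw [hA.elim a 0, map_zero]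

theorem injective_Hmap_succ (h : IsShortExact f g) (hC : Subsingleton (H ρ C i n)) :
    Function.Injective (Hmap ρ f (i + 1) n) := by
  obtain ⟨d, -, hd⟩ := h.exists_connecting ρ i n
  refine (injective_iff_map_eq_zero _).2 fun a ha => ?_
  obtain ⟨c, rfl⟩ := (hd a).1 ha
  rw [hC.elim c 0, map_zero]

theorem injective_Hmap (h : IsShortExact f g) (hA : Subsingleton (H ρ A i n)) :
    Function.Injective (Hmap ρ g i n) := by
  refine (injective_iff_map_eq_zero _).2 fun b hb => ?_
  obtain ⟨a, rfl⟩ := (h.exact_Hmap ρ i n b).1 hb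
  rw [hA.elim a 0, map_zero]

theorem surjective_Hmap (h : IsShortExact f g) (hA : Subsingleton (H ρ A (i + 1) n)) :
    Function.Surjective (Hmap ρ g i n) := by
  obtain ⟨d, hd, -⟩ := h.exists_connecting ρ i n
  exact fun c => (hd c).1 (hA.elim _ _)

theorem subsingleton_left (h : IsShortExact f g) (hC : Subsingleton (H ρ C i n))
    (hB : Subsingleton (H ρ B (i + 1) n)) : Subsingleton (H ρ A (i + 1) n) :=
  ⟨fun _ _ => h.injective_Hmap_succ hC (hB.elim _ _)⟩

theorem subsingleton_left_zero (h : IsShortExact f g) (hB : Subsingleton (H ρ B 0 n)) :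
    Subsingleton (H ρ A 0 n) :=
  ⟨fun _ _ => h.Hmap_zero_injective ρ n (hB.elim _ _)⟩

theorem subsingleton_right (h : IsShortExact f g) (hB : Subsingleton (H ρ B i n))
    (hA : Subsingleton (H ρ A (i + 1) n)) : Subsingleton (H ρ C i n) :=
  subsingleton_of_forall_eq 0 fun c => by
    obtain ⟨b, rfl⟩ := h.surjective_Hmap hA c
    rw [hB.elim b 0, map_zero]

end IsShortExact

theorem subsingleton_H_of_retract {M N : GrMod 𝒜} (ι : Hom M N) (p : Hom N M)
    (hp : p.comp ι = Hom.id M) (hN : Subsingleton (H ρ N i n)) : Subsingleton (H ρ M i n) := by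
  have hinv : (Hmap ρ p i n).comp (Hmap ρ ι i n) = AddMonoidHom.id _ := by
    rw [← Hmap_comp, hp, Hmap_id]
  have hleft : Function.LeftInverse (Hmap ρ p i n) (Hmap ρ ι i n) := DFunLike.congr_fun hinv
  exact ⟨fun _ _ => hleft.injective (hN.elim _ _)⟩

theorem subsingleton_H_of_Hmap_id_eq_zero {M : GrMod 𝒜} (h : Hmap ρ (Hom.id M) i n = 0) :
    Subsingleton (H ρ M i n) :=
  subsingleton_of_forall_eq 0 fun c => DFunLike.congr_fun ((Hmap_id ρ i n).symm.trans h) c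

theorem subsingleton_H_of_subsingleton {M : GrMod 𝒜} (hM : Subsingleton M.carrier) (i : ℕ)
    (n : Fin r → ℤ) : Subsingleton (H ρ M i n) := by
  refine subsingleton_H_of_Hmap_id_eq_zero ?_
  rw [show Hom.id M = 0 from Hom.ext fun _ => hM.elim _ _, Hmap_zero]

theorem Hmap_comp_eq_zero {M N P : GrMod 𝒜} (g : Hom N P) (f : Hom M N)
    (hN : Subsingleton (H ρ N i n)) : Hmap ρ (g.comp f) i n = 0 := by
  refine AddMonoidHom.ext fun c => ?_
  rw [Hmap_comp, AddMonoidHom.comp_apply, hN.elim (Hmap ρ f i n c) 0, map_zero]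
  rfl

end Vanishing

theorem isShortExact_prod (A B : GrMod 𝒜) :
    IsShortExact (A := A) (B := prod A B) (C := B)
      ⟨LinearMap.inl S _ _, fun _ _ hx => ⟨hx, zero_mem _⟩⟩
      ⟨LinearMap.snd S _ _, fun _ _ hx => hx.2⟩ where
  injective := LinearMap.inl_injective
  surjective := LinearMap.snd_surjective
  exact := Function.Exact.inl_snd

theorem isShortExact_quot {M : GrMod 𝒜} (K : Submodule S M.carrier) (hK : M.IsHomogeneous K) :
    IsShortExact (subIncl K hK) (quotProj K hK) where
  injective := subIncl_injective K hK
  surjective := quotProj_surjective K hK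
  exact x := by
    rw [quotProj_eq_zero_iff]
    exact ⟨fun hx => ⟨⟨x, hx⟩, rfl⟩, by rintro ⟨y, rfl⟩; exact y.2⟩

theorem nontrivial_cohomology_zero_iff {M : GrMod 𝒜} (R : InjRes M) {n : Fin r → ℤ} :
    Nontrivial (R.cohomology 0 n) ↔
      ∃ x ∈ M.gr n, x ≠ 0 ∧ x ∈ gammaTorsion (maxIdeal 𝒜) M.carrier := by
  rw [nontrivial_iff_exists]
  constructor
  · rintro ⟨_, ⟨⟨hx, t, ht⟩, hδ⟩, hx0⟩
    obtain ⟨y, rfl⟩ := (R.exact_zero _).1 hδ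
    have hy : M.proj n y = y := R.ε_injective <|
      (R.augmentation.map_proj n y).trans ((R.I 0).proj_of_mem hx)
    refine ⟨y, hy ▸ M.proj_mem n y, ?_, t, fun a ha => R.ε_injective ?_⟩
    · rintro rfl
      exact hx0 (map_zero R.ε)
    · rw [map_smul, ht a ha, map_zero]
  · rintro ⟨x, hx, hx0, hxt⟩
    refine ⟨R.ε x, ⟨⟨R.ε_hom _ _ hx, R.augmentation.map_gammaTorsion _ hxt⟩, R.δ_ε x⟩,
      fun h => hx0 ?_⟩
    exact R.ε_injective ((R.mem_coboundaries_zero.1 h).trans (map_zero _).symm)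

section Shift

theorem IsInjective.shift {E : GrMod 𝒜} (hE : E.IsInjective) (a : Fin r → ℤ) :
    (E.shift a).IsInjective := by
  intro A B i f hi hi' hf
  obtain ⟨g, hg, hgi⟩ := hE (A.shift (-a)) (B.shift (-a)) i f (fun n x hx => hi _ x hx) hi'
    fun n x hx => by
      have hfx := hf _ x hx
      change f x ∈ E.gr (a + (-a + n)) at hfx
      rwa [add_neg_cancel_left] at hfx
  refine ⟨g, fun n x hx => hg (a + n) x ?_, hgi⟩
  change x ∈ B.gr (-a + (a + n))
  rwa [neg_add_cancel_left]

/-- The shift of an injective resolution. -/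
def shiftRes {M : GrMod 𝒜} (R : InjRes M) (a : Fin r → ℤ) : InjRes (M.shift a) where
  I p := (R.I p).shift a
  inj p := (R.inj p).shift a
  ε := R.ε
  δ := R.δ
  ε_hom _ _ hx := R.ε_hom _ _ hx
  δ_hom _ _ _ hx := R.δ_hom _ _ _ hx
  ε_injective := R.ε_injective
  exact_zero := R.exact_zero
  exact_succ := R.exact_succ

theorem mem_coboundaries_shiftRes {M : GrMod 𝒜} (R : InjRes M) (a : Fin r → ℤ) {i : ℕ}
    {n : Fin r → ℤ} {x : (R.I i).carrier} :
    x ∈ (shiftRes R a).coboundaries i n ↔ x ∈ R.coboundaries i (a + n) := by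
  cases i <;> exact Iff.rfl

variable (ρ : ∀ N : GrMod 𝒜, InjRes N) (M : GrMod 𝒜) (a : Fin r → ℤ) (i : ℕ) (n : Fin r → ℤ)

theorem nontrivial_H_shift_iff :
    Nontrivial (H ρ (M.shift a) i n) ↔ Nontrivial (H ρ M i (a + n)) := by
  rw [((ρ (M.shift a)).cohomologyEquiv (shiftRes (ρ M) a) i n).toEquiv.nontrivial_congr,
    nontrivial_iff_exists, nontrivial_iff_exists]
  exact exists_congr fun x => and_congr_right fun _ =>
    not_congr (mem_coboundaries_shiftRes (ρ M) a)

theorem subsingleton_H_shift_iff :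
    Subsingleton (H ρ (M.shift a) i n) ↔ Subsingleton (H ρ M i (a + n)) := by
  rw [← not_nontrivial_iff_subsingleton, nontrivial_H_shift_iff, not_nontrivial_iff_subsingleton]

end Shift

section Mul

open Pointwise

variable {M : GrMod 𝒜} {m : Fin r → ℤ} {x : S}

/-- Multiplication by a homogeneous element. -/
def mulHom (M : GrMod 𝒜) (hx : x ∈ 𝒜 m) : Hom M (M.shift m) :=
  ⟨LinearMap.lsmul S M.carrier x, fun n y hy => M.smul_mem m n x y hx hy⟩

theorem isHomogeneous_smul_top (hx : x ∈ 𝒜 m) :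
    M.IsHomogeneous (x • (⊤ : Submodule S M.carrier)) := by
  intro n y hy
  obtain ⟨z, -, rfl⟩ := (Submodule.mem_smul_pointwise_iff_exists _ _ _).1 hy
  refine (Submodule.mem_smul_pointwise_iff_exists _ _ _).2 ⟨M.proj (-m + n) z, trivial, ?_⟩
  rw [← M.proj_smul hx, add_neg_cancel_left]

theorem isShortExact_mul (hx : x ∈ 𝒜 m) (hinj : ∀ y : M.carrier, x • y = 0 → y = 0) :
    IsShortExact (mulHom M hx)
      ((quotProj _ (isHomogeneous_smul_top (M := M) hx)).shift m) where
  injective := (injective_iff_map_eq_zero _).2 hinj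
  surjective := quotProj_surjective _ (isHomogeneous_smul_top (M := M) hx)
  exact y := by
    refine (quotProj_eq_zero_iff _ (isHomogeneous_smul_top (M := M) hx) y).trans ?_
    refine (Submodule.mem_smul_pointwise_iff_exists _ _ _).trans ?_
    exact ⟨fun ⟨z, _, hz⟩ => ⟨z, hz⟩, fun ⟨z, hz⟩ => ⟨z, trivial, hz⟩⟩

/-- Multiplication by a homogeneous element on an injective resolution. -/
def mulResMap (R : InjRes M) (hx : x ∈ 𝒜 m) : ResMap R (shiftRes R m) (mulHom M hx) where
  φ p := mulHom (R.I p) hx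
  ε_comm y := (map_smul R.ε x y).symm
  δ_comm p y := (map_smul (R.δ p) x y).symm

theorem smul_mem_cocycles (R : InjRes M) (hx : x ∈ 𝒜 m) {i : ℕ} {n : Fin r → ℤ}
    {z : (R.I i).carrier} (hz : z ∈ R.cocycles i n) : x • z ∈ R.cocycles i (m + n) :=
  (mulResMap R hx).map_cocycles i n z hz

theorem mem_maxIdeal (hx : x ∈ 𝒜 m) (hm : m ≠ 0) : x ∈ maxIdeal 𝒜 :=
  Ideal.subset_span ⟨m, hm, hx⟩

variable (ρ : ∀ N : GrMod 𝒜, InjRes N) {i : ℕ} {n : Fin r → ℤ}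

theorem mem_coboundaries_of_smul_mem (hx : x ∈ 𝒜 m) (hinj : ∀ y : M.carrier, x • y = 0 → y = 0)
    (hQ : ∀ i', i = i' + 1 → Subsingleton
      (H ρ (quot _ (isHomogeneous_smul_top (M := M) hx)) i' (m + n)))
    {z : ((ρ M).I i).carrier} (hz : z ∈ (ρ M).cocycles i n)
    (hxz : x • z ∈ (ρ M).coboundaries i (m + n)) : z ∈ (ρ M).coboundaries i n := by
  have hmul := isShortExact_mul hx hinj
  have mul_injective : Function.Injective ((mulResMap (ρ M) hx).cohomologyMap i n) := by
    have Hmap_injective : Function.Injective (Hmap ρ (mulHom M hx) i n) := by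
      cases i with
      | zero => exact hmul.Hmap_zero_injective ρ n
      | succ i => exact hmul.injective_Hmap_succ ((subsingleton_H_shift_iff ρ _ m i n).2 (hQ i rfl))
    rw [← cohomologyEquiv_comp_cohomologyMap ρ (mulResMap (ρ M) hx) i n] at Hmap_injective
    exact Function.Injective.of_comp
      (f := (shiftRes (ρ M) m).cohomologyEquiv (ρ (M.shift m)) i n) Hmap_injective
  rw [← classOf_eq_zero_iff _ hz]
  refine mul_injective (Eq.trans ?_ (map_zero _).symm)
  exact ((shiftRes (ρ M) m).classOf_eq_zero_iff (smul_mem_cocycles (ρ M) hx hz)).2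
    ((mem_coboundaries_shiftRes (ρ M) m).2 hxz)

theorem mem_coboundaries_of_pow_smul_eq_zero (hx : x ∈ 𝒜 m)
    (hinj : ∀ y : M.carrier, x • y = 0 → y = 0)
    (hQ : ∀ i', i = i' + 1 → ∀ t : ℕ, Subsingleton
      (H ρ (quot _ (isHomogeneous_smul_top (M := M) hx)) i' (m + (t • m + n))))
    (t s : ℕ) {z : ((ρ M).I i).carrier} (hz : z ∈ (ρ M).cocycles i (s • m + n))
    (htz : x ^ t • z = 0) : z ∈ (ρ M).coboundaries i (s • m + n) := by
  induction t generalizing s z with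
  | zero =>
    rw [pow_zero, one_smul] at htz
    rw [htz]
    exact zero_mem _
  | succ t ih =>
    refine mem_coboundaries_of_smul_mem ρ hx hinj (fun i' hi' => hQ i' hi' s) hz ?_
    have hxz := smul_mem_cocycles _ hx hz
    rw [← add_assoc, ← succ_nsmul'] at hxz ⊢
    exact ih (s + 1) hxz (by rw [smul_smul, ← pow_succ, htz])

theorem subsingleton_H_of_mul (hx : x ∈ 𝒜 m) (hm : m ≠ 0)
    (hinj : ∀ y : M.carrier, x • y = 0 → y = 0)
    (hQ : ∀ i', i = i' + 1 → ∀ t : ℕ, Subsingleton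
      (H ρ (quot _ (isHomogeneous_smul_top (M := M) hx)) i' (m + (t • m + n)))) :
    Subsingleton (H ρ M i n) := by
  rw [← not_nontrivial_iff_subsingleton, nontrivial_iff_exists]
  rintro ⟨z, hz, hz'⟩
  obtain ⟨t, ht⟩ := hz.1.2
  have hmem := mem_coboundaries_of_pow_smul_eq_zero ρ hx hinj hQ t 0
    (by rwa [zero_smul, zero_add]) (ht _ (Ideal.pow_mem_pow (mem_maxIdeal hx hm) t))
  rw [zero_smul, zero_add] at hmem
  exact hz' hmem

end Mul

section Torsion

theorem maxIdeal_pow_le_torsionOf (hN : IsNatGraded 𝒜) {M : GrMod 𝒜} {b : ℤ}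
    (hM : M.WeightLE b) {t : ℕ} {n : Fin r → ℤ} {y : M.carrier} (hy : y ∈ M.gr n)
    (hb : b < t + weight n) : maxIdeal 𝒜 ^ t ≤ Ideal.torsionOf S M.carrier y := by
  induction t generalizing n y with
  | zero =>
    have hy0 : y = 0 := by
      by_contra hy0
      have := hM n y hy hy0
      push_cast at hb
      omega
    rw [hy0, Ideal.torsionOf_zero]
    exact le_top
  | succ t ih =>
    rw [pow_succ, Ideal.mul_le]
    intro c hc d hd
    have hle : maxIdeal 𝒜 ≤ Ideal.torsionOf S M.carrier (c • y) := by
      refine Ideal.span_le.2 ?_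
      rintro d ⟨m, hm, hd⟩
      change d • c • y = 0
      by_cases hm0 : 0 ≤ m
      · rw [smul_comm]
        refine ih (M.smul_mem m n d y hd hy) ?_ hc
        have := weight_pos hm0 hm
        rw [weight_add]
        push_cast at hb
        omega
      · rw [hN m hm0, AddSubgroup.mem_bot] at hd
        rw [hd, zero_smul]
    rw [Ideal.mem_torsionOf_iff, mul_comm, mul_smul]
    exact hle hd

theorem mem_gammaTorsion_of_weightLE (hN : IsNatGraded 𝒜) {M : GrMod 𝒜}
    {b : ℤ} (hM : M.WeightLE b) (y : M.carrier) : y ∈ gammaTorsion (maxIdeal 𝒜) M.carrier := by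
  induction y using M.homogeneous_induction with
  | zero => exact zero_mem _
  | homogeneous n y hy =>
    have hb := Int.self_le_toNat (b - weight n + 1)
    exact ⟨(b - weight n + 1).toNat,
      fun a ha => maxIdeal_pow_le_torsionOf hN hM hy (by omega) ha⟩
  | add x y hx hy => exact add_mem hx hy

theorem subsingleton_H_succ_of_weightLE [GradedRing 𝒜] {k : Type v} [Field k] [Algebra k S]
    (hN : IsNatGraded 𝒜) (hk : ∀ c : k, algebraMap k S c ∈ 𝒜 0)
    (ρ : ∀ N : GrMod 𝒜, InjRes N) {M : GrMod 𝒜} {b : ℤ} (hM : M.WeightLE b) (i : ℕ)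
    (n : Fin r → ℤ) : Subsingleton (H ρ M (i + 1) n) := by
  obtain ⟨R, hR⟩ := exists_injRes (k := k) hN hk M
  rw [← not_nontrivial_iff_subsingleton,
    ((ρ M).cohomologyEquiv R (i + 1) n).toEquiv.nontrivial_congr, nontrivial_iff_exists]
  rintro ⟨x, hx, hx'⟩
  obtain ⟨y, rfl⟩ := (R.exact_succ i x).1 hx.2
  refine hx' ⟨(R.I i).proj n y, ⟨(R.I i).proj_mem n y,
    mem_gammaTorsion_of_weightLE hN (hR b hM i) _⟩, ?_⟩
  exact ((R.differential i).map_proj n y).trans ((R.I (i + 1)).proj_of_mem hx.1.1)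

end Torsion

section Free

variable {b : ℕ} (a : Fin b → Fin r → ℤ)

theorem single_mem_freeGr (q : Fin b) {n : Fin r → ℤ} {x : S} (hx : x ∈ 𝒜 (a q + n)) :
    (Pi.single q x : Fin b → S) ∈ freeGr 𝒜 a n := by
  intro q'
  by_cases h : q' = q
  · subst h
    rwa [Pi.single_eq_same]
  · rw [Pi.single_eq_of_ne h]
    exact zero_mem _

theorem Hom.sum_apply {M N : GrMod 𝒜} {ι : Type*} (s : Finset ι) (f : ι → Hom M N)
    (x : M.carrier) : (∑ j ∈ s, f j).1 x = ∑ j ∈ s, (f j).1 x := by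
  rw [show (∑ j ∈ s, f j).1 = ∑ j ∈ s, (f j).1 from map_sum (homs M N).subtype f s,
    LinearMap.sum_apply]

variable [GradedRing 𝒜]

/-- The projection of a graded free module to a summand. -/
def freeProj (q : Fin b) : Hom (free 𝒜 a) ((self 𝒜).shift (a q)) :=
  ⟨LinearMap.proj q, fun _ _ hx => hx q⟩

/-- The inclusion of a summand in a graded free module. -/
def freeIncl (q : Fin b) : Hom ((self 𝒜).shift (a q)) (free 𝒜 a) :=
  ⟨LinearMap.single S (fun _ => S) q, fun _ _ hx => single_mem_freeGr a q hx⟩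

theorem freeProj_comp_freeIncl (q : Fin b) :
    (freeProj (𝒜 := 𝒜) a q).comp (freeIncl a q) = Hom.id _ :=
  Hom.ext fun x => Pi.single_eq_same (M := fun _ => S) q x

theorem sum_freeIncl_freeProj (x : (free 𝒜 a).carrier) :
    ∑ q, (freeIncl a q).1 ((freeProj a q).1 x) = x :=
  Finset.univ_sum_single (M := fun _ => S) x

theorem subsingleton_H_free_iff (ρ : ∀ N : GrMod 𝒜, InjRes N) (i : ℕ) (n : Fin r → ℤ) :
    Subsingleton (H ρ (free 𝒜 a) i n) ↔ ∀ q, Subsingleton (H ρ (self 𝒜) i (a q + n)) := by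
  simp_rw [← subsingleton_H_shift_iff]
  refine ⟨fun h q => subsingleton_H_of_retract _ _ (freeProj_comp_freeIncl a q) h,
    fun h => subsingleton_H_of_Hmap_id_eq_zero ?_⟩
  have id_eq_sum : Hom.id (free 𝒜 a) = ∑ q, (freeIncl a q).comp (freeProj a q) :=
    Hom.ext fun x => ((Hom.sum_apply _ _ x).trans (sum_freeIncl_freeProj a x)).symm
  rw [id_eq_sum, Hmap_sum]
  exact Finset.sum_eq_zero fun q _ => Hmap_comp_eq_zero _ _ (h q)

variable {b' : ℕ} (a' : Fin b' → Fin r → ℤ) (f : Hom (free 𝒜 a) (free 𝒜 a'))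

/-- The entry of a morphism of graded free modules from one summand to another. -/
def freeEntry (q : Fin b) (q' : Fin b') :
    Hom ((self 𝒜).shift (a q)) ((self 𝒜).shift (a' q')) :=
  (freeProj a' q').comp (f.comp (freeIncl a q))

theorem eq_sum_freeEntry : f = ∑ q, ∑ q',
    (freeIncl a' q').comp ((freeEntry a a' f q q').comp (freeProj a q)) := by
  refine Hom.ext fun x => ?_
  simp_rw [Hom.sum_apply]
  refine Eq.trans ?_ (Finset.sum_congr rfl fun q _ =>
    (sum_freeIncl_freeProj a' (f.1 ((freeIncl a q).1 ((freeProj a q).1 x)))).symm)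
  rw [← map_sum, sum_freeIncl_freeProj]

theorem Hmap_free_eq_zero (ρ : ∀ N : GrMod 𝒜, InjRes N) (i : ℕ) (n : Fin r → ℤ)
    (h : ∀ q q', Subsingleton (H ρ (self 𝒜) i (a q + n)) ∨
      Subsingleton (H ρ (self 𝒜) i (a' q' + n)) ∨ freeEntry a a' f q q' = 0) :
    Hmap ρ f i n = 0 := by
  rw [eq_sum_freeEntry a a' f]
  simp_rw [Hmap_sum]
  refine Finset.sum_eq_zero fun q _ => Finset.sum_eq_zero fun q' _ => ?_
  obtain hq | hq' | hentry := h q q'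
  · rw [Hmap_comp, Hmap_comp_eq_zero _ _ ((subsingleton_H_shift_iff ρ _ _ _ _).2 hq)]
    exact AddMonoidHom.comp_zero _
  · exact Hmap_comp_eq_zero _ _ ((subsingleton_H_shift_iff ρ _ _ _ _).2 hq')
  · rw [Hmap_comp, Hmap_comp, hentry, Hmap_zero]
    exact AddMonoidHom.comp_zero _

end Free

/-! ### Grothendieck vanishing and boundedness -/

open Pointwise in
theorem supportDim_quot_smul_top_add_one_le {X : Type*} [AddCommGroup X] [Module S X]
    [Module.Finite S X] {x : S} (h : ∀ y : X, x • y = 0 → y = 0) :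
    Module.supportDim S (X ⧸ x • (⊤ : Submodule S X)) + 1 ≤ Module.supportDim S X := by
  have hreg : IsSMulRegular X x := (injective_iff_map_eq_zero (LinearMap.lsmul S X x)).2 h
  exact Module.supportDim_quotSMulTop_succ_le_of_notMem_minimalPrimes
    fun _ => hreg.notMem_of_mem_minimalPrimes

open Pointwise in
theorem supportDim_quot_ker_sup_smul_top_add_one_le {X : Type*} [AddCommGroup X] [Module S X]
    [Module.Finite S X] {x : S}
    (h : Disjoint (LinearMap.ker (LinearMap.lsmul S X x)) (x • (⊤ : Submodule S X))) :
    Module.supportDim S (X ⧸ (LinearMap.ker (LinearMap.lsmul S X x) ⊔ x • (⊤ : Submodule S X))) + 1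
      ≤ Module.supportDim S X := by
  set K := LinearMap.ker (LinearMap.lsmul S X x)
  have smul_injective : ∀ y : X ⧸ K, x • y = 0 → y = 0 := fun y hy => by
    obtain ⟨y, rfl⟩ := K.mkQ_surjective y
    rw [← map_smul, Submodule.mkQ_apply, Submodule.Quotient.mk_eq_zero] at hy
    exact (Submodule.Quotient.mk_eq_zero K).2
      (Submodule.disjoint_def.1 h _ hy (Submodule.smul_mem_pointwise_smul y x ⊤ trivial))
  have smul_top_le_ker : x • (⊤ : Submodule S (X ⧸ K)) ≤
      LinearMap.ker (Submodule.factor (le_sup_left : K ≤ K ⊔ x • (⊤ : Submodule S X))) := by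
    intro y hy
    obtain ⟨z, -, rfl⟩ := (Submodule.mem_smul_pointwise_iff_exists _ _ _).1 hy
    obtain ⟨z, rfl⟩ := K.mkQ_surjective z
    rw [LinearMap.mem_ker, ← map_smul]
    exact (Submodule.Quotient.mk_eq_zero _).2 (Submodule.mem_sup_right
      (Submodule.smul_mem_pointwise_smul z x ⊤ trivial))
  have lift_surjective : Function.Surjective (Submodule.liftQ _ _ smul_top_le_ker) := fun y => by
    obtain ⟨y, rfl⟩ := Submodule.factor_surjective le_sup_left y
    exact ⟨Submodule.mkQ _ y, rfl⟩
  calc _ ≤ Module.supportDim S ((X ⧸ K) ⧸ x • (⊤ : Submodule S (X ⧸ K))) + 1 := by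
        gcongr
        exact Module.supportDim_le_of_surjective _ lift_surjective
    _ ≤ Module.supportDim S (X ⧸ K) := supportDim_quot_smul_top_add_one_le smul_injective
    _ ≤ Module.supportDim S X := Module.supportDim_le_of_surjective _ K.mkQ_surjective

open Pointwise in
theorem exists_disjoint_ker_smul_top {X : Type u} [AddCommGroup X] [Module S X] [IsNoetherian S X]
    (x : S) : ∃ c : ℕ, c ≠ 0 ∧
      Disjoint (LinearMap.ker (LinearMap.lsmul S X (x ^ c))) (x ^ c • (⊤ : Submodule S X)) := by
  obtain ⟨c, hdisj, hc⟩ := ((Module.End.eventually_disjoint_ker_pow_range_pow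
    (Algebra.lsmul S S X x)).and (Filter.eventually_ne_atTop 0)).exists
  refine ⟨c, hc, ?_⟩
  rw [← map_pow, LinearMap.range_eq_map] at hdisj
  exact hdisj

theorem exact_mkQ_prod_mkQ {X : Type u} [AddCommGroup X] [Module S X] (K L : Submodule S X) :
    Function.Exact (K.mkQ.prod L.mkQ)
      ((Submodule.factor (le_sup_left : K ≤ K ⊔ L)).comp (LinearMap.fst S (X ⧸ K) (X ⧸ L)) -
        (Submodule.factor (le_sup_right : L ≤ K ⊔ L)).comp (LinearMap.snd S (X ⧸ K) (X ⧸ L))) := by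
  rintro ⟨x, y⟩
  obtain ⟨x, rfl⟩ := K.mkQ_surjective x
  obtain ⟨y, rfl⟩ := L.mkQ_surjective y
  change (K ⊔ L).mkQ x - (K ⊔ L).mkQ y = 0 ↔ _
  rw [← map_sub, Submodule.mkQ_apply, Submodule.Quotient.mk_eq_zero]
  constructor
  · intro hxy
    obtain ⟨u, hu, v, hv, huv⟩ := Submodule.mem_sup.1 hxy
    refine ⟨x - u, Prod.ext ((Submodule.Quotient.eq K).2 ?_) ((Submodule.Quotient.eq L).2 ?_)⟩
    · rwa [sub_sub_cancel_left, neg_mem_iff]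
    · rwa [sub_right_comm, ← huv, add_sub_cancel_left]
  · rintro ⟨z, hz⟩
    obtain ⟨hzx, hzy⟩ := Prod.ext_iff.1 hz
    have hx : z - x ∈ K := (Submodule.Quotient.eq K).1 hzx
    have hy : z - y ∈ L := (Submodule.Quotient.eq L).1 hzy
    rw [← sub_sub_sub_cancel_left y x z]
    exact sub_mem (Submodule.mem_sup_right hy) (Submodule.mem_sup_left hx)

theorem isHomogeneous_sup {M : GrMod 𝒜} {K L : Submodule S M.carrier} (hK : M.IsHomogeneous K)
    (hL : M.IsHomogeneous L) : M.IsHomogeneous (K ⊔ L) := by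
  intro n x hx
  obtain ⟨y, hy, z, hz, rfl⟩ := Submodule.mem_sup.1 hx
  rw [map_add]
  exact Submodule.add_mem_sup (hK n y hy) (hL n z hz)

/-- The canonical morphism from the quotient by a graded submodule to the quotient by a larger
one. -/
noncomputable def quotFactor {M : GrMod 𝒜} {K L : Submodule S M.carrier} (hK : M.IsHomogeneous K)
    (hL : M.IsHomogeneous L) (h : K ≤ L) : Hom (quot K hK) (quot L hL) :=
  ⟨Submodule.factor h, by rintro n _ ⟨x, hx, rfl⟩; exact ⟨x, hx, rfl⟩⟩

theorem exists_isShortExact_of_disjoint {M : GrMod 𝒜} {K L : Submodule S M.carrier}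
    (hK : M.IsHomogeneous K) (hL : M.IsHomogeneous L) (h : Disjoint K L) :
    ∃ (f : Hom M (prod (quot K hK) (quot L hL)))
      (g : Hom (prod (quot K hK) (quot L hL)) (quot (K ⊔ L) (isHomogeneous_sup hK hL))),
      IsShortExact f g := by
  refine ⟨⟨K.mkQ.prod L.mkQ, fun n x hx => ⟨(quotProj K hK).mem hx, (quotProj L hL).mem hx⟩⟩,
    ⟨(Submodule.factor le_sup_left).comp (LinearMap.fst S _ _) -
        (Submodule.factor le_sup_right).comp (LinearMap.snd S _ _), fun n x hx =>
      sub_mem ((quotFactor hK (isHomogeneous_sup hK hL) le_sup_left).mem hx.1)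
        ((quotFactor hL (isHomogeneous_sup hK hL) le_sup_right).mem hx.2)⟩,
    ⟨?_, fun x => ?_, exact_mkQ_prod_mkQ K L⟩⟩
  · refine LinearMap.ker_eq_bot.1 (Eq.trans (LinearMap.ker_prod K.mkQ L.mkQ) ?_)
    rw [Submodule.ker_mkQ, Submodule.ker_mkQ, h.eq_bot]
  · obtain ⟨y, rfl⟩ := Submodule.factor_surjective (le_sup_left : K ≤ K ⊔ L) x
    refine ⟨(y, 0), ?_⟩
    change Submodule.factor (le_sup_left : K ≤ K ⊔ L) y -
      Submodule.factor (le_sup_right : L ≤ K ⊔ L) 0 = _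
    rw [map_zero, sub_zero]

theorem noetherian_quot_induction [IsNoetherianRing S] (P : GrMod 𝒜 → Prop)
    (h : ∀ X : GrMod 𝒜, Module.Finite S X.carrier →
      (∀ (L : Submodule S X.carrier) (hL : X.IsHomogeneous L), L ≠ ⊥ → P (quot L hL)) → P X)
    (N : GrMod 𝒜) [Module.Finite S N.carrier] : P N := by
  suffices of_surjective : ∀ (K : Submodule S N.carrier) (X : GrMod 𝒜) (π : Hom N X),
      Function.Surjective π.1 → LinearMap.ker π.1 = K → P X from
    of_surjective _ N (Hom.id N) Function.surjective_id rfl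
  intro K
  induction K using WellFoundedGT.induction with
  | ind K ih =>
  rintro X π hπ rfl
  refine h X (Module.Finite.of_surjective π.1 hπ) fun L hL hL0 => ?_
  have ker_comp : LinearMap.ker ((quotProj L hL).comp π).1 = L.comap π.1 :=
    (LinearMap.ker_comp _ _).trans (congrArg _ L.ker_mkQ)
  refine ih _ ?_ _ ((quotProj L hL).comp π) ((quotProj_surjective L hL).comp hπ) rfl
  rw [ker_comp, LinearMap.ker]
  exact Submodule.comap_strictMono_of_surjective hπ hL0.bot_lt

theorem exists_mem_gr_ne_zero (X : GrMod 𝒜) [Nontrivial X.carrier] :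
    ∃ n, ∃ z ∈ X.gr n, z ≠ 0 := by
  by_contra! hc
  obtain ⟨w, hw⟩ := exists_ne (0 : X.carrier)
  exact hw (X.ext_proj fun n => by rw [hc n _ (X.proj_mem n w), map_zero])

theorem subsingleton_H_prod {ρ : ∀ N : GrMod 𝒜, InjRes N}
    {A B : GrMod 𝒜} {i : ℕ} {n : Fin r → ℤ}
    (hA : Subsingleton (H ρ A i n)) (hB : Subsingleton (H ρ B i n)) :
    Subsingleton (H ρ (prod A B) i n) :=
  (isShortExact_prod A B).subsingleton_middle hA hB

section IsTame

/-- A graded module whose local cohomology vanishes above its dimension and has degrees with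
`j`-th components bounded above. -/
structure IsTame (ρ : ∀ N : GrMod 𝒜, InjRes N) (j : Fin r) (X : GrMod 𝒜) : Prop where
  subsingleton_of_lt : ∀ (i : ℕ) n, Module.supportDim S X.carrier < i → Subsingleton (H ρ X i n)
  exists_bound : ∃ b : ℤ, ∀ i n, b < n j → Subsingleton (H ρ X i n)

theorem lt_of_add_one_le_of_lt {e e' : WithBot ℕ∞} {i : ℕ} (h : e + 1 ≤ e')
    (h' : e' < (i + 1 : ℕ)) : e < i :=
  lt_of_add_lt_add_right (a := 1) (h.trans_lt (by exact_mod_cast h'))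

theorem subsingleton_of_supportDim_lt_zero {X : Type u} [AddCommGroup X] [Module S X]
    (h : Module.supportDim S X < (0 : ℕ)) : Subsingleton X := by
  rw [← Module.supportDim_eq_bot_iff_subsingleton S]
  by_contra hbot
  obtain ⟨e, he⟩ := WithBot.ne_bot_iff_exists.1 hbot
  rw [← he] at h
  exact not_lt_zero (α := ℕ∞) (WithBot.coe_lt_coe.1 h)

variable {ρ : ∀ N : GrMod 𝒜, InjRes N} {j : Fin r} {X : GrMod 𝒜}

open Pointwise in
theorem isTame_of_smul_regular [Module.Finite S X.carrier]
    {m : Fin r → ℤ} (hm : 0 ≤ m) (hm0 : m ≠ 0) {x : S} (hx : x ∈ 𝒜 m)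
    (hinj : ∀ y : X.carrier, x • y = 0 → y = 0)
    (hquot : IsTame ρ j (quot (x • (⊤ : Submodule S X.carrier)) (isHomogeneous_smul_top hx))) :
    IsTame ρ j X := by
  obtain ⟨hquot_dim, b, hb⟩ := hquot
  refine ⟨fun i n hi => subsingleton_H_of_mul ρ hx hm0 hinj fun i' hi' t => hquot_dim _ _ ?_,
    b, fun i n hn => subsingleton_H_of_mul ρ hx hm0 hinj fun i' _ t => hb _ _ ?_⟩
  · subst hi'
    exact lt_of_add_one_le_of_lt (supportDim_quot_smul_top_add_one_le hinj) hi
  · have hmj : 0 ≤ m j := hm j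
    have htmj : 0 ≤ (t : ℤ) * m j := mul_nonneg (Int.natCast_nonneg t) hmj
    change b < m j + (t • m j + n j)
    rw [nsmul_eq_mul]
    linarith

open Pointwise in
theorem isTame_of_disjoint_ker_smul_top [Module.Finite S X.carrier]
    {m : Fin r → ℤ} {x : S} (hx : x ∈ 𝒜 m)
    (hdisj : Disjoint (LinearMap.ker (mulHom X hx).1) (x • (⊤ : Submodule S X.carrier)))
    (hker : IsTame ρ j (quot _ (isHomogeneous_ker (mulHom X hx))))
    (himage : IsTame ρ j (quot _ (isHomogeneous_smul_top (M := X) hx)))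
    (hsup : IsTame ρ j (quot _ (isHomogeneous_sup (isHomogeneous_ker (mulHom X hx))
      (isHomogeneous_smul_top (M := X) hx)))) : IsTame ρ j X := by
  obtain ⟨f, g, hex⟩ := exists_isShortExact_of_disjoint (isHomogeneous_ker (mulHom X hx))
    (isHomogeneous_smul_top hx) hdisj
  obtain ⟨hker_dim, bK, hbK⟩ := hker
  obtain ⟨himage_dim, bL, hbL⟩ := himage
  obtain ⟨hsup_dim, bS, hbS⟩ := hsup
  refine ⟨fun i n hi => ?_, max bK (max bL bS), fun i n hn => ?_⟩
  · cases i with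
    | zero => exact subsingleton_H_of_subsingleton (subsingleton_of_supportDim_lt_zero hi) 0 n
    | succ i =>
      have supportDim_quot_lt {K : Submodule S X.carrier} (hK : X.IsHomogeneous K) :
          Module.supportDim S (quot K hK).carrier < (i + 1 : ℕ) :=
        (Module.supportDim_le_of_surjective _ (quotProj_surjective K hK)).trans_lt hi
      refine hex.subsingleton_left (hsup_dim _ _ (lt_of_add_one_le_of_lt ?_ hi))
        (subsingleton_H_prod (hker_dim _ _ (supportDim_quot_lt _))
          (himage_dim _ _ (supportDim_quot_lt _)))
      exact supportDim_quot_ker_sup_smul_top_add_one_le hdisj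
  · obtain ⟨hK, hLS⟩ := max_lt_iff.1 hn
    obtain ⟨hL, hS⟩ := max_lt_iff.1 hLS
    have hprod := fun i => subsingleton_H_prod (hbK i n hK) (hbL i n hL)
    cases i with
    | zero => exact hex.subsingleton_left_zero (hprod 0)
    | succ i => exact hex.subsingleton_left (hbS _ _ hS) (hprod (i + 1))

variable [GradedRing 𝒜]

/-- A nonzero homogeneous element with maximal annihilator works: if `x ^ (c + 1) • z = 0` and
`x ^ c • z ≠ 0`, then `x` kills `x ^ c • z`, hence also `z`. -/
theorem exists_socle [IsNoetherianRing S] {X : GrMod 𝒜} [Nontrivial X.carrier]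
    (h : ∀ m, m ≠ 0 → ∀ x ∈ 𝒜 m, ∃ c : ℕ, ∀ y : X.carrier, x ^ c • y = 0) :
    ∃ n, ∃ z ∈ X.gr n, z ≠ 0 ∧ ∀ m, m ≠ 0 → ∀ x ∈ 𝒜 m, x • z = 0 := by
  let annihilators : Set (Ideal S) :=
    {I | ∃ n, ∃ z ∈ X.gr n, z ≠ 0 ∧ Ideal.torsionOf S X.carrier z = I}
  obtain ⟨n₀, z₀, hz₀⟩ := exists_mem_gr_ne_zero X
  obtain ⟨_, ⟨n, z, hz, hz0, rfl⟩, hmax⟩ := WellFounded.has_min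
    (wellFounded_gt (α := Ideal S)) annihilators ⟨_, n₀, z₀, hz₀.1, hz₀.2, rfl⟩
  refine ⟨n, z, hz, hz0, fun m hm x hx => ?_⟩
  obtain ⟨b, hb⟩ := h m hm x hx
  obtain ⟨c, hc, hc'⟩ := Nat.exists_not_and_succ_of_not_zero_of_exists
    (p := fun c => x ^ c • z = 0) (by rwa [pow_zero, one_smul]) ⟨b, hb z⟩
  by_contra hxz
  refine hmax _ ⟨_, x ^ c • z, X.smul_mem _ n _ z (SetLike.pow_mem_graded c hx) hz, hc, rfl⟩
    (SetLike.lt_iff_le_and_exists.2 ⟨fun a ha => ?_, x, ?_, hxz⟩)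
  · rw [Ideal.mem_torsionOf_iff] at ha ⊢
    rw [smul_comm, ha, smul_zero]
  · rwa [Ideal.mem_torsionOf_iff, smul_smul, ← pow_succ']

theorem isHomogeneous_span {X : GrMod 𝒜} {n : Fin r → ℤ} {z : X.carrier} (hz : z ∈ X.gr n) :
    X.IsHomogeneous (Submodule.span S {z}) := by
  intro l y hy
  obtain ⟨a, rfl⟩ := Submodule.mem_span_singleton.1 hy
  clear hy
  induction a using DirectSum.Decomposition.inductionOn 𝒜 with
  | zero => rw [zero_smul, map_zero]; exact zero_mem _
  | @homogeneous m a =>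
    have haz := X.smul_mem m n _ z a.2 hz
    by_cases hl : m + n = l
    · subst hl
      rw [X.proj_of_mem haz]
      exact Submodule.smul_mem _ _ (Submodule.mem_span_singleton_self z)
    · rw [X.proj_of_mem_ne haz hl]; exact zero_mem _
  | add a b ha hb => rw [add_smul, map_add]; exact add_mem ha hb

theorem mem_gr_of_mem_span_socle {X : GrMod 𝒜} {n : Fin r → ℤ} {z : X.carrier} (hz : z ∈ X.gr n)
    (h : ∀ m, m ≠ 0 → ∀ x ∈ 𝒜 m, x • z = 0) {y : X.carrier} (hy : y ∈ Submodule.span S {z}) :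
    y ∈ X.gr n := by
  obtain ⟨a, rfl⟩ := Submodule.mem_span_singleton.1 hy
  clear hy
  induction a using DirectSum.Decomposition.inductionOn 𝒜 with
  | zero => rw [zero_smul]; exact zero_mem _
  | @homogeneous m a =>
    by_cases hm : m = 0
    · subst hm
      simpa only [zero_add] using X.smul_mem 0 n _ z a.2 hz
    · rw [h m hm a a.2]; exact zero_mem _
  | add a b ha hb => rw [add_smul]; exact add_mem ha hb

theorem isTame_of_quot_concentrated {k : Type v} [Field k] [Algebra k S] (hN : IsNatGraded 𝒜)
    (hk : ∀ c : k, algebraMap k S c ∈ 𝒜 0) {K : Submodule S X.carrier} (hK : X.IsHomogeneous K)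
    {n₀ : Fin r → ℤ} (hKn₀ : ∀ y ∈ K, y ∈ X.gr n₀) (hquot : IsTame ρ j (quot K hK)) :
    IsTame ρ j X := by
  have hex := isShortExact_quot K hK
  have degree_eq : ∀ n, ∀ y ∈ (sub K hK).gr n, y ≠ 0 → n = n₀ := fun n y hy hy0 => by
    by_contra hn
    exact hy0 (Subtype.ext (X.eq_zero_of_mem_gr_of_ne hn hy (hKn₀ y.1 y.2)))
  have hweight : (sub K hK).WeightLE (weight n₀) := fun n y hy hy0 =>
    (degree_eq n y hy hy0 ▸ le_rfl)
  have H_succ_sub (i : ℕ) (n) : Subsingleton (H ρ (sub K hK) (i + 1) n) :=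
    subsingleton_H_succ_of_weightLE hN hk ρ hweight i n
  obtain ⟨hquot_dim, b, hb⟩ := hquot
  refine ⟨fun i n hi => ?_, max b (n₀ j), fun i n hn => hex.subsingleton_middle ?_
    (hb i n ((le_max_left _ _).trans_lt hn))⟩
  · cases i with
    | zero => exact subsingleton_H_of_subsingleton (subsingleton_of_supportDim_lt_zero hi) 0 n
    | succ i =>
      exact hex.subsingleton_middle (H_succ_sub i n) (hquot_dim _ n
        ((Module.supportDim_le_of_surjective _ (quotProj_surjective K hK)).trans_lt hi))
  · cases i with
    | zero =>
      rw [← not_nontrivial_iff_subsingleton, nontrivial_cohomology_zero_iff]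
      rintro ⟨y, hy, hy0, -⟩
      rw [degree_eq n y hy hy0] at hn
      exact absurd hn (le_max_right _ _).not_gt
    | succ i => exact H_succ_sub i n

open Pointwise in
/-- By noetherian induction, `X` is reduced to proper graded quotients: if no homogeneous element
of nonzero degree is regular on `X` and not all of them act nilpotently, some power `x` of one of
them satisfies `ker x ∩ x X = 0` with both submodules nonzero. -/
theorem isTame_of_finite [IsNoetherianRing S] {k : Type v} [Field k] [Algebra k S]
    (hN : IsNatGraded 𝒜) (hk : ∀ c : k, algebraMap k S c ∈ 𝒜 0) (ρ : ∀ N : GrMod 𝒜, InjRes N)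
    (j : Fin r) (X : GrMod 𝒜) [Module.Finite S X.carrier] : IsTame ρ j X := by
  refine noetherian_quot_induction (IsTame ρ j) (fun X _ ih => ?_) X
  obtain hX | hX := subsingleton_or_nontrivial X.carrier
  · exact ⟨fun i n _ => subsingleton_H_of_subsingleton hX i n,
      0, fun i n _ => subsingleton_H_of_subsingleton hX i n⟩
  by_cases hnil : ∀ m, m ≠ 0 → ∀ x ∈ 𝒜 m, ∃ c : ℕ, ∀ y : X.carrier, x ^ c • y = 0
  · obtain ⟨n₀, z, hz, hz0, hsocle⟩ := exists_socle hnil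
    exact isTame_of_quot_concentrated hN hk (isHomogeneous_span hz)
      (fun _ => mem_gr_of_mem_span_socle hz hsocle)
      (ih _ _ (mt Submodule.span_singleton_eq_bot.1 hz0))
  push Not at hnil
  obtain ⟨m, hm0, x, hx, hxpow⟩ := hnil
  have smul_top_ne_bot (c : ℕ) : x ^ c • (⊤ : Submodule S X.carrier) ≠ ⊥ := fun hbot => by
    obtain ⟨y, hy⟩ := hxpow c
    have hmem := Submodule.smul_mem_pointwise_smul y (x ^ c) (⊤ : Submodule S X.carrier) trivial
    rw [hbot] at hmem
    exact hy hmem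
  by_cases hinj : ∀ y : X.carrier, x • y = 0 → y = 0
  · have hm : 0 ≤ m := by
      by_contra hm
      obtain ⟨y, hy⟩ := hxpow 1
      rw [hN m hm, AddSubgroup.mem_bot] at hx
      exact hy (by rw [hx, pow_one, zero_smul])
    refine isTame_of_smul_regular hm hm0 hx hinj (ih _ _ ?_)
    simpa only [pow_one] using smul_top_ne_bot 1
  push Not at hinj
  obtain ⟨y, hxy, hy⟩ := hinj
  obtain ⟨c, hc, hdisj⟩ := exists_disjoint_ker_smul_top (X := X.carrier) x
  have hxc : x ^ c ∈ 𝒜 (c • m) := SetLike.pow_mem_graded c hx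
  refine isTame_of_disjoint_ker_smul_top hxc hdisj (ih _ _ fun hbot => hy ?_)
    (ih _ _ (smul_top_ne_bot c)) (ih _ _ fun hbot => smul_top_ne_bot c ?_)
  · have hmem : y ∈ LinearMap.ker (mulHom X hxc).1 := by
      obtain ⟨c, rfl⟩ := Nat.exists_eq_succ_of_ne_zero hc
      change x ^ (c + 1) • y = 0
      rw [pow_succ, mul_smul, hxy, smul_zero]
    rwa [hbot] at hmem
  · exact eq_bot_iff.2 (le_sup_right.trans hbot.le)

end IsTame

/-! ### Free resolutions -/

section Homogenize

variable {M N P : GrMod 𝒜}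

/-- The degree preserving part of an additive map between graded modules. -/
noncomputable def homogenizeAdd (f : M.carrier →+ N.carrier) : M.carrier →+ N.carrier :=
  (DirectSum.toAddMonoid fun n => (N.proj n).comp (f.comp (M.gr n).subtype)).comp
    (DirectSum.decomposeAddEquiv M.gr).toAddMonoidHom

theorem homogenizeAdd_of_mem (f : M.carrier →+ N.carrier) {n : Fin r → ℤ} {x : M.carrier}
    (hx : x ∈ M.gr n) : homogenizeAdd f x = N.proj n (f x) := by
  change DirectSum.toAddMonoid _ (DirectSum.decompose M.gr x) = _
  rw [DirectSum.decompose_of_mem M.gr hx, DirectSum.toAddMonoid_of]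
  rfl

theorem Hom.ext_homogeneous {f g : Hom M N} (h : ∀ n, ∀ x ∈ M.gr n, f.1 x = g.1 x) : f = g :=
  Hom.ext fun x => by
    induction x using M.homogeneous_induction with
    | zero => rw [map_zero, map_zero]
    | homogeneous n x hx => exact h n x hx
    | add x y hx hy => rw [map_add, map_add, hx, hy]

variable [GradedRing 𝒜]

theorem homogenizeAdd_smul (f : M.carrier →ₗ[S] N.carrier) (a : S) (x : M.carrier) :
    homogenizeAdd f.toAddMonoidHom (a • x) = a • homogenizeAdd f.toAddMonoidHom x := by
  induction x using M.homogeneous_induction with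
  | zero => rw [smul_zero, map_zero, smul_zero]
  | homogeneous n x hx =>
    induction a using DirectSum.Decomposition.inductionOn 𝒜 with
    | zero => rw [zero_smul, map_zero, zero_smul]
    | @homogeneous m a =>
      rw [homogenizeAdd_of_mem _ (M.smul_mem m n _ x a.2 hx), homogenizeAdd_of_mem _ hx,
        ← N.proj_smul a.2]
      exact congrArg _ (map_smul f _ x)
    | add a b ha hb => rw [add_smul, map_add, ha, hb, add_smul]
  | add x y hx hy => rw [smul_add, map_add, map_add, hx, hy, smul_add]

/-- The degree preserving part of a linear map between graded modules. -/
noncomputable def homogenize (f : M.carrier →ₗ[S] N.carrier) : Hom M N :=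
  ⟨{ homogenizeAdd f.toAddMonoidHom with map_smul' := homogenizeAdd_smul f },
    fun n _ hx => (homogenizeAdd_of_mem f.toAddMonoidHom hx).symm ▸ N.proj_mem n _⟩

theorem homogenize_of_mem (f : M.carrier →ₗ[S] N.carrier) {n : Fin r → ℤ} {x : M.carrier}
    (hx : x ∈ M.gr n) : (homogenize f).1 x = N.proj n (f x) :=
  homogenizeAdd_of_mem f.toAddMonoidHom hx

theorem homogenize_comp_eq {f : N.carrier →ₗ[S] P.carrier} {g : Hom M N} {u : Hom M P}
    (h : ∀ x, f (g.1 x) = u.1 x) : (homogenize f).comp g = u :=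
  Hom.ext_homogeneous fun n x hx => by
    rw [Hom.comp_apply, homogenize_of_mem f (g.mem hx), h, P.proj_of_mem (u.mem hx)]

theorem comp_homogenize_eq {f : M.carrier →ₗ[S] N.carrier} {g : Hom N P} {u : Hom M P}
    (h : ∀ x, g.1 (f x) = u.1 x) : g.comp (homogenize f) = u :=
  Hom.ext_homogeneous fun n x hx => by
    rw [Hom.comp_apply, homogenize_of_mem f hx, g.map_proj, h, P.proj_of_mem (u.mem hx)]

end Homogenize

theorem exists_linear_lift {F A B : Type*} [AddCommGroup F] [AddCommGroup A] [AddCommGroup B]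
    [Module S F] [Module S A] [Module S B] [Module.Projective S F] (f : A →ₗ[S] B)
    (g : F →ₗ[S] B) (h : ∀ x, ∃ y, f y = g x) : ∃ g' : F →ₗ[S] A, ∀ x, f (g' x) = g x := by
  obtain ⟨g', hg'⟩ := Module.projective_lifting_property f.rangeRestrict
    (g.codRestrict (LinearMap.range f) h) f.surjective_rangeRestrict
  exact ⟨g', fun x => congrArg Subtype.val (LinearMap.congr_fun hg' x)⟩

theorem exists_homogeneous_generators (N : GrMod 𝒜) [Module.Finite S N.carrier] :
    ∃ (b : ℕ) (e : Fin b → Fin r → ℤ) (g : Fin b → N.carrier),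
      (∀ q, g q ∈ N.gr (e q)) ∧ Submodule.span S (Set.range g) = ⊤ := by
  classical
  obtain ⟨T, hT⟩ := (Module.Finite.fg_top : (⊤ : Submodule S N.carrier).FG)
  choose s hs _ using N.exists_eq_sum_proj
  let U : Finset N.carrier := T.biUnion fun x => (s x).image fun n => N.proj n x
  have exists_degree (u : U) : ∃ n, u.1 ∈ N.gr n := by
    obtain ⟨x, -, hu⟩ := Finset.mem_biUnion.1 u.2
    obtain ⟨n, -, hn⟩ := Finset.mem_image.1 hu
    exact ⟨n, hn ▸ N.proj_mem n x⟩
  choose e he using exists_degree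
  refine ⟨U.card, fun q => e (U.equivFin.symm q), Subtype.val ∘ U.equivFin.symm, fun q => he _, ?_⟩
  rw [U.equivFin.symm.surjective.range_comp, Subtype.range_coe, eq_top_iff, ← hT,
    Submodule.span_le]
  intro x hx
  rw [SetLike.mem_coe, hs x]
  exact sum_mem fun n hn => Submodule.subset_span
    (Finset.mem_biUnion.2 ⟨x, hx, Finset.mem_image_of_mem _ hn⟩)

theorem exact_subIncl_ker {M N : GrMod 𝒜} (f : Hom M N) :
    Function.Exact (subIncl _ (isHomogeneous_ker f)).1 f.1 :=
  LinearMap.exact_subtype_ker_map f.1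

section FreeRes

variable [GradedRing 𝒜]

instance projective_free {b : ℕ} (a : Fin b → Fin r → ℤ) :
    Module.Projective S (free 𝒜 a).carrier :=
  inferInstanceAs (Module.Projective S (Fin b → S))

instance finite_free {b : ℕ} (a : Fin b → Fin r → ℤ) : Module.Finite S (free 𝒜 a).carrier :=
  inferInstanceAs (Module.Finite S (Fin b → S))

theorem exists_hom_lift {b : ℕ} {a : Fin b → Fin r → ℤ} {A B : GrMod 𝒜} (f : Hom A B)
    (g : Hom (free 𝒜 a) B) (h : ∀ x, ∃ y, f.1 y = g.1 x) :
    ∃ g' : Hom (free 𝒜 a) A, ∀ x, f.1 (g'.1 x) = g.1 x := by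
  obtain ⟨g', hg'⟩ := exists_linear_lift f.1 g.1 h
  exact ⟨homogenize g', fun x => congrArg (fun u : Hom (free 𝒜 a) B => u.1 x)
    (comp_homogenize_eq hg')⟩

theorem exists_free_cover (N : GrMod 𝒜) [Module.Finite S N.carrier] :
    ∃ (b : ℕ) (a : Fin b → Fin r → ℤ) (ε : Hom (free 𝒜 a) N), Function.Surjective ε.1 := by
  obtain ⟨b, e, g, hg, hspan⟩ := exists_homogeneous_generators N
  refine ⟨b, -e, ⟨Fintype.linearCombination S g, fun n x hx => ?_⟩, LinearMap.range_eq_top.1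
    ((Fintype.range_linearCombination S g).trans hspan)⟩
  change ∑ q, x q • g q ∈ N.gr n
  refine sum_mem fun q _ => ?_
  have hmem := N.smul_mem _ _ _ _ (hx q) (hg q)
  rwa [Pi.neg_apply, neg_add_cancel_comm] at hmem

/-- Graded free resolutions with finitely generated terms. -/
structure FreeRes (M : GrMod 𝒜) where
  rank : ℕ → ℕ
  shift : ∀ p, Fin (rank p) → Fin r → ℤ
  ε : Hom (free 𝒜 (shift 0)) M
  δ : ∀ p, Hom (free 𝒜 (shift (p + 1))) (free 𝒜 (shift p))
  ε_surjective : Function.Surjective ε.1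
  exact_zero : Function.Exact (δ 0).1 ε.1
  exact_succ : ∀ p, Function.Exact (δ (p + 1)).1 (δ p).1

theorem exists_freeRes [IsNoetherianRing S] (M : GrMod 𝒜) [Module.Finite S M.carrier] :
    Nonempty (FreeRes M) := by
  choose b a ε hε using fun N : {N : GrMod 𝒜 // Module.Finite S N.carrier} =>
    haveI := N.2; exists_free_cover N.1
  let syzygy : ℕ → {N : GrMod 𝒜 // Module.Finite S N.carrier} := fun p =>
    Nat.rec ⟨M, inferInstance⟩ (fun _ N => ⟨sub _ (isHomogeneous_ker (ε N)),
      inferInstanceAs (Module.Finite S (LinearMap.ker (ε N).1))⟩) p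
  let incl (p : ℕ) : Hom (syzygy (p + 1)).1 (free 𝒜 (a (syzygy p))) :=
    subIncl _ (isHomogeneous_ker (ε (syzygy p)))
  have exact_incl_comp (p : ℕ) :
      Function.Exact ((incl p).comp (ε (syzygy (p + 1)))).1 (ε (syzygy p)).1 :=
    (hε (syzygy (p + 1))).comp_exact_iff_exact.2 (exact_subIncl_ker (ε (syzygy p)))
  exact ⟨⟨fun p => b (syzygy p), fun p => a (syzygy p), ε (syzygy 0),
    fun p => (incl p).comp (ε (syzygy (p + 1))), hε (syzygy 0), exact_incl_comp 0, fun p =>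
      (subIncl_injective _ (isHomogeneous_ker (ε (syzygy p)))).comp_exact_iff_exact.2
        (exact_incl_comp (p + 1))⟩⟩

namespace FreeRes

variable {L : GrMod 𝒜} (P : FreeRes L)

/-- The terms of a free resolution. -/
abbrev F (p : ℕ) : GrMod 𝒜 := free 𝒜 (P.shift p)

theorem δ_δ (p : ℕ) (x : (P.F (p + 2)).carrier) : (P.δ p).1 ((P.δ (p + 1)).1 x) = 0 :=
  (P.exact_succ p).apply_apply_eq_zero x

theorem ε_δ (x : (P.F 1).carrier) : P.ε.1 ((P.δ 0).1 x) = 0 :=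
  P.exact_zero.apply_apply_eq_zero x

theorem exists_nullhomotopy {c : S} (hc : ∀ y : L.carrier, c • y = 0) :
    ∃ h : ∀ p, (P.F p).carrier →ₗ[S] (P.F (p + 1)).carrier,
      (∀ x, (P.δ 0).1 (h 0 x) = c • x) ∧
      ∀ p x, (P.δ (p + 1)).1 (h (p + 1) x) + h p ((P.δ p).1 x) = c • x := by
  obtain ⟨h₀, hh₀⟩ := exists_linear_lift (P.δ 0).1
    (LinearMap.lsmul S (P.F 0).carrier c) fun x => (P.exact_zero _).1 (by
      rw [LinearMap.lsmul_apply, map_smul, hc])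
  have exists_next (p : ℕ) (h : {h : (P.F p).carrier →ₗ[S] (P.F (p + 1)).carrier //
      ∀ x, (P.δ p).1 (h ((P.δ p).1 x)) = c • (P.δ p).1 x}) :
      ∃ h' : {h' : (P.F (p + 1)).carrier →ₗ[S] (P.F (p + 1 + 1)).carrier //
        ∀ x, (P.δ (p + 1)).1 (h' ((P.δ (p + 1)).1 x)) = c • (P.δ (p + 1)).1 x},
      ∀ x, (P.δ (p + 1)).1 (h'.1 x) + h.1 ((P.δ p).1 x) = c • x := by
    obtain ⟨h', hh'⟩ := exists_linear_lift (P.δ (p + 1)).1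
      (LinearMap.lsmul S (P.F (p + 1)).carrier c - h.1 ∘ₗ (P.δ p).1) fun x =>
        (P.exact_succ p _).1 (by
          rw [LinearMap.sub_apply, LinearMap.lsmul_apply, LinearMap.comp_apply, map_sub, h.2,
            map_smul, sub_self])
    refine ⟨⟨h', fun x => ?_⟩, fun x => ?_⟩
    · rw [hh', LinearMap.sub_apply, LinearMap.lsmul_apply, LinearMap.comp_apply, P.δ_δ, map_zero,
        sub_zero]
    · rw [hh', LinearMap.sub_apply, LinearMap.lsmul_apply, LinearMap.comp_apply, sub_add_cancel]
  choose next hnext using exists_next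
  let h : ∀ p, {h : (P.F p).carrier →ₗ[S] (P.F (p + 1)).carrier //
      ∀ x, (P.δ p).1 (h ((P.δ p).1 x)) = c • (P.δ p).1 x} :=
    fun p => Nat.rec ⟨h₀, fun x => hh₀ _⟩ (fun p h => next p h) p
  exact ⟨fun p => (h p).1, hh₀, fun p x => hnext p (h p) x⟩

section Ext

variable {X : Type*} [AddCommGroup X] [Module S X] {i : ℕ}

variable (X) in
/-- The cocycles of the complex of linear maps from a free resolution to a module. -/
def cocycles (i : ℕ) : Submodule S ((P.F i).carrier →ₗ[S] X) :=
  LinearMap.ker (LinearMap.lcomp S X (P.δ i).1)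

variable (X) in
/-- The coboundaries of the complex of linear maps from a free resolution of `L` to a module.
Since the resolution is exact, `cocycles X i ≤ coboundaries X i` means that `Ext^i (L, X)`
vanishes. -/
def coboundaries : (i : ℕ) → Submodule S ((P.F i).carrier →ₗ[S] X)
  | 0 => ⊥
  | i + 1 => LinearMap.range (LinearMap.lcomp S X (P.δ i).1)

variable {P}

theorem mem_cocycles_iff {φ : (P.F i).carrier →ₗ[S] X} :
    φ ∈ P.cocycles X i ↔ ∀ x, φ ((P.δ i).1 x) = 0 :=
  LinearMap.ext_iff

theorem mem_coboundaries_succ_iff {φ : (P.F (i + 1)).carrier →ₗ[S] X} :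
    φ ∈ P.coboundaries X (i + 1) ↔
      ∃ ψ : (P.F i).carrier →ₗ[S] X, ∀ x, ψ ((P.δ i).1 x) = φ x :=
  exists_congr fun _ => LinearMap.ext_iff

theorem smul_mem_coboundaries_of_annihilates {c : S} (hc : ∀ y : L.carrier, c • y = 0)
    {φ : (P.F i).carrier →ₗ[S] X} (hφ : φ ∈ P.cocycles X i) : c • φ ∈ P.coboundaries X i := by
  obtain ⟨h, h_zero, h_succ⟩ := P.exists_nullhomotopy hc
  rw [mem_cocycles_iff] at hφ
  cases i with
  | zero =>
    refine LinearMap.ext fun x => ?_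
    rw [LinearMap.smul_apply, ← map_smul, ← h_zero, hφ, LinearMap.zero_apply]
  | succ i =>
    refine mem_coboundaries_succ_iff.2 ⟨φ ∘ₗ h i, fun x => ?_⟩
    rw [LinearMap.smul_apply, ← map_smul, ← h_succ, map_add, hφ, zero_add, LinearMap.comp_apply]

theorem exists_lift_of_comp_mem_coboundaries {Y : Type*} [AddCommGroup Y] [Module S Y]
    {π : X →ₗ[S] Y} (hπ : Function.Surjective π) {ψ : (P.F i).carrier →ₗ[S] X}
    (h : π ∘ₗ ψ ∈ P.coboundaries Y i) :
    ∃ ψ' : (P.F i).carrier →ₗ[S] X,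
      (∀ x, π (ψ' x) = 0) ∧ ∀ x, ψ' ((P.δ i).1 x) = ψ ((P.δ i).1 x) := by
  cases i with
  | zero => exact ⟨ψ, LinearMap.congr_fun ((Submodule.mem_bot S).1 h), fun _ => rfl⟩
  | succ i =>
    obtain ⟨χ, hχ⟩ := mem_coboundaries_succ_iff.1 h
    obtain ⟨χ', hχ'⟩ := exists_linear_lift π χ fun x => hπ _
    refine ⟨ψ - χ' ∘ₗ (P.δ i).1, fun x => ?_, fun x => ?_⟩
    · rw [LinearMap.sub_apply, LinearMap.comp_apply, map_sub, hχ', hχ, LinearMap.comp_apply,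
        sub_self]
    · rw [LinearMap.sub_apply, LinearMap.comp_apply, P.δ_δ, map_zero, sub_zero]

section Regular

variable {R : Type*} [CommRing R] [Algebra S R] [Module R X] [IsScalarTower S R X] {y : R}
  {φ : (P.F i).carrier →ₗ[S] X}

theorem smul_mem_coboundaries (y : R) (hφ : φ ∈ P.coboundaries X i) :
    y • φ ∈ P.coboundaries X i := by
  cases i with
  | zero => rw [(Submodule.mem_bot S).1 hφ, smul_zero]; exact zero_mem _
  | succ i =>
    obtain ⟨ψ, hψ⟩ := mem_coboundaries_succ_iff.1 hφ
    exact mem_coboundaries_succ_iff.2 ⟨y • ψ, fun x => by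
      rw [LinearMap.smul_apply, hψ, LinearMap.smul_apply]⟩

open scoped Pointwise in
theorem exists_surjective_quotSMulTop (X : Type*) [AddCommGroup X] [Module S X] [Module R X]
    [IsScalarTower S R X] (y : R) :
    ∃ π : X →ₗ[S] QuotSMulTop y X, Function.Surjective π ∧ ∀ x, π x = 0 ↔ ∃ z, y • z = x := by
  let N : Submodule R X := y • (⊤ : Submodule R X)
  refine ⟨N.mkQ.restrictScalars S, N.mkQ_surjective, fun x => ?_⟩
  change N.mkQ x = 0 ↔ _
  rw [Submodule.mkQ_apply, Submodule.Quotient.mk_eq_zero]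
  exact exists_congr fun z => ⟨And.right, And.intro trivial⟩

/-- This is the injectivity of multiplication by `y` on `Ext^i (L, X)`, from the long exact
sequence of `0 → X → X → X/yX → 0`. -/
theorem mem_coboundaries_of_smul_mem (hy : IsSMulRegular X y)
    (hX : ∀ i', i = i' + 1 →
      P.cocycles (QuotSMulTop y X) i' ≤ P.coboundaries (QuotSMulTop y X) i')
    (h : y • φ ∈ P.coboundaries X i) : φ ∈ P.coboundaries X i := by
  cases i with
  | zero =>
    refine LinearMap.ext fun x => hy ?_
    exact (LinearMap.congr_fun ((Submodule.mem_bot S).1 h) x).trans (smul_zero y).symm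
  | succ i =>
    obtain ⟨ψ, hψ⟩ := mem_coboundaries_succ_iff.1 h
    obtain ⟨π, hπ, hπ0⟩ := exists_surjective_quotSMulTop (S := S) X y
    have comp_mem : π ∘ₗ ψ ∈ P.coboundaries _ i := hX i rfl (mem_cocycles_iff.2 fun x => by
      rw [LinearMap.comp_apply, hψ]
      exact (hπ0 _).2 ⟨_, rfl⟩)
    obtain ⟨ψ', hπψ', hψ'⟩ := exists_lift_of_comp_mem_coboundaries hπ comp_mem
    obtain ⟨χ, hχ⟩ := exists_linear_lift ((LinearMap.lsmul R X y).restrictScalars S) ψ'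
      fun x => (hπ0 _).1 (hπψ' x)
    refine mem_coboundaries_succ_iff.2 ⟨χ, fun x => hy ?_⟩
    exact (hχ _).trans ((hψ' x).trans (hψ x))

theorem mem_coboundaries_of_pow_smul_mem (hy : IsSMulRegular X y)
    (hX : ∀ i', i = i' + 1 →
      P.cocycles (QuotSMulTop y X) i' ≤ P.coboundaries (QuotSMulTop y X) i')
    {t : ℕ} (h : y ^ t • φ ∈ P.coboundaries X i) : φ ∈ P.coboundaries X i := by
  induction t with
  | zero => rwa [pow_zero, one_smul] at h
  | succ t ih =>
    rw [pow_succ', mul_smul] at h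
    exact ih (mem_coboundaries_of_smul_mem hy hX h)

theorem cocycles_le_coboundaries_of_isWeaklyRegular {rs : List R}
    (hrs : ∀ y ∈ rs, ∃ (t : ℕ) (c : S) (w : R),
      (∀ z : L.carrier, c • z = 0) ∧ y ^ t = w * algebraMap S R c)
    (hreg : RingTheory.Sequence.IsWeaklyRegular X rs) (hi : i < rs.length) :
    P.cocycles X i ≤ P.coboundaries X i := by
  induction rs generalizing X i with
  | nil => exact absurd hi (Nat.not_lt_zero i)
  | cons y rs ih =>
    intro φ hφ
    rw [RingTheory.Sequence.isWeaklyRegular_cons_iff] at hreg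
    obtain ⟨t, c, w, hc, hyt⟩ := hrs y List.mem_cons_self
    refine mem_coboundaries_of_pow_smul_mem (t := t) hreg.1 (fun i' hi' => ?_) ?_
    · subst hi'
      exact ih (fun z hz => hrs z (List.mem_cons_of_mem _ hz)) hreg.2
        (Nat.succ_lt_succ_iff.1 hi)
    · rw [hyt, mul_smul, algebraMap_smul]
      exact smul_mem_coboundaries w (smul_mem_coboundaries_of_annihilates hc hφ)

end Regular

end Ext

section Localization

theorem exists_eq_mul_algebraMap_of_mem_maximalIdeal {I : Ideal S} [I.IsPrime]
    {y : Localization.AtPrime I} (hy : y ∈ IsLocalRing.maximalIdeal (Localization.AtPrime I)) :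
    ∃ c ∈ I, ∃ w, y = w * algebraMap S (Localization.AtPrime I) c := by
  rw [← Localization.AtPrime.map_eq_maximalIdeal,
    IsLocalization.mem_map_algebraMap_iff I.primeCompl] at hy
  obtain ⟨⟨⟨c, hc⟩, s⟩, hcs⟩ := hy
  obtain ⟨w, hw⟩ := (IsLocalization.map_units (Localization.AtPrime I) s).exists_left_inv
  exact ⟨c, hc, w, by rw [← hcs, mul_left_comm, hw, mul_one]⟩

theorem mem_of_pow_smul_mem_of_smul_mem {X : Type*} [AddCommGroup X] [Module S X]
    {K : Submodule S X} {x : X} {I : Ideal S} [hI : I.IsMaximal] {t : ℕ}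
    (ht : ∀ c ∈ I ^ t, c • x ∈ K) {s : S} (hs : s ∉ I) (hsx : s • x ∈ K) : x ∈ K := by
  let J : Ideal S := K.comap (LinearMap.toSpanSingleton S X x)
  have sup_eq_top : I ⊔ J = ⊤ := hI.1.2 _ (left_lt_sup.2 fun hJ => hs (hJ hsx))
  have hJ : J = ⊤ := by
    rw [← sup_eq_right.2 (show I ^ t ≤ J from ht)]
    exact Ideal.pow_sup_eq_top sup_eq_top
  have one_mem : (1 : S) ∈ J := hJ ▸ trivial
  rwa [Submodule.mem_comap, LinearMap.toSpanSingleton_apply, one_smul] at one_mem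

variable {P} {I : Ideal S} {i : ℕ}

theorem exists_notMem_smul_mem_coboundaries [I.IsPrime]
    (hinj : Function.Injective (algebraMap S (Localization.AtPrime I)))
    {φ : (P.F i).carrier →ₗ[S] S}
    (h : Algebra.linearMap S (Localization.AtPrime I) ∘ₗ φ ∈ P.coboundaries _ i) :
    ∃ s ∉ I, s • φ ∈ P.coboundaries S i := by
  cases i with
  | zero =>
    refine ⟨1, (Ideal.ne_top_iff_one I).1 (Ideal.IsPrime.ne_top'), ?_⟩
    rw [one_smul]
    refine LinearMap.ext fun x => hinj ?_
    exact (LinearMap.congr_fun ((Submodule.mem_bot S).1 h) x).trans (map_zero _).symm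
  | succ i =>
    obtain ⟨ψ, hψ⟩ := mem_coboundaries_succ_iff.1 h
    have := Module.finitePresentation_of_projective S (P.F i).carrier
    obtain ⟨ψ', s, hs⟩ := Module.FinitePresentation.exists_lift_of_isLocalizedModule I.primeCompl
      (Algebra.linearMap S (Localization.AtPrime I)) ψ
    refine ⟨s, s.2, mem_coboundaries_succ_iff.2 ⟨ψ', fun x => hinj ?_⟩⟩
    refine (LinearMap.congr_fun hs _).trans ?_
    rw [LinearMap.smul_apply, hψ, LinearMap.comp_apply, LinearMap.smul_apply, Submonoid.smul_def,
      ← map_smul, Algebra.linearMap_apply]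

theorem cocycles_le_coboundaries_of_localization [I.IsMaximal] {t : ℕ}
    (hI : ∀ c ∈ I ^ t, ∀ z : L.carrier, c • z = 0)
    (hreg : ∀ s, s ∉ I → ∀ x : S, s * x = 0 → x = 0) {rs : List (Localization.AtPrime I)}
    (hrs : ∀ y ∈ rs, y ∈ IsLocalRing.maximalIdeal (Localization.AtPrime I))
    (hrs' : RingTheory.Sequence.IsWeaklyRegular (Localization.AtPrime I) rs)
    (hi : i < rs.length) : P.cocycles S i ≤ P.coboundaries S i := by
  intro φ hφ
  have hinj : Function.Injective (algebraMap S (Localization.AtPrime I)) :=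
    IsLocalization.injective _ (M := I.primeCompl) fun s hs => mem_nonZeroDivisors_iff.2
      ⟨hreg s hs, fun x hx => hreg s hs x (by rwa [mul_comm])⟩
  have localized_mem : Algebra.linearMap S (Localization.AtPrime I) ∘ₗ φ ∈ P.coboundaries _ i := by
    refine cocycles_le_coboundaries_of_isWeaklyRegular (fun y hy => ?_) hrs' hi
      (mem_cocycles_iff.2 fun x => by
        rw [LinearMap.comp_apply, mem_cocycles_iff.1 hφ, map_zero])
    obtain ⟨c, hc, w, rfl⟩ := exists_eq_mul_algebraMap_of_mem_maximalIdeal (hrs y hy)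
    exact ⟨t, c ^ t, w ^ t, hI _ (Ideal.pow_mem_pow hc t), by rw [mul_pow, map_pow]⟩
  obtain ⟨s, hs, hsφ⟩ := exists_notMem_smul_mem_coboundaries hinj localized_mem
  exact mem_of_pow_smul_mem_of_smul_mem
    (fun c hc => smul_mem_coboundaries_of_annihilates (hI c hc) hφ) hs hsφ

end Localization

end FreeRes

end FreeRes

/-! ### The homogeneous maximal ideal -/

/-- The component of degree zero of the graded `k`-algebra is `k`. -/
def IsConnectedOver (k : Type v) [Field k] (𝒜 : (Fin r → ℤ) → AddSubgroup S) [Algebra k S] :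
    Prop :=
  ∀ x : S, x ∈ 𝒜 0 ↔ ∃ c : k, algebraMap k S c = x

section MaxIdeal

variable [GradedRing 𝒜]

/-- The elements of a graded module with no component of weight less than `w`. -/
def weightGE (hN : IsNatGraded 𝒜) (M : GrMod 𝒜) (w : ℤ) : Submodule S M.carrier where
  carrier := {x | ∀ n, weight n < w → M.proj n x = 0}
  zero_mem' _ _ := map_zero _
  add_mem' hx hy n hn := by rw [map_add, hx n hn, hy n hn, add_zero]
  smul_mem' c x hx n hn := by
    induction c using DirectSum.Decomposition.inductionOn 𝒜 with
    | zero => rw [zero_smul, map_zero]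
    | @homogeneous m c =>
      by_cases hm : 0 ≤ m
      · rw [← add_sub_cancel m n, M.proj_smul c.2, hx, smul_zero]
        have weight_eq := weight_add m (n - m)
        have hweight := weight_nonneg hm
        rw [add_sub_cancel] at weight_eq
        omega
      · have hc : (c : S) = 0 := AddSubgroup.mem_bot.1 (hN m hm ▸ c.2)
        rw [hc, zero_smul, map_zero]
    | add a b ha hb => rw [add_smul, map_add, ha, hb, add_zero]

theorem smul_mem_weightGE_add_one (hN : IsNatGraded 𝒜) (M : GrMod 𝒜) {w : ℤ} {a : S}
    (ha : a ∈ maxIdeal 𝒜) {x : M.carrier} (hx : x ∈ weightGE hN M w) :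
    a • x ∈ weightGE hN M (w + 1) := by
  induction ha using Submodule.span_induction with
  | mem a ha =>
    obtain ⟨m, hm0, ha⟩ := ha
    intro n hn
    by_cases hm : 0 ≤ m
    · rw [← add_sub_cancel m n, M.proj_smul ha, hx, smul_zero]
      have weight_eq := weight_add m (n - m)
      have hweight := weight_pos hm hm0
      rw [add_sub_cancel] at weight_eq
      omega
    · have ha0 : a = 0 := AddSubgroup.mem_bot.1 (hN m hm ▸ ha)
      rw [ha0, zero_smul, map_zero]
  | zero => rw [zero_smul]; exact zero_mem _
  | add a b _ _ ha hb => rw [add_smul]; exact add_mem ha hb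
  | smul c a _ ha => rw [smul_eq_mul, mul_smul]; exact Submodule.smul_mem _ _ ha

theorem exists_mem_weightGE (hN : IsNatGraded 𝒜) (M : GrMod 𝒜) (x : M.carrier) :
    ∃ w, x ∈ weightGE hN M w := by
  obtain ⟨s, -, hs⟩ := M.exists_eq_sum_proj x
  obtain ⟨w, hw⟩ := (s.image weight).bddBelow
  refine ⟨w, fun n hn => hs n fun hns => hn.not_ge ?_⟩
  exact hw (Finset.mem_coe.2 (Finset.mem_image_of_mem weight hns))

theorem eq_zero_of_forall_mem_weightGE (hN : IsNatGraded 𝒜) (M : GrMod 𝒜) {x : M.carrier}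
    (h : ∀ w, x ∈ weightGE hN M w) : x = 0 :=
  M.ext_proj fun n => by rw [h (weight n + 1) n (lt_add_one _), map_zero]

theorem eq_zero_of_smul_eq_self (hN : IsNatGraded 𝒜) (M : GrMod 𝒜) {a : S}
    (ha : a ∈ maxIdeal 𝒜) {x : M.carrier} (h : a • x = x) : x = 0 := by
  obtain ⟨w₀, hw₀⟩ := exists_mem_weightGE hN M x
  have mem_weightGE_add (t : ℕ) : x ∈ weightGE hN M (w₀ + t) := by
    induction t with
    | zero => rwa [Nat.cast_zero, add_zero]
    | succ t ih =>
      rw [Nat.cast_succ, ← add_assoc, ← h]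
      exact smul_mem_weightGE_add_one hN M ha ih
  exact eq_zero_of_forall_mem_weightGE hN M fun w n hn =>
    mem_weightGE_add (w - w₀).toNat n (by omega)

variable {k : Type v} [Field k] [Algebra k S]

theorem exists_algebraMap_sub_mem_maxIdeal (h0 : IsConnectedOver k 𝒜) (s : S) :
    ∃ c : k, s - algebraMap k S c ∈ maxIdeal 𝒜 := by
  induction s using DirectSum.Decomposition.inductionOn 𝒜 with
  | zero => exact ⟨0, by rw [map_zero, sub_zero]; exact zero_mem _⟩
  | @homogeneous m a =>
    by_cases hm : m = 0
    · subst hm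
      obtain ⟨c, hc⟩ := (h0 _).1 a.2
      exact ⟨c, by rw [hc, sub_self]; exact zero_mem _⟩
    · exact ⟨0, by rw [map_zero, sub_zero]; exact mem_maxIdeal a.2 hm⟩
  | add a b ha hb =>
    obtain ⟨c, hc⟩ := ha
    obtain ⟨c', hc'⟩ := hb
    exact ⟨c + c', by rw [map_add, add_sub_add_comm]; exact add_mem hc hc'⟩

theorem one_notMem_maxIdeal [Nontrivial S] (hN : IsNatGraded 𝒜) : (1 : S) ∉ maxIdeal 𝒜 :=
  fun h => one_ne_zero (α := S) (eq_zero_of_smul_eq_self hN (self 𝒜) h (one_smul S (1 : S)))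

theorem isMaximal_maxIdeal [Nontrivial S] (hN : IsNatGraded 𝒜) (h0 : IsConnectedOver k 𝒜) :
    (maxIdeal 𝒜).IsMaximal := by
  refine Ideal.isMaximal_iff.2 ⟨one_notMem_maxIdeal hN, fun J x hJ hx hxJ => ?_⟩
  obtain ⟨c, hc⟩ := exists_algebraMap_sub_mem_maxIdeal h0 x
  have hc0 : c ≠ 0 := fun h => hx (by rwa [h, map_zero, sub_zero] at hc)
  have algebraMap_mem : algebraMap k S c ∈ J := by
    have hmem := J.sub_mem hxJ (hJ hc)
    rwa [sub_sub_cancel] at hmem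
  have hone := J.mul_mem_left (algebraMap k S c⁻¹) algebraMap_mem
  rwa [← map_mul, inv_mul_cancel₀ hc0, map_one] at hone

/-- If `s = c + a` with `c` a nonzero scalar and `a` in the maximal ideal, then `x = -c⁻¹ a x`. -/
theorem eq_zero_of_smul_eq_zero_of_notMem (hN : IsNatGraded 𝒜) (M : GrMod 𝒜)
    (h0 : IsConnectedOver k 𝒜) {s : S} (hs : s ∉ maxIdeal 𝒜) {x : M.carrier} (hx : s • x = 0) :
    x = 0 := by
  obtain ⟨c, hc⟩ := exists_algebraMap_sub_mem_maxIdeal h0 s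
  have hc0 : c ≠ 0 := fun h => hs (by rwa [h, map_zero, sub_zero] at hc)
  obtain ⟨w, hw⟩ := ((IsUnit.mk0 c hc0).map (algebraMap k S)).exists_left_inv
  refine eq_zero_of_smul_eq_self hN M (Ideal.mul_mem_left _ (-w) hc) ?_
  rw [mul_smul, sub_smul, hx, zero_sub, smul_neg, neg_smul, neg_neg, smul_smul, hw, one_smul]

end MaxIdeal

/-! ### Local cohomology below the depth of the ring -/

section CosyzygyDefinition

variable {N : GrMod 𝒜} (R : InjRes N)

/-- The cosyzygies of an injective resolution. -/
noncomputable def InjRes.cosyzygy : ℕ → GrMod 𝒜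
  | 0 => N
  | p + 1 => sub _ (isHomogeneous_ker (R.differential (p + 1)))

/-- The inclusions of the cosyzygies in the terms of an injective resolution. -/
noncomputable def InjRes.cosyzygyIncl : ∀ p, Hom (R.cosyzygy p) (R.I p)
  | 0 => R.augmentation
  | p + 1 => subIncl _ (isHomogeneous_ker (R.differential (p + 1)))

/-- The differentials of an injective resolution as maps to the cosyzygies. -/
noncomputable def InjRes.cosyzygyProj (p : ℕ) : Hom (R.I p) (R.cosyzygy (p + 1)) :=
  subLift _ (isHomogeneous_ker (R.differential (p + 1))) (R.differential p) (R.δ_δ p)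

theorem InjRes.isShortExact_cosyzygy (p : ℕ) :
    IsShortExact (R.cosyzygyIncl p) (R.cosyzygyProj p) where
  injective := by
    cases p with
    | zero => exact R.ε_injective
    | succ p => exact subIncl_injective _ (isHomogeneous_ker (R.differential (p + 1)))
  surjective y := by
    obtain ⟨x, hx⟩ := (R.exact_succ p _).1 y.2
    exact ⟨x, Subtype.ext hx⟩
  exact x := by
    rw [show (R.cosyzygyProj p).1 x = 0 ↔ R.δ p x = 0 from Subtype.ext_iff]
    cases p with
    | zero => exact R.exact_zero x
    | succ p => exact exact_subIncl_ker (R.differential (p + 1)) x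

end CosyzygyDefinition

section DepthVanishing

variable [GradedRing 𝒜]

namespace FreeRes

variable {L : GrMod 𝒜} {P : FreeRes L}

theorem eq_zero_of_cocycles_le_coboundaries {X : Type*} [AddCommGroup X]
    [Module S X] (h : P.cocycles X 0 ≤ P.coboundaries X 0) (f : L.carrier →ₗ[S] X) : f = 0 := by
  have comp_eq_zero : f ∘ₗ P.ε.1 = 0 := (Submodule.mem_bot S).1 (h (mem_cocycles_iff.2 fun x => by
    rw [LinearMap.comp_apply, P.ε_δ, map_zero]))
  refine LinearMap.ext fun y => ?_
  obtain ⟨x, rfl⟩ := P.ε_surjective y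
  exact LinearMap.congr_fun comp_eq_zero x

/-- The vanishing of the graded `Ext` group of index `i + 1`, computed by a free resolution. -/
def ExtSuccVanishes (P : FreeRes L) (i : ℕ) (N : GrMod 𝒜) : Prop :=
  ∀ φ : Hom (P.F (i + 1)) N, (∀ x, φ.1 ((P.δ (i + 1)).1 x) = 0) →
    ∃ ψ : Hom (P.F i) N, ∀ x, φ.1 x = ψ.1 ((P.δ i).1 x)

theorem extSuccVanishes_of_cocycles_le_coboundaries {N : GrMod 𝒜} {i : ℕ}
    (h : P.cocycles N.carrier (i + 1) ≤ P.coboundaries N.carrier (i + 1)) :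
    P.ExtSuccVanishes i N := fun φ hφ => by
  obtain ⟨ψ, hψ⟩ := mem_coboundaries_succ_iff.1 (h (mem_cocycles_iff.2 hφ))
  exact ⟨homogenize ψ, fun x => congrArg (fun u : Hom (P.F (i + 1)) N => u.1 x)
    (homogenize_comp_eq hψ).symm⟩

variable {A E B : GrMod 𝒜} {f : Hom A E} {g : Hom E B}

theorem exists_lift_of_extSuccVanishes (h : IsShortExact f g) {i : ℕ}
    (hA : P.ExtSuccVanishes i A) (φ : Hom (P.F i) B) (hφ : ∀ x, φ.1 ((P.δ i).1 x) = 0) :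
    ∃ χ : Hom (P.F i) E, (∀ x, g.1 (χ.1 x) = φ.1 x) ∧ ∀ x, χ.1 ((P.δ i).1 x) = 0 := by
  obtain ⟨φ', hφ'⟩ := exists_hom_lift g φ fun x => h.surjective _
  obtain ⟨χ, hχ⟩ := exists_hom_lift f (φ'.comp (P.δ i)) fun x => (h.exact _).1 (by
    rw [Hom.comp_apply, hφ', hφ])
  obtain ⟨ψ, hψ⟩ := hA χ fun x => h.injective (by
    rw [hχ, Hom.comp_apply, P.δ_δ, map_zero, map_zero])
  refine ⟨φ' - f.comp ψ, fun x => ?_, fun x => ?_⟩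
  · rw [Hom.sub_apply, map_sub, hφ', Hom.comp_apply, (h.exact _).2 ⟨_, rfl⟩, sub_zero]
  · rw [Hom.sub_apply, Hom.comp_apply, ← hψ, hχ, Hom.comp_apply, sub_self]

theorem ExtSuccVanishes.of_isShortExact (h : IsShortExact f g) (hE : E.IsInjective) {i : ℕ}
    (hA : P.ExtSuccVanishes (i + 1) A) : P.ExtSuccVanishes i B := by
  intro φ hφ
  obtain ⟨χ, hχ, hχ'⟩ := exists_lift_of_extSuccVanishes h hA φ hφ
  obtain ⟨w, hw⟩ := hE.exists_extension (P.δ i) χ fun x hx => by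
    obtain ⟨y, rfl⟩ := (P.exact_succ i x).1 hx
    exact hχ' y
  exact ⟨g.comp w, fun x => by rw [Hom.comp_apply, hw, hχ]⟩

theorem ExtSuccVanishes.exists_lift (h : IsShortExact f g) (hE : E.IsInjective)
    (hA : P.ExtSuccVanishes 0 A) (φ : Hom L B) : ∃ w : Hom L E, ∀ x, g.1 (w.1 x) = φ.1 x := by
  obtain ⟨χ, hχ, hχ'⟩ := exists_lift_of_extSuccVanishes h hA (φ.comp P.ε) fun x => by
    rw [Hom.comp_apply, P.ε_δ, map_zero]
  obtain ⟨w, hw⟩ := hE.exists_extension P.ε χ fun x hx => by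
    obtain ⟨y, rfl⟩ := (P.exact_zero x).1 hx
    exact hχ' y
  refine ⟨w, fun x => ?_⟩
  obtain ⟨y, rfl⟩ := P.ε_surjective x
  rw [hw, hχ, Hom.comp_apply]

end FreeRes

variable {N : GrMod 𝒜} (R : InjRes N)

theorem InjRes.extSuccVanishes_cosyzygy {L : GrMod 𝒜} {P : FreeRes L} {i p : ℕ}
    (h : P.ExtSuccVanishes (i + p) N) : P.ExtSuccVanishes i (R.cosyzygy p) := by
  induction p generalizing i with
  | zero => exact h
  | succ p ih =>
    exact (ih (i := i + 1) (by rwa [add_right_comm])).of_isShortExact (R.isShortExact_cosyzygy p)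
      (R.inj p)

theorem smul_span_singleton_eq_zero {X : Type*} [AddCommGroup X] [Module S X] {z : X} {c : S}
    (h : c • z = 0) (y : Submodule.span S {z}) : c • y = 0 := by
  obtain ⟨b, hb⟩ := Submodule.mem_span_singleton.1 y.2
  refine Subtype.ext ?_
  rw [Submodule.coe_smul, ← hb, smul_comm, h, smul_zero, Submodule.coe_zero]

/-- A torsion cocycle `z` spans a torsion module; the vanishing of its `Ext` groups lifts the
inclusion of `S z` in the cosyzygy, and the lift sends `z` to a torsion preimage. -/
theorem InjRes.cocycles_le_coboundaries_of_extSuccVanishes [IsNoetherianRing S] {i : ℕ}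
    (h : ∀ (L : GrMod 𝒜) (P : FreeRes L) (t : ℕ),
      (∀ c ∈ maxIdeal 𝒜 ^ t, ∀ z : L.carrier, c • z = 0) → P.ExtSuccVanishes i N)
    (n : Fin r → ℤ) : R.cocycles (i + 1) n ≤ R.coboundaries (i + 1) n := by
  intro z hz
  obtain ⟨t, ht⟩ := hz.1.2
  let K : Submodule S (R.I (i + 1)).carrier := Submodule.span S {z}
  have hK : (R.I (i + 1)).IsHomogeneous K := isHomogeneous_span hz.1.1
  have : Module.Finite S (sub K hK).carrier := inferInstanceAs (Module.Finite S K)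
  obtain ⟨P⟩ := exists_freeRes (sub K hK)
  have hP := h _ P t fun c hc => smul_span_singleton_eq_zero (ht c hc)
  have δ_eq_zero (y : (sub K hK).carrier) : R.δ (i + 1) y.1 = 0 := by
    obtain ⟨b, hb⟩ := Submodule.mem_span_singleton.1 y.2
    rw [← hb, map_smul, hz.2, smul_zero]
  obtain ⟨w, hw⟩ := (R.extSuccVanishes_cosyzygy (i := 0) (p := i) (by rwa [zero_add])).exists_lift
    (R.isShortExact_cosyzygy i) (R.inj i)
    (subLift _ (isHomogeneous_ker (R.differential (i + 1))) (subIncl K hK) δ_eq_zero)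
  let z' : (sub K hK).carrier := ⟨z, Submodule.mem_span_singleton_self z⟩
  have hz' : z' ∈ (sub K hK).gr n := hz.1.1
  exact ⟨w.1 z', ⟨w.mem hz', w.map_gammaTorsion _ ⟨t, fun c hc => Subtype.ext (ht c hc)⟩⟩,
    congrArg Subtype.val (hw z')⟩

variable {k : Type v} [Field k] [Algebra k S]

theorem subsingleton_H_self_of_lt [IsNoetherianRing S] (hN : IsNatGraded 𝒜)
    (h0 : IsConnectedOver k 𝒜) [(maxIdeal 𝒜).IsMaximal]
    {rs : List (Localization.AtPrime (maxIdeal 𝒜))}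
    (hrs : ∀ y ∈ rs, y ∈ IsLocalRing.maximalIdeal (Localization.AtPrime (maxIdeal 𝒜)))
    (hrs' : RingTheory.Sequence.IsWeaklyRegular (Localization.AtPrime (maxIdeal 𝒜)) rs)
    (ρ : ∀ N : GrMod 𝒜, InjRes N) {i : ℕ} (hi : i < rs.length) (n : Fin r → ℤ) :
    Subsingleton (H ρ (self 𝒜) i n) := by
  have ext_vanishes (L : GrMod 𝒜) (P : FreeRes L) (t : ℕ)
      (ht : ∀ c ∈ maxIdeal 𝒜 ^ t, ∀ z : L.carrier, c • z = 0) :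
      P.cocycles S i ≤ P.coboundaries S i :=
    FreeRes.cocycles_le_coboundaries_of_localization ht
      (fun _ hs _ => eq_zero_of_smul_eq_zero_of_notMem hN (self 𝒜) h0 hs) hrs hrs' hi
  rw [← not_nontrivial_iff_subsingleton]
  cases i with
  | zero =>
    rw [nontrivial_cohomology_zero_iff]
    rintro ⟨z, hz, hz0, t, ht⟩
    let K : Submodule S (self 𝒜).carrier := Submodule.span S {z}
    have hK : (self 𝒜).IsHomogeneous K := isHomogeneous_span hz
    have : Module.Finite S (sub K hK).carrier := inferInstanceAs (Module.Finite S K)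
    obtain ⟨P⟩ := exists_freeRes (sub K hK)
    have subtype_eq_zero := FreeRes.eq_zero_of_cocycles_le_coboundaries
      (ext_vanishes _ P t fun c hc => smul_span_singleton_eq_zero (ht c hc)) K.subtype
    exact hz0 (LinearMap.congr_fun subtype_eq_zero ⟨z, Submodule.mem_span_singleton_self z⟩)
  | succ i =>
    rw [nontrivial_iff_exists]
    rintro ⟨z, hz, hz'⟩
    exact hz' ((ρ (self 𝒜)).cocycles_le_coboundaries_of_extSuccVanishes (fun L P t ht =>
      FreeRes.extSuccVanishes_of_cocycles_le_coboundaries (ext_vanishes L P t ht)) n hz)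

end DepthVanishing

/-! ### The height of the homogeneous maximal ideal -/

attribute [local instance] Polynomial.algebra Polynomial.isLocalization in
theorem height_le_height_comap_C_add_one {R : Type*} [CommRing R] [IsNoetherianRing R]
    (Q : Ideal (Polynomial R)) [Q.IsPrime] : Q.height ≤ (Q.comap Polynomial.C).height + 1 := by
  let p : Ideal R := Q.comap Polynomial.C
  have hp : p.IsPrime := Ideal.comap_isPrime _ _
  let Rp := Localization.AtPrime p
  have disjoint_Q : Disjoint (p.primeCompl.map Polynomial.C : Set (Polynomial R)) Q := by
    refine Set.disjoint_left.mpr ?_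
    rintro _ ⟨b, hb, rfl⟩ hbQ
    exact hb hbQ
  have isPrime_map : (Q.map (algebraMap (Polynomial R) (Polynomial Rp))).IsPrime :=
    IsLocalization.isPrime_of_isPrime_disjoint (Submonoid.map Polynomial.C p.primeCompl) _ Q
      inferInstance disjoint_Q
  have height_map_le := Ideal.height_le_ringKrullDim_of_isPrime
    (I := Q.map (algebraMap (Polynomial R) (Polynomial Rp)))
  rw [IsLocalization.height_map_of_disjoint (Submonoid.map Polynomial.C p.primeCompl) Q
      disjoint_Q, Polynomial.ringKrullDim_of_isNoetherianRing,
    IsLocalization.AtPrime.ringKrullDim_eq_height p Rp] at height_map_le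
  exact_mod_cast height_map_le

section Coaction

variable [GradedRing 𝒜]

variable (𝒜) in
/-- The coaction of the weight grading, which sends `a` in `𝒜 n` to `a T^{-|n|}`. -/
noncomputable def coaction : S →+* AddMonoidAlgebra S ℤ :=
  (DirectSum.toSemiring (A := fun n => 𝒜 n)
    (fun n => (AddMonoidAlgebra.singleAddHom (-weight n)).comp (𝒜 n).subtype)
    (by
      change AddMonoidAlgebra.single (-weight 0) (1 : S) = 1
      rw [weight_zero, neg_zero, AddMonoidAlgebra.one_def])
    (fun {m n} a b => by
      change AddMonoidAlgebra.single (-weight (m + n)) ((a : S) * b) =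
        AddMonoidAlgebra.single (-weight m) (a : S) * AddMonoidAlgebra.single (-weight n) (b : S)
      rw [AddMonoidAlgebra.single_mul_single, weight_add, neg_add])).comp
    (DirectSum.decomposeRingEquiv 𝒜).toRingHom

theorem coaction_of_mem {n : Fin r → ℤ} {a : S} (ha : a ∈ 𝒜 n) :
    coaction 𝒜 a = AddMonoidAlgebra.single (-weight n) a := by
  have decompose_eq : DirectSum.decomposeRingEquiv 𝒜 a = DirectSum.of (fun n => 𝒜 n) n ⟨a, ha⟩ :=
    DirectSum.decompose_of_mem 𝒜 ha
  rw [coaction, RingHom.comp_apply]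
  refine (congrArg _ decompose_eq).trans ?_
  rw [DirectSum.toSemiring_of]
  rfl

variable (𝒜) in
/-- The extension of the coaction to a map from the polynomial ring to the Laurent polynomials
that sends the variable `X` to `T`. -/
noncomputable def polyCoaction : Polynomial S →+* AddMonoidAlgebra S ℤ :=
  Polynomial.eval₂RingHom (coaction 𝒜) (AddMonoidAlgebra.single 1 1)

variable (𝒜) in
/-- The prime ideal of the polynomial ring that is the preimage of `p S[T, T⁻¹]` under the
extended coaction. -/
noncomputable def coactionPrime (p : PrimeSpectrum S) : PrimeSpectrum (Polynomial S) :=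
  ⟨RingHom.ker ((AddMonoidAlgebra.mapRingHom ℤ (Ideal.Quotient.mk p.asIdeal)).comp
    (polyCoaction 𝒜)), RingHom.ker_isPrime _⟩

theorem mem_coactionPrime {p : PrimeSpectrum S} {f : Polynomial S} :
    f ∈ (coactionPrime 𝒜 p).asIdeal ↔ ∀ i, (polyCoaction 𝒜 f).coeff i ∈ p.asIdeal := by
  change AddMonoidAlgebra.mapRingHom ℤ (Ideal.Quotient.mk p.asIdeal) (polyCoaction 𝒜 f) = 0 ↔ _
  constructor
  · intro h i
    rw [← Ideal.Quotient.eq_zero_iff_mem, ← AddMonoidAlgebra.coeff_mapRingHom, h]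
    rfl
  · intro h
    ext i
    rw [AddMonoidAlgebra.coeff_mapRingHom, Ideal.Quotient.eq_zero_iff_mem.2 (h i)]
    rfl

theorem C_mem_coactionPrime {p : PrimeSpectrum S} {s : S} :
    Polynomial.C s ∈ (coactionPrime 𝒜 p).asIdeal ↔ ∀ i, (coaction 𝒜 s).coeff i ∈ p.asIdeal := by
  rw [mem_coactionPrime, polyCoaction, Polynomial.coe_eval₂RingHom, Polynomial.eval₂_C]

theorem mem_coactionPrime_iff_of_eq_single {p : PrimeSpectrum S} {f : Polynomial S} {i : ℤ}
    {a : S} (hf : polyCoaction 𝒜 f = AddMonoidAlgebra.single i a) :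
    f ∈ (coactionPrime 𝒜 p).asIdeal ↔ a ∈ p.asIdeal := by
  rw [mem_coactionPrime, hf, AddMonoidAlgebra.coeff_single]
  refine ⟨fun h => ?_, fun h i' => ?_⟩
  · rw [← Finsupp.single_eq_same (a := i) (b := a)]
    exact h i
  · by_cases hi : i' = i
    · rwa [hi, Finsupp.single_eq_same]
    · rw [Finsupp.single_eq_of_ne hi]
      exact zero_mem _

theorem exists_polyCoaction_eq (hN : IsNatGraded 𝒜) (a : S) :
    ∃ f, polyCoaction 𝒜 f = AddMonoidAlgebra.single 0 a := by
  induction a using DirectSum.Decomposition.inductionOn 𝒜 with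
  | zero => exact ⟨0, by rw [map_zero, AddMonoidAlgebra.single_zero]⟩
  | @homogeneous n a =>
    by_cases hn : 0 ≤ n
    · refine ⟨Polynomial.C (a : S) * Polynomial.X ^ (weight n).toNat, ?_⟩
      rw [polyCoaction, Polynomial.coe_eval₂RingHom, Polynomial.eval₂_mul, Polynomial.eval₂_C,
        Polynomial.eval₂_pow, Polynomial.eval₂_X, coaction_of_mem a.2,
        AddMonoidAlgebra.single_pow, AddMonoidAlgebra.single_mul_single, one_pow, mul_one,
        nsmul_one, Int.natCast_toNat_eq_self.2 (weight_nonneg hn), neg_add_cancel]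
    · have ha : (a : S) = 0 := AddSubgroup.mem_bot.1 (hN n hn ▸ a.2)
      exact ⟨0, by rw [map_zero, ha, AddMonoidAlgebra.single_zero]⟩
  | add a b ha hb =>
    obtain ⟨f, hf⟩ := ha
    obtain ⟨g, hg⟩ := hb
    exact ⟨f + g, by rw [map_add, hf, hg, AddMonoidAlgebra.single_add]⟩

theorem strictMono_coactionPrime (hN : IsNatGraded 𝒜) : StrictMono (coactionPrime 𝒜) := by
  refine Monotone.strictMono_of_injective (fun p q h f hf => ?_) fun p q h => ?_
  · exact mem_coactionPrime.2 fun i => h (mem_coactionPrime.1 hf i)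
  · refine PrimeSpectrum.ext (Ideal.ext fun a => ?_)
    obtain ⟨f, hf⟩ := exists_polyCoaction_eq hN a
    rw [← mem_coactionPrime_iff_of_eq_single hf, ← mem_coactionPrime_iff_of_eq_single hf, h]

theorem coeff_zero_coaction_mem (hN : IsNatGraded 𝒜) (s : S) :
    (coaction 𝒜 s).coeff 0 ∈ 𝒜 0 ∧ s - (coaction 𝒜 s).coeff 0 ∈ maxIdeal 𝒜 := by
  induction s using DirectSum.Decomposition.inductionOn 𝒜 with
  | zero => simp
  | @homogeneous n a =>
    rw [coaction_of_mem a.2, AddMonoidAlgebra.coeff_single]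
    by_cases hn0 : n = 0
    · subst hn0
      rw [weight_zero, neg_zero, Finsupp.single_eq_same, sub_self]
      exact ⟨a.2, zero_mem _⟩
    · by_cases hn : 0 ≤ n
      · rw [Finsupp.single_eq_of_ne (neg_ne_zero.2 (weight_pos hn hn0).ne').symm, sub_zero]
        exact ⟨zero_mem _, mem_maxIdeal a.2 hn0⟩
      · have ha : (a : S) = 0 := AddSubgroup.mem_bot.1 (hN n hn ▸ a.2)
        simp [ha]
  | add a b ha hb =>
    rw [map_add, AddMonoidAlgebra.coeff_add, Finsupp.add_apply, add_sub_add_comm]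
    exact ⟨add_mem ha.1 hb.1, add_mem ha.2 hb.2⟩

theorem maxIdeal_le_of_C_mem_coactionPrime {p : PrimeSpectrum S}
    (h : ∀ s ∈ maxIdeal 𝒜, Polynomial.C s ∈ (coactionPrime 𝒜 p).asIdeal) :
    maxIdeal 𝒜 ≤ p.asIdeal := by
  refine Ideal.span_le.2 ?_
  rintro a ⟨n, hn, ha⟩
  have coeff_mem := C_mem_coactionPrime.1 (h a (mem_maxIdeal ha hn)) (-weight n)
  rwa [coaction_of_mem ha, AddMonoidAlgebra.coeff_single, Finsupp.single_eq_same] at coeff_mem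

variable {k : Type v} [Field k] [Algebra k S]

theorem mem_maxIdeal_of_C_mem_coactionPrime (hN : IsNatGraded 𝒜) (h0 : IsConnectedOver k 𝒜)
    {p : PrimeSpectrum S} {s : S} (hs : Polynomial.C s ∈ (coactionPrime 𝒜 p).asIdeal) :
    s ∈ maxIdeal 𝒜 := by
  obtain ⟨coeff_mem, sub_coeff_mem⟩ := coeff_zero_coaction_mem hN s
  obtain ⟨c, hc⟩ := (h0 _).1 coeff_mem
  have hc0 : c = 0 := by
    by_contra hc0
    refine p.2.ne_top (Ideal.eq_top_of_isUnit_mem _ (C_mem_coactionPrime.1 hs 0) ?_)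
    rw [← hc]
    exact (IsUnit.mk0 c hc0).map _
  rwa [← hc, hc0, map_zero, sub_zero] at sub_coeff_mem

/-- If a prime `P` does not contain the homogeneous maximal ideal, then the prime of `S[X]` attached
to `P` lies over a prime strictly contained in the homogeneous maximal ideal; passing from `P` to
`S[X]` does not lower the height, and contracting to `S` lowers it by at most one. -/
theorem height_maxIdeal [IsNoetherianRing S] [Nontrivial S] (hN : IsNatGraded 𝒜)
    (h0 : IsConnectedOver k 𝒜) : ((maxIdeal 𝒜).height : WithBot ℕ∞) = ringKrullDim S := by
  have hmax : (maxIdeal 𝒜).IsMaximal := isMaximal_maxIdeal hN h0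
  refine le_antisymm Ideal.height_le_ringKrullDim_of_isPrime
    ((ringKrullDim_le_iff_height_le _).2 fun P hP => ?_)
  by_cases hle : maxIdeal 𝒜 ≤ P
  · rw [hmax.eq_of_le hP.ne_top hle]
  let p : PrimeSpectrum S := ⟨P, hP⟩
  let Q : Ideal (Polynomial S) := (coactionPrime 𝒜 p).asIdeal
  have hQ : Q.IsPrime := (coactionPrime 𝒜 p).2
  have hQ' : (Q.comap Polynomial.C).IsPrime := Ideal.comap_isPrime _ _
  have height_le_height_Q : P.height ≤ Q.height := by
    rw [show P = p.asIdeal from rfl, PrimeSpectrum.height_eq_orderHeight,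
      PrimeSpectrum.height_eq_orderHeight]
    exact Order.height_le_height_apply_of_strictMono _ (strictMono_coactionPrime hN) p
  have comap_lt_maxIdeal : Q.comap Polynomial.C < maxIdeal 𝒜 :=
    lt_of_le_not_ge (fun s hs => mem_maxIdeal_of_C_mem_coactionPrime hN h0 hs)
      fun h => hle (maxIdeal_le_of_C_mem_coactionPrime h)
  have height_le : P.height ≤ (maxIdeal 𝒜).height := calc
    P.height ≤ Q.height := height_le_height_Q
    _ ≤ (Q.comap Polynomial.C).height + 1 := height_le_height_comap_C_add_one Q
    _ ≤ (maxIdeal 𝒜).height := Ideal.height_add_one_le_of_lt_of_isPrime comap_lt_maxIdeal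
  exact_mod_cast height_le

end Coaction

/-! ### Syzygies -/

section Syzygy

variable [GradedRing 𝒜]

/-- The two cohomological properties of a Cohen–Macaulay graded ring of dimension `d` on which the
argument rests: local cohomology of the ring vanishes below degree `d`, and that of finitely
generated graded modules vanishes above `d`. -/
structure IsCohomologicallyCohenMacaulay (ρ : ∀ N : GrMod 𝒜, InjRes N) (d : ℕ) : Prop where
  subsingleton_of_lt : ∀ i < d, ∀ n, Subsingleton (H ρ (self 𝒜) i n)
  subsingleton_of_gt : ∀ (X : GrMod 𝒜) [Module.Finite S X.carrier] (i : ℕ) n, d < i →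
    Subsingleton (H ρ X i n)

theorem isCohomologicallyCohenMacaulay_of_isCohenMacaulayLocal [IsNoetherianRing S] [Nontrivial S]
    {k : Type v} [Field k] [Algebra k S] (hN : IsNatGraded 𝒜) (h0 : IsConnectedOver k 𝒜)
    [(maxIdeal 𝒜).IsPrime] (hCM : IsCohenMacaulayLocal (Localization.AtPrime (maxIdeal 𝒜)))
    {d : ℕ} (hd : ringKrullDim S = d) (ρ : ∀ N : GrMod 𝒜, InjRes N) (j : Fin r) :
    IsCohomologicallyCohenMacaulay ρ d where
  subsingleton_of_lt i hi n := by
    have := isMaximal_maxIdeal hN h0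
    obtain ⟨rs, hrs, hreg, hlen⟩ := hCM
    rw [IsLocalization.AtPrime.ringKrullDim_eq_height (maxIdeal 𝒜), height_maxIdeal hN h0,
      hd] at hlen
    have length_eq : rs.length = d := by exact_mod_cast hlen
    exact subsingleton_H_self_of_lt hN h0 hrs hreg.1 ρ (length_eq ▸ hi) n
  subsingleton_of_gt X _ i n hi :=
    (isTame_of_finite hN (fun c => (h0 _).2 ⟨c, rfl⟩) ρ j X).subsingleton_of_lt i n
      (((Module.supportDim_le_ringKrullDim S X.carrier).trans_eq hd).trans_lt
        (by exact_mod_cast hi))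

namespace FreeRes

variable {M : GrMod 𝒜} (P : FreeRes M)

/-- The syzygies of a free resolution; the zeroth one is the resolved module. -/
noncomputable def syzygy : ℕ → GrMod 𝒜
  | 0 => M
  | p + 1 => sub _ (isHomogeneous_range (P.δ p))

/-- The inclusion of a syzygy in the preceding term of the resolution. -/
noncomputable def syzygyIncl (p : ℕ) : Hom (P.syzygy (p + 1)) (P.F p) :=
  subIncl _ (isHomogeneous_range (P.δ p))

/-- The maps of a free resolution, as projections of its terms to the syzygies. -/
noncomputable def syzygyProj : ∀ p, Hom (P.F p) (P.syzygy p)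
  | 0 => P.ε
  | p + 1 => subLift _ (isHomogeneous_range (P.δ p)) (P.δ p) fun x => ⟨x, rfl⟩

theorem syzygyIncl_comp_syzygyProj (p : ℕ) :
    (P.syzygyIncl p).comp (P.syzygyProj (p + 1)) = P.δ p := rfl

theorem isShortExact_syzygy (p : ℕ) : IsShortExact (P.syzygyIncl p) (P.syzygyProj p) where
  injective := subIncl_injective _ (isHomogeneous_range (P.δ p))
  surjective := by
    cases p with
    | zero => exact P.ε_surjective
    | succ p =>
      rintro ⟨_, y, rfl⟩
      exact ⟨y, rfl⟩
  exact x := by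
    have mem_range_iff : (∃ y, (P.syzygyIncl p).1 y = x) ↔ ∃ y, (P.δ p).1 y = x :=
      ⟨by rintro ⟨⟨_, z, rfl⟩, rfl⟩; exact ⟨z, rfl⟩, by rintro ⟨z, rfl⟩; exact ⟨⟨_, z, rfl⟩, rfl⟩⟩
    refine Iff.trans ?_ mem_range_iff.symm
    cases p with
    | zero => exact P.exact_zero x
    | succ p => exact Subtype.ext_iff.trans (P.exact_succ p x)

theorem finite_syzygy_succ (p : ℕ) : Module.Finite S (P.syzygy (p + 1)).carrier :=
  inferInstanceAs (Module.Finite S (LinearMap.range (P.δ p).1))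

variable (ρ : ∀ N : GrMod 𝒜, InjRes N)

section Shift

variable {e : ℕ} {n : Fin r → ℤ} {i p q : ℕ}

theorem subsingleton_H_of_syzygy (he : ∀ i < e, ∀ n, Subsingleton (H ρ (self 𝒜) i n))
    (hiq : i + q ≤ e) (h : Subsingleton (H ρ (P.syzygy (p + q)) (i + q) n)) :
    Subsingleton (H ρ (P.syzygy p) i n) := by
  induction q generalizing i p with
  | zero => exact h
  | succ q ih =>
    have subsingleton_succ : Subsingleton (H ρ (P.syzygy (p + 1)) (i + 1) n) :=
      ih (by omega) (by rwa [add_right_comm p, add_right_comm i])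
    exact (P.isShortExact_syzygy p).subsingleton_right
      ((subsingleton_H_free_iff _ ρ i n).2 fun q => he i (by omega) _) subsingleton_succ

theorem subsingleton_H_syzygy (he : ∀ i < e, ∀ n, Subsingleton (H ρ (self 𝒜) i n))
    (hiq : i + q < e) (h : Subsingleton (H ρ (P.syzygy p) i n)) :
    Subsingleton (H ρ (P.syzygy (p + q)) (i + q) n) := by
  induction q with
  | zero => exact h
  | succ q ih =>
    exact (P.isShortExact_syzygy (p + q)).subsingleton_left (ih (by omega))
      ((subsingleton_H_free_iff _ ρ _ n).2 fun q => he _ (by omega) _)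

theorem nontrivial_H_of_nontrivial_syzygy (he : ∀ i ≤ e, ∀ n, Subsingleton (H ρ (self 𝒜) i n))
    (h : Nontrivial (H ρ (P.syzygy p) e n)) : p ≤ e ∧ Nontrivial (H ρ M (e - p) n) := by
  have he' : ∀ i < e + 1, ∀ n, Subsingleton (H ρ (self 𝒜) i n) :=
    fun i hi => he i (Nat.lt_succ_iff.1 hi)
  by_cases hpe : p ≤ e
  · refine ⟨hpe, not_subsingleton_iff_nontrivial.1 fun hM => ?_⟩
    have hsyz := P.subsingleton_H_syzygy ρ he' (p := 0) (q := p) (by omega) hM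
    rw [zero_add, Nat.sub_add_cancel hpe] at hsyz
    exact not_nontrivial_iff_subsingleton.2 hsyz h
  · obtain ⟨q, rfl⟩ : ∃ q, p = q + 1 + e := ⟨p - e - 1, by omega⟩
    have subsingleton_zero : Subsingleton (H ρ (P.syzygy (q + 1)) 0 n) :=
      (P.isShortExact_syzygy q).subsingleton_left_zero
        ((subsingleton_H_free_iff _ ρ 0 n).2 fun _ => he 0 (Nat.zero_le e) _)
    have hsyz := P.subsingleton_H_syzygy ρ he' (q := e) (by omega) subsingleton_zero
    rw [zero_add] at hsyz
    exact absurd h (not_nontrivial_iff_subsingleton.2 hsyz)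

end Shift

variable {ρ} {d : ℕ} {p : ℕ} {n : Fin r → ℤ}

theorem nontrivial_H_F_of_nontrivial (hS : IsCohomologicallyCohenMacaulay ρ d) (hp : p ≤ d)
    (h : Nontrivial (H ρ M (d - p) n)) : Nontrivial (H ρ (P.F p) d n) := by
  refine not_subsingleton_iff_nontrivial.1 fun hF => not_subsingleton_iff_nontrivial.2 h ?_
  have := P.finite_syzygy_succ p
  have subsingleton_syzygy : Subsingleton (H ρ (P.syzygy p) d n) :=
    (P.isShortExact_syzygy p).subsingleton_right hF
      (hS.subsingleton_of_gt _ _ _ (Nat.lt_succ_self d))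
  exact P.subsingleton_H_of_syzygy ρ hS.subsingleton_of_lt (p := 0) (q := p) (by omega)
    (by rwa [zero_add, Nat.sub_add_cancel hp])

theorem surjective_Hmap_syzygyProj (hS : IsCohomologicallyCohenMacaulay ρ d) (p : ℕ)
    (n : Fin r → ℤ) : Function.Surjective (Hmap ρ (P.syzygyProj p) d n) :=
  have := P.finite_syzygy_succ p
  (P.isShortExact_syzygy p).surjective_Hmap (hS.subsingleton_of_gt _ _ _ (Nat.lt_succ_self d))

theorem Hmap_syzygyIncl_eq_zero (hS : IsCohomologicallyCohenMacaulay ρ d)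
    (hδ : Hmap ρ (P.δ p) d n = 0) : Hmap ρ (P.syzygyIncl p) d n = 0 := by
  refine AddMonoidHom.ext fun c => ?_
  obtain ⟨b, rfl⟩ := P.surjective_Hmap_syzygyProj hS (p + 1) n c
  rw [← P.syzygyIncl_comp_syzygyProj, Hmap_comp] at hδ
  exact DFunLike.congr_fun hδ b

theorem nontrivial_H_syzygy (hS : IsCohomologicallyCohenMacaulay ρ d)
    [Subsingleton (H ρ (P.F (p + 1)) d n)] [Nontrivial (H ρ (P.F p) d n)] :
    Nontrivial (H ρ (P.syzygy p) d n) :=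
  have : Subsingleton (H ρ (P.syzygy (p + 1)) d n) :=
    (P.surjective_Hmap_syzygyProj hS (p + 1) n).subsingleton
  ((P.isShortExact_syzygy p).injective_Hmap this).nontrivial

/-- The hypothesis on the differential makes `H^d` of the inclusion of the `p`-th syzygy vanish,
so the nonzero class in `H^d` of the syzygy comes from a connecting homomorphism; dimension
shifting then carries it down to `M`. -/
theorem nontrivial_H_of_nontrivial_F (hS : IsCohomologicallyCohenMacaulay ρ d)
    [Subsingleton (H ρ (P.F (p + 1)) d n)] [Nontrivial (H ρ (P.F p) d n)]
    (hδ : ∀ p', p = p' + 1 → Hmap ρ (P.δ p') d n = 0) :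
    p ≤ d ∧ Nontrivial (H ρ M (d - p) n) := by
  have nontrivial_syzygy := P.nontrivial_H_syzygy hS (p := p) (n := n)
  cases p with
  | zero => exact ⟨Nat.zero_le d, nontrivial_syzygy⟩
  | succ p =>
    have not_injective : ¬ Function.Injective (Hmap ρ (P.syzygyIncl p) d n) := fun hinj => by
      obtain ⟨x, y, hxy⟩ := nontrivial_syzygy
      exact hxy (hinj (by rw [P.Hmap_syzygyIncl_eq_zero hS (hδ p rfl)]; rfl))
    cases d with
    | zero => exact absurd ((P.isShortExact_syzygy p).Hmap_zero_injective ρ n) not_injective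
    | succ e =>
      have nontrivial_preceding : Nontrivial (H ρ (P.syzygy p) e n) :=
        not_subsingleton_iff_nontrivial.1 fun h =>
          not_injective ((P.isShortExact_syzygy p).injective_Hmap_succ h)
      obtain ⟨hpe, hM⟩ := P.nontrivial_H_of_nontrivial_syzygy ρ
        (fun i hi => hS.subsingleton_of_lt i (Nat.lt_succ_of_le hi)) nontrivial_preceding
      exact ⟨Nat.succ_le_succ hpe, by rwa [Nat.succ_sub_succ]⟩

end FreeRes

theorem proj_self (n : Fin r → ℤ) (x : S) :
    (self 𝒜).proj n x = (DirectSum.decompose 𝒜 x n : S) := by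
  have decomposition_eq : (inferInstance : DirectSum.Decomposition (self 𝒜).gr) =
      (inferInstance : DirectSum.Decomposition 𝒜) := Subsingleton.elim _ _
  exact congrArg (fun D : DirectSum.Decomposition 𝒜 => (D.decompose' x n : S)) decomposition_eq

theorem isHomogeneous_maxIdeal : (self 𝒜).IsHomogeneous (maxIdeal 𝒜) := by
  have h : (maxIdeal 𝒜).IsHomogeneous 𝒜 :=
    Ideal.homogeneous_span 𝒜 _ fun x ⟨n, _, hx⟩ => ⟨n, hx⟩
  exact fun n x hx => Set.mem_of_eq_of_mem (proj_self (𝒜 := 𝒜) n x) (h n hx)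

theorem exists_nontrivial_H_self [IsNoetherianRing S] [Nontrivial S] (hN : IsNatGraded 𝒜)
    {ρ : ∀ N : GrMod 𝒜, InjRes N} {d : ℕ} (hS : IsCohomologicallyCohenMacaulay ρ d) :
    ∃ n, Nontrivial (H ρ (self 𝒜) d n) := by
  by_contra! hd
  have subsingleton_of_le : ∀ i < d + 1, ∀ n, Subsingleton (H ρ (self 𝒜) i n) := fun i hi n => by
    rcases Nat.lt_succ_iff_lt_or_eq.1 hi with h | rfl
    · exact hS.subsingleton_of_lt i h n
    · exact hd n
  let K := quot (M := self 𝒜) (maxIdeal 𝒜) isHomogeneous_maxIdeal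
  let π : Hom (self 𝒜) K := quotProj _ isHomogeneous_maxIdeal
  have : Module.Finite S K.carrier := inferInstanceAs (Module.Finite S (S ⧸ maxIdeal 𝒜))
  obtain ⟨P⟩ := exists_freeRes K
  have := P.finite_syzygy_succ (0 + d)
  have subsingleton_K : Subsingleton (H ρ K 0 0) :=
    P.subsingleton_H_of_syzygy ρ subsingleton_of_le (p := 0) (q := d + 1) (by omega)
      (hS.subsingleton_of_gt _ _ _ (by omega))
  refine not_nontrivial_iff_subsingleton.2 subsingleton_K
    ((nontrivial_cohomology_zero_iff (ρ K)).2 ?_)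
  let o : (self 𝒜).carrier := (1 : S)
  refine ⟨π.1 o, π.mem (SetLike.GradedOne.one_mem : (1 : S) ∈ 𝒜 0),
    fun h => one_notMem_maxIdeal hN ((quotProj_eq_zero_iff _ isHomogeneous_maxIdeal o).1 h),
    1, fun a ha => ?_⟩
  rw [pow_one] at ha
  rw [← map_smul]
  refine (quotProj_eq_zero_iff _ isHomogeneous_maxIdeal _).2 ?_
  rwa [show a • o = a from mul_one a]

end Syzygy

/-! ### Maximal shifts -/

section Lex

variable {σ : Equiv.Perm (Fin r)}

theorem exists_toLex_max {T : Set (Fin r → ℤ)} (hT : T.Nonempty) {b : Fin r → ℤ}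
    (hb : ∀ n ∈ T, n ≤ b) : ∃ m ∈ T, ∀ n ∈ T, toLex n ≤ toLex m := by
  let f : (Fin r → ℤ) → Lex (Fin r → ℕ) := fun n => toLex fun i => (b i - n i).toNat
  obtain ⟨m, hm, hmin⟩ := WellFounded.has_min (wellFounded_lt.onFun (f := f)) T hT
  refine ⟨m, hm, fun n hn => not_lt.1 fun ⟨i, heq, (hlt : m i < n i)⟩ => hmin n hn ?_⟩
  refine ⟨i, fun i' hi' => ?_, ?_⟩
  · change (b i' - n i').toNat = (b i' - m i').toNat
    rw [show m i' = n i' from heq i' hi']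
  · change (b i - n i).toNat < (b i - m i).toNat
    have : n i ≤ b i := hb n hn i
    omega

theorem apply_le_of_toLex_comp_le {j : Fin r} (hσ : σ ⟨0, Fin.pos j⟩ = j) {n m : Fin r → ℤ}
    (h : toLex (n ∘ σ) ≤ toLex (m ∘ σ)) : n j ≤ m j := by
  have apply_zero_le := Pi.apply_le_of_toLex (i := ⟨0, Fin.pos j⟩) h fun i hi =>
    absurd (Fin.lt_def.1 hi) (Nat.not_lt_zero _)
  simpa only [Function.comp_apply, hσ] using apply_zero_le

theorem toLex_comp_lt_toLex_comp (σ : Equiv.Perm (Fin r)) {n m : Fin r → ℤ} (h : n < m) :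
    toLex (n ∘ σ) < toLex (m ∘ σ) :=
  Pi.toLex_strictMono (lt_of_le_of_ne (fun i => h.le (σ i))
    fun heq => h.ne (σ.surjective.injective_comp_right heq))

end Lex

namespace MinFreeRes

variable [GradedRing 𝒜] {M : GrMod 𝒜} (D : M.MinFreeRes)

/-- The free resolution underlying a minimal free resolution. -/
def toFreeRes : FreeRes M where
  rank := D.rank
  shift := D.shift
  ε := ⟨D.ε, D.ε_hom⟩
  δ p := ⟨D.δ p, D.δ_hom p⟩
  ε_surjective := D.ε_surjective
  exact_zero := D.exact_zero
  exact_succ := D.exact_succ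

/-- The vector `-a_{pq}`, recorded as in `lexMax` with its coordinates permuted by `σ`. -/
def lexShift (σ : Equiv.Perm (Fin r)) (p : ℕ) (q : Fin (D.rank p)) : Lex (Fin r → ℤ) :=
  toLex fun i => -D.shift p q (σ i)

theorem ofInt_le_t (p : ℕ) (q : Fin (D.rank p)) (j : Fin r) :
    ExtInt.ofInt (-D.shift p q j) ≤ D.t p j :=
  Finset.le_sup (f := fun q => ExtInt.ofInt (-D.shift p q j)) (Finset.mem_univ q)

theorem t_le_tStar (p : ℕ) (j : Fin r) : D.t p j ≤ D.tStar j := by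
  by_cases h : p ≤ D.l
  · exact Finset.le_sup (f := fun p => D.t p j) (Finset.mem_range.2 (Nat.lt_succ_of_le h))
  · refine Finset.sup_le fun q _ => ?_
    have := D.finite p (not_le.1 h)
    exact absurd q.2 (by omega)

section LexMax

variable (σ : Equiv.Perm (Fin r)) {p p' : ℕ}

theorem lexShift_le_lexMax (q : Fin (D.rank p)) :
    (D.lexShift σ p q : WithBot (Lex (Fin r → ℤ))) ≤ D.lexMax σ p :=
  Finset.le_sup (f := fun q => (D.lexShift σ p q : WithBot (Lex (Fin r → ℤ)))) (Finset.mem_univ q)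

variable {σ} in
theorem exists_lexMax_eq (h : D.lexMax σ p ≠ ⊥) :
    ∃ q, D.lexMax σ p = (D.lexShift σ p q : WithBot (Lex (Fin r → ℤ))) := by
  have univ_nonempty : (Finset.univ : Finset (Fin (D.rank p))).Nonempty := by
    by_contra hempty
    exact h (by rw [lexMax, Finset.not_nonempty_iff_eq_empty.1 hempty, Finset.sup_empty])
  obtain ⟨q, -, hq⟩ := Finset.exists_mem_eq_sup _ univ_nonempty fun q =>
    (D.lexShift σ p q : WithBot (Lex (Fin r → ℤ)))
  exact ⟨q, hq⟩

variable {σ} in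
theorem t_le_ofInt_of_lexMax_le {j : Fin r} (hσ : σ ⟨0, Fin.pos j⟩ = j) {q : Fin (D.rank p)}
    (h : D.lexMax σ p' ≤ (D.lexShift σ p q : WithBot (Lex (Fin r → ℤ)))) :
    D.t p' j ≤ ExtInt.ofInt (-D.shift p q j) :=
  Finset.sup_le fun q' _ => ExtInt.ofInt_le_ofInt.2 (apply_le_of_toLex_comp_le hσ
    (n := -D.shift p' q') (m := -D.shift p q)
    (WithBot.coe_le_coe.1 ((D.lexShift_le_lexMax σ q').trans h)))

theorem lexMax_eq_bot_of_lt (h : D.l < p) : D.lexMax σ p = ⊥ := by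
  refine (Finset.sup_eq_bot_iff _ _).2 fun q _ => ?_
  have := D.finite p h
  exact absurd q.2 (by omega)

theorem exists_forall_lexMax_le : ∃ p, ∀ p', D.lexMax σ p' ≤ D.lexMax σ p := by
  obtain ⟨p, -, hp⟩ := Finset.exists_max_image (Finset.range (D.l + 1)) (D.lexMax σ)
    ⟨0, Finset.mem_range.2 (Nat.succ_pos _)⟩
  refine ⟨p, fun p' => ?_⟩
  by_cases hp' : p' ≤ D.l
  · exact hp p' (Finset.mem_range.2 (Nat.lt_succ_of_le hp'))
  · exact (D.lexMax_eq_bot_of_lt σ (not_le.1 hp')).trans_le bot_le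

theorem forall_lexMax_eq_bot_or_exists_last :
    (∀ p, D.lexMax σ p = ⊥) ∨
      ∃ p, D.lexMax σ (p + 1) < D.lexMax σ p ∧ ∀ p', D.lexMax σ p' ≤ D.lexMax σ p := by
  classical
  obtain ⟨p₀, hmax⟩ := D.exists_forall_lexMax_le σ
  by_cases hbot : D.lexMax σ p₀ = ⊥
  · exact Or.inl fun p => le_bot_iff.1 (hbot ▸ hmax p)
  let IsMaxAt (p : ℕ) : Prop := D.lexMax σ p = D.lexMax σ p₀
  have le_of_isMaxAt (p : ℕ) (hp : IsMaxAt p) : p ≤ D.l :=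
    not_lt.1 fun h => hbot (hp ▸ D.lexMax_eq_bot_of_lt σ h)
  let p := Nat.findGreatest IsMaxAt D.l
  have hp : IsMaxAt p := Nat.findGreatest_spec (le_of_isMaxAt p₀ rfl) rfl
  refine Or.inr ⟨p, lt_of_le_of_ne (hp ▸ hmax _) fun heq => ?_, fun p' => hp ▸ hmax p'⟩
  have hsucc : IsMaxAt (p + 1) := heq.trans hp
  exact Nat.findGreatest_is_greatest (Nat.lt_succ_self p) (le_of_isMaxAt _ hsucc) hsucc

end LexMax

end MinFreeRes

section Entries

variable [GradedRing 𝒜] {k : Type v} [Field k] [Algebra k S]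

theorem pos_of_mem_maxIdeal [Nontrivial S] (hN : IsNatGraded 𝒜) (h0 : IsConnectedOver k 𝒜)
    {n : Fin r → ℤ} {x : S} (hx : x ∈ 𝒜 n) (hxM : x ∈ maxIdeal 𝒜) (hx0 : x ≠ 0) : 0 < n := by
  have nonneg : 0 ≤ n := by
    by_contra hn
    rw [hN n hn] at hx
    exact hx0 hx
  refine lt_of_le_of_ne nonneg fun hn => one_notMem_maxIdeal hN ?_
  obtain ⟨c, rfl⟩ := (h0 x).1 (hn ▸ hx)
  have hc : c ≠ 0 := fun h => hx0 (by rw [h, map_zero])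
  have one_mem := Ideal.mul_mem_left (maxIdeal 𝒜) (algebraMap k S c⁻¹) hxM
  rwa [← map_mul, inv_mul_cancel₀ hc, map_one] at one_mem

namespace MinFreeRes

variable {M : GrMod 𝒜} (D : M.MinFreeRes)

/-- The entries of the matrix of a differential. -/
def entry (p : ℕ) (q : Fin (D.rank (p + 1))) (q' : Fin (D.rank p)) : S :=
  (D.δ p (Pi.single q (1 : S) : Fin (D.rank (p + 1)) → S) : Fin (D.rank p) → S) q'

variable {p : ℕ} (q : Fin (D.rank (p + 1))) (q' : Fin (D.rank p))

theorem entry_mem : D.entry p q q' ∈ 𝒜 (D.shift p q' - D.shift (p + 1) q) := by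
  rw [sub_eq_add_neg]
  refine D.δ_hom p _ _ (single_mem_freeGr (D.shift (p + 1)) q ?_) q'
  rw [add_neg_cancel]
  exact SetLike.GradedOne.one_mem

theorem entry_mem_maxIdeal : D.entry p q q' ∈ maxIdeal 𝒜 := by
  have smul_top_le : maxIdeal 𝒜 • (⊤ : Submodule S (Fin (D.rank p) → S)) ≤
      Submodule.comap (LinearMap.proj (R := S) (φ := fun _ : Fin (D.rank p) => S) q')
        (maxIdeal 𝒜) :=
    Submodule.smul_le.2 fun _ hc y _ => Ideal.mul_mem_right (y q') _ hc
  exact smul_top_le (D.minimal p ⟨_, rfl⟩)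

theorem freeEntry_apply (s : S) :
    (freeEntry (D.shift (p + 1)) (D.shift p) (D.toFreeRes.δ p) q q').1 s =
      s * D.entry p q q' := by
  have single_eq : (Pi.single q s : Fin (D.rank (p + 1)) → S) = s • Pi.single q (1 : S) := by
    rw [← Pi.single_smul, smul_eq_mul, mul_one]
  have δ_single : D.δ p (Pi.single q s : Fin (D.rank (p + 1)) → S) =
      s • D.δ p (Pi.single q (1 : S) : Fin (D.rank (p + 1)) → S) :=
    (congrArg (D.δ p) single_eq).trans ((D.δ p).map_smul s _)
  exact congrFun δ_single q'

theorem shift_lt_of_freeEntry_ne_zero [Nontrivial S] (hN : IsNatGraded 𝒜)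
    (h0 : IsConnectedOver k 𝒜)
    (h : freeEntry (D.shift (p + 1)) (D.shift p) (D.toFreeRes.δ p) q q' ≠ 0) :
    D.shift (p + 1) q < D.shift p q' := by
  have entry_ne_zero : D.entry p q q' ≠ 0 := fun h' => h (Hom.ext fun (s : S) =>
    (D.freeEntry_apply q q' s).trans (by rw [h', mul_zero]; rfl))
  exact sub_pos.1 (pos_of_mem_maxIdeal hN h0 (D.entry_mem q q') (D.entry_mem_maxIdeal q q')
    entry_ne_zero)

end MinFreeRes

end Entries

/-! ### The invariants of a minimal free resolution -/

section Invariants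

variable {M : GrMod 𝒜} (ρ : ∀ N : GrMod 𝒜, InjRes N) {i : ℕ} {j : Fin r}

theorem ofInt_le_aInv {n : Fin r → ℤ} (h : Nontrivial (H ρ M i n)) :
    ExtInt.ofInt (n j) ≤ M.aInv i j :=
  le_iSup₂_of_le n ((mem_localCohomologySupport_iff ρ).2 h) le_rfl

theorem aInv_le_iff {c : ExtInt} :
    M.aInv i j ≤ c ↔ ∀ n, Nontrivial (H ρ M i n) → ExtInt.ofInt (n j) ≤ c := by
  simp only [aInv, iSup_le_iff, mem_localCohomologySupport_iff ρ]

variable {ρ}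

theorem IsTame.aInv_ne_top (hM : IsTame ρ j M) (i : ℕ) : M.aInv i j ≠ ⊤ := by
  obtain ⟨b, hb⟩ := hM.exists_bound
  refine ne_top_of_le_ne_top (ExtInt.ofInt_ne_top b) ((aInv_le_iff ρ).2 fun n hn => ?_)
  exact ExtInt.ofInt_le_ofInt.2
    (not_lt.1 fun h => not_subsingleton_iff_nontrivial.2 hn (hb i n h))

end Invariants

section LexMaxDegree

variable [GradedRing 𝒜] {ρ : ∀ N : GrMod 𝒜, InjRes N} {d : ℕ} {σ : Equiv.Perm (Fin r)}

/-- The degree `m` is the largest one, for the order `≤_σ`, in which `H^d` of the ring is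
nonzero. -/
structure IsLexMaxDegree (ρ : ∀ N : GrMod 𝒜, InjRes N) (d : ℕ) (σ : Equiv.Perm (Fin r))
    (m : Fin r → ℤ) : Prop where
  nontrivial : Nontrivial (H ρ (self 𝒜) d m)
  le : ∀ n, Nontrivial (H ρ (self 𝒜) d n) → toLex (n ∘ σ) ≤ toLex (m ∘ σ)

theorem exists_isLexMaxDegree [IsNoetherianRing S] [Nontrivial S] {k : Type v} [Field k]
    [Algebra k S] (hN : IsNatGraded 𝒜) (h0 : IsConnectedOver k 𝒜)
    (hS : IsCohomologicallyCohenMacaulay ρ d) (σ : Equiv.Perm (Fin r)) :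
    ∃ m, IsLexMaxDegree ρ d σ m := by
  have : Module.Finite S (self 𝒜).carrier := inferInstanceAs (Module.Finite S S)
  choose b hb using fun i : Fin r =>
    (isTame_of_finite hN (fun c => (h0 _).2 ⟨c, rfl⟩) ρ i (self 𝒜)).exists_bound
  have le_b (n) (hn : Nontrivial (H ρ (self 𝒜) d n)) (i : Fin r) : n i ≤ b i :=
    not_lt.1 fun h => not_subsingleton_iff_nontrivial.2 hn (hb i d n h)
  obtain ⟨n₀, hn₀⟩ := exists_nontrivial_H_self hN hS
  obtain ⟨_, ⟨m, hm, rfl⟩, hmax⟩ := exists_toLex_max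
    (T := (fun n => n ∘ σ) '' {n | Nontrivial (H ρ (self 𝒜) d n)}) ⟨_, n₀, hn₀, rfl⟩
    (b := b ∘ σ) (by rintro _ ⟨n, hn, rfl⟩ i; exact le_b n hn (σ i))
  exact ⟨m, hm, fun n hn => hmax _ ⟨n, hn, rfl⟩⟩

namespace IsLexMaxDegree

variable {m : Fin r → ℤ}

theorem aInv_self_eq (hm : IsLexMaxDegree ρ d σ m) {j : Fin r}
    (hσ : σ ⟨0, Fin.pos j⟩ = j) : (self 𝒜).aInv d j = ExtInt.ofInt (m j) :=
  le_antisymm ((aInv_le_iff ρ).2 fun n hn =>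
    ExtInt.ofInt_le_ofInt.2 (apply_le_of_toLex_comp_le hσ (hm.le n hn)))
    (ofInt_le_aInv ρ hm.nontrivial)

theorem subsingleton_of_lt (hm : IsLexMaxDegree ρ d σ m) {a b : Fin r → ℤ}
    (h : toLex (b ∘ σ) < toLex (a ∘ σ)) : Subsingleton (H ρ (self 𝒜) d (a + (m - b))) := by
  refine not_nontrivial_iff_subsingleton.1 fun hn => (hm.le _ hn).not_gt ?_
  calc toLex (m ∘ σ) = toLex (b ∘ σ) + (toLex (m ∘ σ) - toLex (b ∘ σ)) := by abel
    _ < toLex (a ∘ σ) + (toLex (m ∘ σ) - toLex (b ∘ σ)) := add_lt_add_left h _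

end IsLexMaxDegree

end LexMaxDegree

namespace MinFreeRes

variable [GradedRing 𝒜] {k : Type v} [Field k] [Algebra k S]
  {ρ : ∀ N : GrMod 𝒜, InjRes N} {d : ℕ} {σ : Equiv.Perm (Fin r)} {m : Fin r → ℤ}
  {M : GrMod 𝒜} (D : M.MinFreeRes) {p : ℕ} {j : Fin r}

theorem Hmap_δ_eq_zero [Nontrivial S] (hN : IsNatGraded 𝒜) (h0 : IsConnectedOver k 𝒜)
    (hm : IsLexMaxDegree ρ d σ m) {q₀ : Fin (D.rank (p + 1))}
    (hq₀ : D.lexMax σ (p + 1) = (D.lexShift σ (p + 1) q₀ : WithBot (Lex (Fin r → ℤ)))) :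
    Hmap ρ (D.toFreeRes.δ p) d (m - D.shift (p + 1) q₀) = 0 := by
  refine Hmap_free_eq_zero _ _ _ ρ d _ fun q q' => Or.inr ?_
  by_cases hentry : freeEntry (D.shift (p + 1)) (D.shift p) (D.toFreeRes.δ p) q q' = 0
  · exact Or.inr hentry
  have shift_q₀_le : toLex (D.shift (p + 1) q₀ ∘ σ) ≤ toLex (D.shift (p + 1) q ∘ σ) :=
    neg_le_neg_iff.1 (WithBot.coe_le_coe.1 ((D.lexShift_le_lexMax σ q).trans_eq hq₀))
  have shift_q_lt := toLex_comp_lt_toLex_comp σ (D.shift_lt_of_freeEntry_ne_zero q q' hN h0 hentry)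
  exact Or.inl (hm.subsingleton_of_lt (shift_q₀_le.trans_lt shift_q_lt))

theorem aInv_le_t_add_aInv_self (hS : IsCohomologicallyCohenMacaulay ρ d) (hp : p ≤ d)
    (j : Fin r) : M.aInv (d - p) j ≤ D.t p j + (self 𝒜).aInv d j := by
  refine (aInv_le_iff ρ).2 fun n hn => ?_
  obtain ⟨q, hq⟩ : ∃ q, Nontrivial (H ρ (self 𝒜) d (D.shift p q + n)) := by
    by_contra! h
    exact not_subsingleton_iff_nontrivial.2 (D.toFreeRes.nontrivial_H_F_of_nontrivial hS hp hn)
      ((subsingleton_H_free_iff _ ρ d n).2 h)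
  calc ExtInt.ofInt (n j)
      = ExtInt.ofInt (-D.shift p q j) + ExtInt.ofInt ((D.shift p q + n) j) := by
        rw [← ExtInt.ofInt_add, Pi.add_apply, neg_add_cancel_left]
    _ ≤ D.t p j + (self 𝒜).aInv d j := add_le_add (D.ofInt_le_t p q j) (ofInt_le_aInv ρ hq)

theorem nontrivial_H_of_lexMax_lt [Nontrivial S] (hN : IsNatGraded 𝒜) (h0 : IsConnectedOver k 𝒜)
    (hS : IsCohomologicallyCohenMacaulay ρ d) (hm : IsLexMaxDegree ρ d σ m)
    (hp : D.lexMax σ (p + 1) < D.lexMax σ p) {q₀ : Fin (D.rank p)}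
    (hq₀ : D.lexMax σ p = (D.lexShift σ p q₀ : WithBot (Lex (Fin r → ℤ)))) :
    p ≤ d ∧ Nontrivial (H ρ M (d - p) (m - D.shift p q₀)) := by
  have : Subsingleton (H ρ (D.toFreeRes.F (p + 1)) d (m - D.shift p q₀)) :=
    (subsingleton_H_free_iff _ ρ d _).2 fun q => hm.subsingleton_of_lt (neg_lt_neg_iff.1
      (WithBot.coe_lt_coe.1 ((D.lexShift_le_lexMax σ q).trans_lt (hp.trans_eq hq₀))))
  have : Nontrivial (H ρ (D.toFreeRes.F p) d (m - D.shift p q₀)) := by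
    refine not_subsingleton_iff_nontrivial.1 fun h => ?_
    have subsingleton_summand := (subsingleton_H_free_iff _ ρ d _).1 h q₀
    rw [show D.toFreeRes.shift p q₀ = D.shift p q₀ from rfl, add_sub_cancel]
      at subsingleton_summand
    exact not_subsingleton_iff_nontrivial.2 hm.nontrivial subsingleton_summand
  refine D.toFreeRes.nontrivial_H_of_nontrivial_F hS ?_
  rintro p rfl
  exact D.Hmap_δ_eq_zero hN h0 hm hq₀

variable [Module.Finite S M.carrier]

theorem aStar_le (hS : IsCohomologicallyCohenMacaulay ρ d) (j : Fin r) :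
    M.aStar j ≤ D.tStar j + (self 𝒜).aInv d j := by
  refine iSup₂_le fun i _ => ?_
  obtain hi | hi := le_or_gt i d
  · calc M.aInv i j = M.aInv (d - (d - i)) j := by rw [Nat.sub_sub_self hi]
      _ ≤ D.t (d - i) j + (self 𝒜).aInv d j := D.aInv_le_t_add_aInv_self hS (Nat.sub_le d i) j
      _ ≤ D.tStar j + (self 𝒜).aInv d j := by gcongr; exact D.t_le_tStar _ j
  · exact (aInv_le_iff ρ).2 fun n hn =>
      absurd hn (not_nontrivial_iff_subsingleton.2 (hS.subsingleton_of_gt M i n hi))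

variable [IsNoetherianRing S] [Nontrivial S]

theorem aInv_eq_of_lexMax_lt (hN : IsNatGraded 𝒜) (h0 : IsConnectedOver k 𝒜)
    (hS : IsCohomologicallyCohenMacaulay ρ d) (hσ : σ ⟨0, Fin.pos j⟩ = j)
    (hp : D.lexMax σ (p + 1) < D.lexMax σ p) :
    p ≤ d ∧ ((d - p : ℕ) : WithBot ℕ∞) ≤ Module.supportDim S M.carrier ∧
      M.aInv (d - p) j = D.t p j + (self 𝒜).aInv d j := by
  obtain ⟨m, hm⟩ := exists_isLexMaxDegree hN h0 hS σ
  obtain ⟨q₀, hq₀⟩ := D.exists_lexMax_eq (ne_bot_of_gt hp)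
  obtain ⟨hpd, hM⟩ := D.nontrivial_H_of_lexMax_lt hN h0 hS hm hp hq₀
  have isTame_M : IsTame ρ j M := isTame_of_finite hN (fun c => (h0 _).2 ⟨c, rfl⟩) ρ j M
  refine ⟨hpd, not_lt.1 fun h => not_subsingleton_iff_nontrivial.2 hM
    (isTame_M.subsingleton_of_lt _ _ h), le_antisymm (D.aInv_le_t_add_aInv_self hS hpd j) ?_⟩
  calc D.t p j + (self 𝒜).aInv d j
      ≤ ExtInt.ofInt (-D.shift p q₀ j) + ExtInt.ofInt (m j) :=
        add_le_add (D.t_le_ofInt_of_lexMax_le hσ hq₀.le) (hm.aInv_self_eq hσ).le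
    _ = ExtInt.ofInt ((m - D.shift p q₀) j) := by
        rw [← ExtInt.ofInt_add, Pi.sub_apply, neg_add_eq_sub]
    _ ≤ M.aInv (d - p) j := ofInt_le_aInv ρ hM

/-- The last homological degree in which the `≤_σ`-maximal shift of the whole resolution occurs
satisfies the hypothesis of `aInv_eq_of_lexMax_lt`. -/
theorem aStar_eq (hN : IsNatGraded 𝒜) (h0 : IsConnectedOver k 𝒜)
    (hS : IsCohomologicallyCohenMacaulay ρ d) (j : Fin r) :
    M.aStar j = D.tStar j + (self 𝒜).aInv d j := by
  refine le_antisymm (D.aStar_le hS j) ?_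
  let σ : Equiv.Perm (Fin r) := Equiv.swap ⟨0, Fin.pos j⟩ j
  have hσ : σ ⟨0, Fin.pos j⟩ = j := Equiv.swap_apply_left _ _
  obtain hbot | ⟨p, hp, hmax⟩ := D.forall_lexMax_eq_bot_or_exists_last σ
  · have tStar_eq_bot : D.tStar j = ⊥ := (Finset.sup_eq_bot_iff _ _).2 fun p _ =>
      (Finset.sup_eq_bot_iff _ _).2 fun q _ =>
        absurd (hbot p ▸ D.lexShift_le_lexMax σ q) (not_le.2 (WithBot.bot_lt_coe _))
    rw [tStar_eq_bot, WithBot.bot_add]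
    exact bot_le
  · obtain ⟨_, hdim, heq⟩ := D.aInv_eq_of_lexMax_lt hN h0 hS hσ hp
    obtain ⟨q₀, hq₀⟩ := D.exists_lexMax_eq (ne_bot_of_gt hp)
    calc D.tStar j + (self 𝒜).aInv d j
        ≤ D.t p j + (self 𝒜).aInv d j := by
          gcongr
          exact Finset.sup_le fun p' _ =>
            (D.t_le_ofInt_of_lexMax_le hσ ((hmax p').trans_eq hq₀)).trans (D.ofInt_le_t p q₀ j)
      _ = M.aInv (d - p) j := heq.symm
      _ ≤ M.aStar j := le_iSup₂_of_le (d - p) hdim le_rfl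

end MinFreeRes

end GrMod

theorem theorem1p3p4_general {k : Type v} [Field k] {S : Type u} [CommRing S] [IsNoetherianRing S]
    [Algebra k S] {r : ℕ} (𝒜 : (Fin r → ℤ) → AddSubgroup S) [GradedRing 𝒜]
    (hN : GrMod.IsNatGraded 𝒜) (h0 : GrMod.IsConnectedOver k 𝒜) [(GrMod.maxIdeal 𝒜).IsPrime]
    (hCM : IsCohenMacaulayLocal (Localization.AtPrime (GrMod.maxIdeal 𝒜)))
    (d : ℕ) (hd : ringKrullDim S = d)
    (M : GrMod 𝒜) [Module.Finite S M.carrier] (D : M.MinFreeRes) (j : Fin r) :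
    (∃ α : ℤ, (GrMod.self 𝒜).aInv d j = ExtInt.ofInt α) ∧ (∀ i, M.aInv i j ≠ ⊤) ∧
    (∀ p ≤ d, M.aInv (d - p) j ≤ D.t p j + (GrMod.self 𝒜).aInv d j) ∧
    (∀ (p : ℕ) (σ : Equiv.Perm (Fin r)), σ ⟨0, Fin.pos j⟩ = j →
      D.lexMax σ (p + 1) < D.lexMax σ p →
      p ≤ d ∧ M.aInv (d - p) j = D.t p j + (GrMod.self 𝒜).aInv d j) ∧
    M.aStar j = D.tStar j + (GrMod.self 𝒜).aInv d j := by
  have hk : ∀ c : k, algebraMap k S c ∈ 𝒜 0 := fun c => (h0 _).2 ⟨c, rfl⟩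
  have : Nontrivial S := (Ideal.Quotient.mk (GrMod.maxIdeal 𝒜)).domain_nontrivial
  choose ρ _ using GrMod.exists_injRes hN hk
  have hS := GrMod.isCohomologicallyCohenMacaulay_of_isCohenMacaulayLocal hN h0 hCM hd ρ j
  obtain ⟨m, hm⟩ := GrMod.exists_isLexMaxDegree hN h0 hS (Equiv.swap ⟨0, Fin.pos j⟩ j)
  refine ⟨⟨m j, hm.aInv_self_eq (Equiv.swap_apply_left _ _)⟩,
    (GrMod.isTame_of_finite hN hk ρ j M).aInv_ne_top,
    fun p hp => D.aInv_le_t_add_aInv_self hS hp j, fun p σ hσ hp => ?_, D.aStar_eq hN h0 hS j⟩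
  obtain ⟨hpd, _, heq⟩ := D.aInv_eq_of_lexMax_lt hN h0 hS hσ hp
  exact ⟨hpd, heq⟩

theorem theorem1p3p4 {k : Type v} [Field k] {S : Type u} [CommRing S] [Algebra k S] {r : ℕ}
    (𝒜 : (Fin r → ℤ) → AddSubgroup S) [GradedRing 𝒜]
    (hN : ∀ n : Fin r → ℤ, ¬ 0 ≤ n → 𝒜 n = ⊥)
    (h0 : ∀ x : S, x ∈ 𝒜 0 ↔ ∃ c : k, algebraMap k S c = x)
    (hCM : IsCohenMacaulay S)
    (d : ℕ) (hd : ringKrullDim S = d)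
    (M : GrMod 𝒜) [Module.Finite S M.carrier] (D : M.MinFreeRes) (j : Fin r) :
    -- the maxima that define the invariants exist, and `a^j(S)` is an integer
    (∃ α : ℤ, (GrMod.self 𝒜).aInv d j = ExtInt.ofInt α) ∧ (∀ i, M.aInv i j ≠ ⊤) ∧
    (∀ p : ℕ, (d : WithBot ℕ∞) ≤ Module.supportDim S M.carrier + p →
      (p : ℕ∞) + M.depth ≤ d →
      M.aInv (d - p) j ≤ D.t p j + (GrMod.self 𝒜).aInv d j) ∧
    (∀ (p : ℕ) (σ : Equiv.Perm (Fin r)), σ ⟨0, Fin.pos j⟩ = j →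
      D.lexMax σ (p + 1) < D.lexMax σ p →
      p ≤ d ∧ M.aInv (d - p) j = D.t p j + (GrMod.self 𝒜).aInv d j) ∧
    M.aStar j = D.tStar j + (GrMod.self 𝒜).aInv d j := by
  have : IsNoetherianRing S := hCM.1
  have : Nontrivial S := not_subsingleton_iff_nontrivial.1 fun _ =>
    WithBot.bot_ne_natCast d (ringKrullDim_eq_bot_of_subsingleton.symm.trans hd)
  have : (GrMod.maxIdeal 𝒜).IsPrime := (GrMod.isMaximal_maxIdeal (k := k) hN h0).isPrime
  obtain ⟨hα, hfin, hle, heq⟩ := theorem1p3p4_general 𝒜 hN h0 (hCM.2 _) d hd M D j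
  exact ⟨hα, hfin, fun p _ hp => hle p (by exact_mod_cast le_self_add.trans hp), heq⟩
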